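/- **Setting.** A meandric system of size $n$ is a collection of non-crossing loops in the plane meeting the horizontal axis exactly at the points $1,\dots,2n$, up to continuous deformations of the plane fixing the axis; equivalently, a pair of non-crossing perfect matchings of $\{1,\dots,2n\}$ (the arcs in the upper and in the lower half-plane). A shape $S$ is a single non-crossing loop whose set of intersection points with the axis (its support) is $\{1=i_1<i_2<\dots<i_{2k}=2\ell\}$ for some $k,\ell\ge 1$, with $i_{j+1}-i_j$ odd for all $j$; write $\ell(S)=\ell$. A connected component of a meandric system has shape $S$ if it is a translate of $S$ along the axis. **Constants.** The loop $S$ together with the horizontal axis cuts the plane into two unbounded faces $F_+$ (upper half-plane) and $F_-$ (lower half-plane) and finitely many bounded faces. For a face $F$ let $I(F)$ be the number of integers in $[1,2\ell(S)]$ on the boundary of $F$ but not on $S$, and put $$K=\prod_{F\text{ bounded}}\mathrm{Cat}_{I(F)/2},\qquad c_\pm=I(F_\pm)/2,\qquad \mathrm{Cat}_m=\frac{(2m)!}{m!\,(m+1)!}.$$ Let $I(S)$ be the set of integers $i$ with $1<i\le 2\ell(S)$ such that some meandric system has two components of shape $S$, with leftmost points $1$ and $i$. For $i\in I(S)$ let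 $\ell_i=\ell(S)+\frac{i-1}{2}$, and let $K_i$, $c_\pm(i)$ be defined as $K$, $c_\pm$, but for the union of the two loops $S$ and $S+(i-1)$ and the integers of $[1,2\ell_i]$ (so $\ell_i$, $c_\pm(i)$ may be half-integers). Define the overlap constants $$b_i=4^{\,4\ell(S)-2\ell_i+c_+(i)-2c_++c_-(i)-2c_-}\,\frac{K_i}{K^2}.$$ **Theorem 1.1.** Fix a shape $S$, let $M_n$ be a uniformly random meandric system of size $n$, and let $X_{S,n}$ be the number of connected components of $M_n$ with shape $S$. Then there are constants $\mu_S,\sigma_S>0$ such that $$\frac{X_{S,n}-n\mu_S}{\sigma_S\sqrt n}\xrightarrow[n\to\infty]{(d)}\mathcal N(0,1).$$ Moreover, one can take $$\mu_S=\frac{2K}{4^{2\ell(S)-c_+-c_-}},\qquad \sigma_S^2=\frac{2K}{4^{2\ell(S)-c_+-c_-}}\Bigl(1+\frac{K}{4^{2\ell(S)-c_+-c_-}}\Bigl(1-4\ell(S)+2\sum_{i\in I(S)}b_i\Bigr)\Bigr).$$ This covers both strong shapes ($I(S)=\emptyset$) and weak shapes ($I(S)\ne\emptyset$, i.e. copies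 of $S$ may overlap). -/

import Mathlib

open MeasureTheory ProbabilityTheory Filter

/-- `m` encodes a non-crossing perfect matching of the finite set `V` by arcs in a half-plane:
`m` exchanges the two endpoints of each arc, and it fixes exactly the integers outside `V`. -/
structure IsNCMatching (V : Finset ℕ) (m : ℕ → ℕ) : Prop where
  ne_iff : ∀ x, m x ≠ x ↔ x ∈ V
  invol : ∀ x, m (m x) = x
  noncrossing : ∀ a b, ¬ (a < b ∧ b < m a ∧ m a < m b)

/-- A collection of non-crossing loops in the plane meeting the horizontal axis exactly at the
points of `V` (up to deformations of the plane fixing the axis), given by its arcs in the upper and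
in the lower half-plane. -/
@[ext]
structure LoopSystem (V : Finset ℕ) where
  upper : ℕ → ℕ
  lower : ℕ → ℕ
  upper_nc : IsNCMatching V upper
  lower_nc : IsNCMatching V lower

namespace LoopSystem

variable {V : Finset ℕ}

/-- One can go from `x` to `y` along the arcs, i.e. `x` and `y` are on the same loop. (The relation
is symmetric since `upper` and `lower` are involutions.) -/
def Joined (M : LoopSystem V) (x y : ℕ) : Prop :=
  Relation.ReflTransGen (fun a b => b = M.upper a ∨ b = M.lower a) x y

/-- `C` is (the support of) a connected component of `M`. -/
def IsComponent (M : LoopSystem V) (C : Set ℕ) : Prop :=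
  ∃ x ∈ V, C = {y | M.Joined x y}

end LoopSystem

/-- A meandric system of size `n`: the vertices are `1, …, 2n`. -/
abbrev MeandricSystem (n : ℕ) : Type := LoopSystem (Finset.Icc 1 (2 * n))

/-- A shape: a single loop whose support has least element `1` and greatest element `2ℓ`, and such
that any two consecutive points of the support are at odd distance. -/
structure Shape where
  support : Finset ℕ
  loop : LoopSystem support
  connected : ∀ x ∈ support, ∀ y ∈ support, loop.Joined x y
  /-- The half-length `ℓ`. -/
  halfLength : ℕ
  one_mem : 1 ∈ support
  last_mem : 2 * halfLength ∈ support
  subset_base : support ⊆ Finset.Icc 1 (2 * halfLength)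
  odd_gap : ∀ x ∈ support, ∀ y ∈ support, x < y →
    (∀ z ∈ support, ¬ (x < z ∧ z < y)) → Odd (y - x)

namespace LoopSystem

variable {V : Finset ℕ}

/-- The component of `M` with support `C` has shape `S`: it is a translate of `S`. -/
def HasShape (M : LoopSystem V) (C : Set ℕ) (S : Shape) : Prop :=
  ∃ t : ℕ, C = (fun x => x + t) '' (S.support : Set ℕ) ∧
    ∀ x ∈ S.support, M.upper (x + t) = S.loop.upper x + t ∧
      M.lower (x + t) = S.loop.lower x + t

/-- The number of components of `M` with shape `S`. -/
noncomputable def numComponents (M : LoopSystem V) (S : Shape) : ℕ :=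
  Set.ncard {C : Set ℕ | M.IsComponent C ∧ M.HasShape C S}

/-- `M` has a component of shape `S` whose leftmost vertex is `i`. -/
def HasShapeAt (M : LoopSystem V) (S : Shape) (i : ℕ) : Prop :=
  ∃ C : Set ℕ, M.IsComponent C ∧ M.HasShape C S ∧ IsLeast C i

instance : MeasurableSpace (LoopSystem V) := ⊤

instance : Finite (LoopSystem V) := by
  have key : ∀ m, IsNCMatching V m → ∀ x, x ∈ V → m x ∈ V := by
    intro m h x hx
    rw [← h.ne_iff] at hx ⊢
    rw [h.invol]
    exact hx.symm
  have out : ∀ m, IsNCMatching V m → ∀ x, x ∉ V → m x = x := by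
    intro m h x hx
    by_contra hne
    exact hx ((h.ne_iff x).1 hne)
  refine Finite.of_injective (β := (V → V) × (V → V))
    (fun M => (fun x => ⟨M.upper x, key _ M.upper_nc x x.2⟩,
      fun x => ⟨M.lower x, key _ M.lower_nc x x.2⟩)) ?_
  intro M N h
  simp only [Prod.mk.injEq] at h
  ext x
  · by_cases hx : x ∈ V
    · exact congrArg Subtype.val (congrFun h.1 ⟨x, hx⟩)
    · rw [out _ M.upper_nc x hx, out _ N.upper_nc x hx]
  · by_cases hx : x ∈ V
    · exact congrArg Subtype.val (congrFun h.2 ⟨x, hx⟩)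
    · rw [out _ M.lower_nc x hx, out _ N.lower_nc x hx]

end LoopSystem

instance (n : ℕ) : Nonempty (MeandricSystem n) := by
  have h : IsNCMatching (Finset.Icc 1 (2 * n)) (fun x =>
      if 1 ≤ x ∧ x ≤ 2 * n then (if x % 2 = 1 then x + 1 else x - 1) else x) := by
    refine ⟨fun x => ?_, fun x => ?_, fun a b => ?_⟩
    · simp only [Finset.mem_Icc]
      split_ifs <;> omega
    · split_ifs <;> omega
    · split_ifs <;> omega
  exact ⟨⟨_, _, h, h⟩⟩

/-- The law of a uniformly random meandric system of size `n`. -/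
noncomputable def uniformMeandric (n : ℕ) : Measure (MeandricSystem n) := uniformOn Set.univ

instance (n : ℕ) : IsProbabilityMeasure (uniformMeandric n) :=
  inferInstanceAs (IsProbabilityMeasure (uniformOn Set.univ))

/-! Faces cut out in a half-plane by the axis and the arcs of a non-crossing matching `m`. The
bounded faces correspond to the arcs `{a, m a}` with `a < m a` (the face directly inside the arc).
The integers not on the arcs are those with `m x = x`. -/

/-- The integers off the arcs lying on the boundary of the face directly inside the arc
`{a, m a}`, `a < m a`: this is the innermost arc enclosing them. -/
def innerVertices (m : ℕ → ℕ) (a : ℕ) : Finset ℕ :=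
  (Finset.Ioo a (m a)).filter fun x => m x = x ∧ ∀ b < x, x < m b → b ≤ a

/-- The integers of `[1, R]` off the arcs lying on the boundary of the unbounded face: no arc
encloses them. -/
def outerVertices (m : ℕ → ℕ) (R : ℕ) : Finset ℕ :=
  (Finset.Icc 1 R).filter fun x => m x = x ∧ ∀ b < x, ¬ x < m b

/-- The product of the Catalan numbers `Cat_{I(F)/2}` over the bounded faces `F` of the half-plane,
where `I(F)` is the number of integers off the arcs on the boundary of `F`. -/
def faceProduct (m : ℕ → ℕ) (R : ℕ) : ℕ :=
  ∏ a ∈ (Finset.Icc 1 R).filter (fun a => a < m a), catalan ((innerVertices m a).card / 2)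

/-- The translate by `t` of the matching `m`. -/
def shiftMatching (t : ℕ) (m : ℕ → ℕ) (x : ℕ) : ℕ :=
  if x < t then x else m (x - t) + t

/-- The union of the matching `m` and its translate by `t` (meaningful if their supports are
disjoint). -/
def pairMatching (t : ℕ) (m : ℕ → ℕ) (x : ℕ) : ℕ := m (shiftMatching t m x)

namespace Shape

/-- `K(S)`, the product of `Cat_{I(F)/2}` over all bounded faces `F` of `S`. -/
def K (S : Shape) : ℕ :=
  faceProduct S.loop.upper (2 * S.halfLength) * faceProduct S.loop.lower (2 * S.halfLength)

/-- `c₊(S) = I(F₊)/2`. -/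
noncomputable def cPlus (S : Shape) : ℝ :=
  (outerVertices S.loop.upper (2 * S.halfLength)).card / 2

/-- `c₋(S) = I(F₋)/2`. -/
noncomputable def cMinus (S : Shape) : ℝ :=
  (outerVertices S.loop.lower (2 * S.halfLength)).card / 2

open Classical in
/-- `I(S)`: the `i ≠ 1` such that overlapping components of shape `S` with leftmost vertices
`1` and `i` can occur together in a meandric system. -/
noncomputable def overlaps (S : Shape) : Finset ℕ :=
  (Finset.Ioc 1 (2 * S.halfLength)).filter fun i =>
    ∃ (n : ℕ) (M : MeandricSystem n), M.HasShapeAt S 1 ∧ M.HasShapeAt S i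

/-- `ℓ_i = ℓ(S) + (i - 1)/2`. The base of the overlapping pair is `[1, 2ℓ_i]`. -/
noncomputable def pairHalfLength (S : Shape) (i : ℕ) : ℝ :=
  (S.halfLength : ℝ) + ((i : ℝ) - 1) / 2

/-- `K_i`, the analogue of `K(S)` for the pair of loops of shape `S` started at `1` and `i`. -/
def pairK (S : Shape) (i : ℕ) : ℕ :=
  faceProduct (pairMatching (i - 1) S.loop.upper) (2 * S.halfLength + (i - 1)) *
    faceProduct (pairMatching (i - 1) S.loop.lower) (2 * S.halfLength + (i - 1))

/-- `c₊(i)`, the analogue of `c₊(S)` for the pair (possibly a half-integer). -/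
noncomputable def pairCPlus (S : Shape) (i : ℕ) : ℝ :=
  (outerVertices (pairMatching (i - 1) S.loop.upper) (2 * S.halfLength + (i - 1))).card / 2

/-- `c₋(i)`, the analogue of `c₋(S)` for the pair (possibly a half-integer). -/
noncomputable def pairCMinus (S : Shape) (i : ℕ) : ℝ :=
  (outerVertices (pairMatching (i - 1) S.loop.lower) (2 * S.halfLength + (i - 1))).card / 2

/-- The overlap constant `b_i`. -/
noncomputable def b (S : Shape) (i : ℕ) : ℝ :=
  (4 : ℝ) ^ (4 * (S.halfLength : ℝ) - 2 * S.pairHalfLength i + S.pairCPlus i - 2 * S.cPlus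
    + S.pairCMinus i - 2 * S.cMinus) * (S.pairK i : ℝ) / (S.K : ℝ) ^ 2

/-- `K / 4^{2ℓ(S) - c₊ - c₋}`. -/
noncomputable def density (S : Shape) : ℝ :=
  (S.K : ℝ) / (4 : ℝ) ^ (2 * (S.halfLength : ℝ) - S.cPlus - S.cMinus)

end Shape

/-! A meandric system of size `n` is a pair of Dyck words of length `2n`, one for each side of the
axis. A uniform one is therefore a pair of independent uniform words of fair bits (`coins`)
conditioned on both being Dyck. A component of shape `S` sits at `t` exactly when the translated
arcs of `S` are matched as parentheses in the two words (`Shape.Occurs`). This event reads only a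
window of `2ℓ` letters per word.

The conditioning event has polynomially small probability, and it is removed through generating
functions with positive coefficients. If prescribed arcs occur in a word, being Dyck only constrains
the letters enclosed by none of these arcs, and those are independent of the arcs
(`coins_hasArcs_and_isDyckOn`). So for a set `A` of places, the probability that `S` occurs on all
of `A` and that both words are Dyck is the unconditioned occurrence probability times the
probability that two shorter words, of lengths `2i` and `2j` with `n - ℓ|A| ≤ i, j ≤ n`, are Dyck
(`Shape.coins_occurs_and_bothDyck`). Expanding `(1 + v) ^ X` over subsets `A` and comparing term by
term for `v ≥ 0`, the conditioned generating function is at least the unconditioned one. It is at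
most the unconditioned one at a slightly larger argument, plus an error from large `A` that is
exponentially small at the scale used (`Shape.genFun_le_meandricGenFun`, `Shape.meandricGenFun_le`).
At `v = exp (l / √n) - 1` with `l > 0` the ratio tends to `1`.

Without conditioning, the count is a sum of stationary `2ℓ`-dependent indicators. Cutting it into
independent blocks separated by gaps gives the central limit theorem in Laplace form
(`IsDependentSequence.tendsto_integral_exp`). Only positive Laplace parameters are available, and
they suffice: they give tightness and determine the limit (`tendsto_gaussian_of_tendsto_mgf`).

The constants come from the same face-by-face independence. An occurrence of one shape, or of two
overlapping ones, has a probability that factors over bounded faces into Catalan numbers over powers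
of `2`. The density is the probability of one occurrence, and `b_i` is the pair probability divided
by the squared density. The variance is positive because `4ℓ` times the density is at most `1`
(`Shape.density_mul_le_one`) while all `b_i` are nonnegative. -/

open scoped Topology

/-! ### Laplace transforms on the positive half-line and weak convergence -/

/-- Two probability measures on `ℝ` whose moment generating functions are finite and agree on the
positive half-line are equal. -/
theorem ext_of_mgf_eq_of_pos {μ ν : Measure ℝ} [IsProbabilityMeasure μ] [IsProbabilityMeasure ν]
    (hμ : ∀ s > 0, Integrable (fun x : ℝ => Real.exp (s * x)) μ)
    (hν : ∀ s > 0, Integrable (fun x : ℝ => Real.exp (s * x)) ν)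
    (h : ∀ s > 0, mgf id μ s = mgf id ν s) : μ = ν := by
  have hint : ∀ (ρ : Measure ℝ) [IsProbabilityMeasure ρ],
      (∀ s > 0, Integrable (fun x : ℝ => Real.exp (s * x)) ρ) →
      Set.Ioi (0 : ℝ) ⊆ interior (integrableExpSet id ρ) := by
    intro ρ _ hρ
    refine interior_maximal (fun s hs => ?_) isOpen_Ioi
    exact hρ s hs
  have hopen : IsOpen {z : ℂ | 0 < z.re} := isOpen_lt continuous_const Complex.continuous_re
  have han : ∀ (ρ : Measure ℝ) [IsProbabilityMeasure ρ],
      (∀ s > 0, Integrable (fun x : ℝ => Real.exp (s * x)) ρ) →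
      AnalyticOnNhd ℂ (complexMGF id ρ) {z : ℂ | 0 < z.re} := by
    intro ρ _ hρ z hz
    exact analyticAt_complexMGF (hint ρ hρ hz)
  -- Identity theorem on the right half-plane: both transforms are analytic there and agree at real
  -- points accumulating at `1`.
  have heq : Set.EqOn (complexMGF id μ) (complexMGF id ν) {z : ℂ | 0 < z.re} := by
    refine (han μ hμ).eqOn_of_preconnected_of_frequently_eq (han ν hν)
      (convex_halfSpace_re_gt 0).isPreconnected (z₀ := 1) (by simp) ?_
    have hseq : Tendsto (fun n : ℕ => ((1 + 1 / ((n : ℝ) + 1) : ℝ) : ℂ)) atTop (𝓝[≠] 1) := by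
      refine tendsto_nhdsWithin_iff.2 ⟨?_, Eventually.of_forall fun n => ?_⟩
      · have h1 : Tendsto (fun n : ℕ => (1 + 1 / ((n : ℝ) + 1) : ℝ)) atTop (𝓝 (1 + 0)) :=
          tendsto_const_nhds.add tendsto_one_div_add_atTop_nhds_zero_nat
        have h2 := (Complex.continuous_ofReal.tendsto (1 + 0 : ℝ)).comp h1
        simp only [add_zero, Complex.ofReal_one] at h2
        exact h2
      · have : (0 : ℝ) < 1 / ((n : ℝ) + 1) := by positivity
        simp only [Set.mem_compl_iff, Set.mem_singleton_iff]
        intro hc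
        have : (1 + 1 / ((n : ℝ) + 1) : ℝ) = 1 := by exact_mod_cast hc
        linarith
    refine hseq.frequently (Eventually.of_forall fun n => ?_).frequently
    rw [complexMGF_ofReal, complexMGF_ofReal, h]
    positivity
  -- Letting the real part decrease to `0` recovers the characteristic function; it stays in `(0,
  -- 1]`, so `1 + exp x` dominates.
  have hlim : ∀ (ρ : Measure ℝ) [IsProbabilityMeasure ρ],
      (∀ s > 0, Integrable (fun x : ℝ => Real.exp (s * x)) ρ) → ∀ t : ℝ,
      Tendsto (fun n : ℕ => complexMGF id ρ ((1 / ((n : ℝ) + 1) : ℝ) + t * Complex.I)) atTop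
        (𝓝 (charFun ρ t)) := by
    intro ρ _ hρ t
    rw [← complexMGF_id_mul_I]
    unfold complexMGF
    refine tendsto_integral_of_dominated_convergence (fun x => 1 + Real.exp (1 * x)) ?_ ?_ ?_ ?_
    · intro n
      exact (by fun_prop : Measurable _).aestronglyMeasurable
    · exact (integrable_const 1).add (hρ 1 one_pos)
    · intro n
      refine Eventually.of_forall fun x => ?_
      have h0 : (0 : ℝ) < 1 / ((n : ℝ) + 1) := by positivity
      have h1 : 1 / ((n : ℝ) + 1) ≤ 1 := by
        rw [div_le_one (by positivity)]
        have : (0 : ℝ) ≤ n := n.cast_nonneg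
        linarith
      rw [Complex.norm_exp]
      have hre : (((1 / ((n : ℝ) + 1) : ℝ) + t * Complex.I) * ((id x : ℝ) : ℂ)).re
          = 1 / ((n : ℝ) + 1) * x := by
        simp only [id, Complex.mul_re, Complex.add_re, Complex.ofReal_re, Complex.I_re,
          Complex.ofReal_im, Complex.I_im, mul_zero, sub_zero, add_zero, mul_one]
      rw [hre]
      rcases le_total 0 x with hx | hx
      · have : Real.exp (1 / ((n : ℝ) + 1) * x) ≤ Real.exp (1 * x) :=
          Real.exp_le_exp.2 (mul_le_mul_of_nonneg_right h1 hx)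
        linarith
      · have : Real.exp (1 / ((n : ℝ) + 1) * x) ≤ 1 :=
          Real.exp_le_one_iff.2 (mul_nonpos_of_nonneg_of_nonpos h0.le hx)
        have := Real.exp_pos (1 * x)
        linarith
    · refine Eventually.of_forall fun x => ?_
      have h1 : Tendsto (fun n : ℕ => ((1 / ((n : ℝ) + 1) : ℝ) : ℂ)) atTop (𝓝 ((0 : ℝ) : ℂ)) :=
        (Complex.continuous_ofReal.tendsto 0).comp tendsto_one_div_add_atTop_nhds_zero_nat
      have h2 := (h1.add_const ((t : ℂ) * Complex.I)).mul_const ((id x : ℝ) : ℂ)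
      simp only [Complex.ofReal_zero, zero_add] at h2
      exact (Complex.continuous_exp.tendsto _).comp h2
  refine Measure.ext_of_charFun (funext fun t => ?_)
  refine tendsto_nhds_unique (hlim μ hμ t) ((hlim ν hν t).congr fun n => ?_)
  refine (heq ?_).symm
  simp only [Set.mem_ofPred_eq, Complex.add_re, Complex.ofReal_re, Complex.mul_re, Complex.I_re,
    Complex.ofReal_im, Complex.I_im]
  have : (0 : ℝ) < 1 / ((n : ℝ) + 1) := by positivity
  simpa using this

/-- Weak convergence together with boundedness of the moment generating functions at `2 * s` gives
convergence of the moment generating functions at `s`. -/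
theorem mgf_eq_of_tendsto_of_tendsto_mgf {ι : Type*} {F : Filter ι} [F.NeBot]
    {P : ι → ProbabilityMeasure ℝ} {ν : ProbabilityMeasure ℝ} (hP : Tendsto P F (𝓝 ν))
    {s a b : ℝ}
    (h1 : ∀ i, Integrable (fun x : ℝ => Real.exp (s * x)) (P i : Measure ℝ))
    (h2 : ∀ i, Integrable (fun x : ℝ => Real.exp (2 * s * x)) (P i : Measure ℝ))
    (ha : Tendsto (fun i => mgf id (P i : Measure ℝ) s) F (𝓝 a))
    (hb : Tendsto (fun i => mgf id (P i : Measure ℝ) (2 * s)) F (𝓝 b)) :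
    Integrable (fun x : ℝ => Real.exp (s * x)) (ν : Measure ℝ) ∧ mgf id (ν : Measure ℝ) s = a := by
  have hcont : ∀ K : ℕ, Continuous fun x : ℝ => min (Real.exp (s * x)) (K : ℝ) :=
    fun K => by fun_prop
  let g : ℕ → BoundedContinuousFunction ℝ ℝ := fun K =>
    BoundedContinuousFunction.ofNormedAddCommGroup (fun x => min (Real.exp (s * x)) (K : ℝ))
      (hcont K) K (fun x => by
        rw [Real.norm_eq_abs, abs_of_nonneg (le_min (Real.exp_pos _).le K.cast_nonneg)]
        exact min_le_right _ _)
  have hg : ∀ K x, g K x = min (Real.exp (s * x)) (K : ℝ) := fun _ _ => rfl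
  have hlim : ∀ K, Tendsto (fun i => ∫ x, g K x ∂(P i : Measure ℝ)) F
      (𝓝 (∫ x, g K x ∂(ν : Measure ℝ))) := fun K =>
    (ProbabilityMeasure.tendsto_iff_forall_integral_tendsto.1 hP) (g K)
  have hup : ∀ K, ∫ x, g K x ∂(ν : Measure ℝ) ≤ a := by
    intro K
    refine le_of_tendsto_of_tendsto' (hlim K) ha fun i => ?_
    refine integral_mono ((g K).integrable _) (h1 i) fun x => ?_
    exact min_le_left _ _
  -- Truncating `y = exp (s x)` at `K` loses at most `y ^ 2 / K`, so the transform at `2 * s` bounds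
  -- the loss uniformly along the filter.
  have hlo : ∀ K : ℕ, 0 < K → a - b / K ≤ ∫ x, g K x ∂(ν : Measure ℝ) := by
    intro K hK
    refine le_of_tendsto_of_tendsto' (ha.sub (hb.div_const (K : ℝ))) (hlim K) fun i => ?_
    have hK' : (0 : ℝ) < K := by exact_mod_cast hK
    have : mgf id (P i : Measure ℝ) s - mgf id (P i : Measure ℝ) (2 * s) / K
        = ∫ x, (Real.exp (s * x) - Real.exp (2 * s * x) / K) ∂(P i : Measure ℝ) := by
      rw [integral_sub (h1 i) ((h2 i).div_const _), integral_div]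
      rfl
    rw [this]
    refine integral_mono ((h1 i).sub ((h2 i).div_const _)) ((g K).integrable _) fun x => ?_
    have hsq : Real.exp (2 * s * x) = Real.exp (s * x) ^ 2 := by
      rw [← Real.exp_nat_mul]; congr 1; push_cast; ring
    simp only [hg, hsq]
    have he := Real.exp_pos (s * x)
    rcases le_total (Real.exp (s * x)) K with h | h
    · rw [min_eq_left h]
      have : 0 ≤ Real.exp (s * x) ^ 2 / K := by positivity
      linarith
    · rw [min_eq_right h]
      have h3 : Real.exp (s * x) * K ≤ Real.exp (s * x) ^ 2 := by nlinarith
      have h4 : Real.exp (s * x) ≤ Real.exp (s * x) ^ 2 / K := by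
        rw [le_div_iff₀ hK']; exact h3
      linarith
  have hpt : ∀ x, Tendsto (fun K => g K x) atTop (𝓝 (Real.exp (s * x))) := by
    intro x
    refine tendsto_const_nhds.congr' ?_
    filter_upwards [eventually_ge_atTop ⌈Real.exp (s * x)⌉₊] with K hK
    rw [hg, min_eq_left (Nat.ceil_le.1 hK)]
  -- Fatou's lemma applied to the truncations, whose integrals are at most `a`.
  have hI : Integrable (fun x : ℝ => Real.exp (s * x)) (ν : Measure ℝ) := by
    refine ⟨(by fun_prop : Measurable _).aestronglyMeasurable, ?_⟩
    rw [hasFiniteIntegral_iff_ofReal (Eventually.of_forall fun x => (Real.exp_pos _).le)]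
    refine lt_of_le_of_lt ?_ (ENNReal.ofReal_lt_top (r := a))
    have hF := lintegral_liminf_le (μ := (ν : Measure ℝ)) (u := atTop)
      (f := fun (K : ℕ) x => ENNReal.ofReal (g K x))
      (fun K => ENNReal.measurable_ofReal.comp (g K).continuous.measurable)
    have hl : ∀ x, liminf (fun K => ENNReal.ofReal (g K x)) atTop
        = ENNReal.ofReal (Real.exp (s * x)) := fun x =>
      ((ENNReal.continuous_ofReal.tendsto _).comp (hpt x)).liminf_eq
    simp only [hl] at hF
    refine hF.trans ?_
    refine (liminf_le_liminf (Eventually.of_forall fun K => ?_)).trans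
      (liminf_const (ENNReal.ofReal a)).le
    change _ ≤ ENNReal.ofReal a
    rw [← ofReal_integral_eq_lintegral_ofReal ((g K).integrable _)
      (Eventually.of_forall fun x => le_min (Real.exp_pos _).le K.cast_nonneg)]
    exact ENNReal.ofReal_le_ofReal (hup K)
  refine ⟨hI, ?_⟩
  have hD : Tendsto (fun K => ∫ x, g K x ∂(ν : Measure ℝ)) atTop
      (𝓝 (∫ x, Real.exp (s * x) ∂(ν : Measure ℝ))) := by
    refine tendsto_integral_of_dominated_convergence (fun x => Real.exp (s * x)) ?_ hI ?_ ?_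
    · exact fun K => (g K).continuous.aestronglyMeasurable
    · intro K
      refine Eventually.of_forall fun x => ?_
      rw [hg, Real.norm_eq_abs, abs_of_nonneg (le_min (Real.exp_pos _).le K.cast_nonneg)]
      exact min_le_left _ _
    · exact Eventually.of_forall hpt
  refine le_antisymm (le_of_tendsto' hD hup) ?_
  have hz : Tendsto (fun K : ℕ => a - b / K) atTop (𝓝 (a - 0)) :=
    tendsto_const_nhds.sub (tendsto_const_div_atTop_nhds_zero_nat b)
  rw [sub_zero] at hz
  refine le_of_tendsto_of_tendsto hz hD ?_
  filter_upwards [eventually_gt_atTop 0] with K hK using hlo K hK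

/-- Both tails are controlled with positive parameters only: if `|x| > r` and `s * r ≥ log 2`, then
`exp (s x)` is at least `2` or at most `1/2`, so `4 * (1 - exp (s x)) ^ 2 ≥ 1`. The expectation of
this function involves the transforms at `s` and `2 * s`, and its limit is small for small `s`. -/
theorem isTightMeasureSet_of_tendsto_mgf_gaussian {P : ℕ → ProbabilityMeasure ℝ}
    (hI : ∀ n, ∀ s > 0, Integrable (fun x : ℝ => Real.exp (s * x)) (P n : Measure ℝ))
    (h : ∀ s > 0, Tendsto (fun n => mgf id (P n : Measure ℝ) s) atTop
      (𝓝 (Real.exp (s ^ 2 / 2)))) :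
    IsTightMeasureSet (Set.range fun n => (P n : Measure ℝ)) := by
  have key : ∀ n, ∀ s > 0, ∀ r, Real.log 2 ≤ s * r →
      (P n : Measure ℝ).real {x | r < ‖x‖} ≤
        4 * (1 - 2 * mgf id (P n : Measure ℝ) s + mgf id (P n : Measure ℝ) (2 * s)) := by
    intro n s hs r hr
    have h2s := hI n (2 * s) (by positivity)
    have h1s := hI n s hs
    have e : 4 * (1 - 2 * mgf id (P n : Measure ℝ) s + mgf id (P n : Measure ℝ) (2 * s))
        = ∫ x, 4 * (1 - 2 * Real.exp (s * x) + Real.exp (2 * s * x)) ∂(P n : Measure ℝ) := by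
      rw [integral_const_mul, integral_add, integral_sub, integral_const_mul]
      · simp [mgf]
      · exact integrable_const _
      · exact h1s.const_mul _
      · exact (integrable_const _).sub (h1s.const_mul _)
      · exact h2s
    have hm : MeasurableSet {x : ℝ | r < ‖x‖} := measurableSet_lt measurable_const measurable_norm
    rw [e, ← integral_indicator_one hm]
    refine integral_mono_of_nonneg (Eventually.of_forall fun x => ?_)
      ((((integrable_const _).sub (h1s.const_mul _)).add h2s).const_mul _)
      (Eventually.of_forall fun x => ?_)
    · exact Set.indicator_nonneg (fun _ _ => zero_le_one) x
    · have hsq : Real.exp (2 * s * x) = Real.exp (s * x) ^ 2 := by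
        rw [← Real.exp_nat_mul]; congr 1; push_cast; ring
      have hx : 4 * (1 - 2 * Real.exp (s * x) + Real.exp (2 * s * x))
          = 4 * (1 - Real.exp (s * x)) ^ 2 := by rw [hsq]; ring
      simp only [hx]
      by_cases hxm : r < ‖x‖
      · rw [Set.indicator_of_mem (show x ∈ {x : ℝ | r < ‖x‖} from hxm)]
        rw [Real.norm_eq_abs, lt_abs] at hxm
        simp only [Pi.one_apply]
        rcases hxm with hxm | hxm
        · have : Real.exp (Real.log 2) ≤ Real.exp (s * x) :=
            Real.exp_le_exp.2 (by nlinarith)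
          rw [Real.exp_log two_pos] at this
          nlinarith
        · have : Real.exp (s * x) ≤ Real.exp (- Real.log 2) :=
            Real.exp_le_exp.2 (by nlinarith)
          rw [Real.exp_neg, Real.exp_log two_pos] at this
          nlinarith
      · rw [Set.indicator_of_notMem (show x ∉ {x : ℝ | r < ‖x‖} from hxm)]
        positivity
  refine isTightMeasureSet_range_of_tendsto_limsup_measure_norm_gt ?_
  rw [ENNReal.tendsto_atTop_zero]
  intro ε hε
  obtain ⟨δ, hδ, hδε⟩ : ∃ δ : ℝ, 0 < δ ∧ ENNReal.ofReal δ ≤ ε := by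
    rcases eq_or_ne ε ⊤ with rfl | hne
    · exact ⟨1, one_pos, le_top⟩
    · exact ⟨ε.toReal, ENNReal.toReal_pos hε.ne' hne, ENNReal.ofReal_toReal_le⟩
  obtain ⟨s, hs, hsδ⟩ : ∃ s : ℝ, 0 < s ∧
      4 * (1 - 2 * Real.exp (s ^ 2 / 2) + Real.exp ((2 * s) ^ 2 / 2)) < δ := by
    have hc : Continuous fun s : ℝ =>
        4 * (1 - 2 * Real.exp (s ^ 2 / 2) + Real.exp ((2 * s) ^ 2 / 2)) := by fun_prop
    have h0 := (hc.tendsto 0).mono_left (nhdsWithin_le_nhds (s := Set.Ioi 0))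
    have h1 : (4 * (1 - 2 * Real.exp ((0 : ℝ) ^ 2 / 2) + Real.exp ((2 * 0 : ℝ) ^ 2 / 2))) < δ := by
      norm_num [hδ]
    obtain ⟨s, h2, h3⟩ := ((h0.eventually (gt_mem_nhds h1)).and self_mem_nhdsWithin).exists
    exact ⟨s, h3, h2⟩
  refine ⟨Real.log 2 / s, fun r hr => ?_⟩
  have hr' : Real.log 2 ≤ s * r := by
    rw [ge_iff_le, div_le_iff₀ hs] at hr
    linarith
  refine le_trans ?_ hδε
  have ht : Tendsto (fun n => 4 * (1 - 2 * mgf id (P n : Measure ℝ) s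
      + mgf id (P n : Measure ℝ) (2 * s))) atTop
      (𝓝 (4 * (1 - 2 * Real.exp (s ^ 2 / 2) + Real.exp ((2 * s) ^ 2 / 2)))) :=
    (((h s hs).const_mul 2).const_sub 1 |>.add (h (2 * s) (by positivity))).const_mul 4
  refine limsup_le_of_le (by isBoundedDefault) ?_
  filter_upwards [ht.eventually (gt_mem_nhds hsδ)] with n hn
  rw [← ofReal_measureReal]
  exact ENNReal.ofReal_le_ofReal ((key n s hs r hr').trans hn.le)

/-- Convergence of the moment generating functions on the positive half-line to that of the
standard normal law implies weak convergence. -/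
theorem tendsto_gaussian_of_tendsto_mgf {P : ℕ → ProbabilityMeasure ℝ}
    (hI : ∀ n, ∀ s > 0, Integrable (fun x : ℝ => Real.exp (s * x)) (P n : Measure ℝ))
    (h : ∀ s > 0, Tendsto (fun n => mgf id (P n : Measure ℝ) s) atTop
      (𝓝 (Real.exp (s ^ 2 / 2)))) :
    Tendsto P atTop (𝓝 ⟨gaussianReal 0 1, inferInstance⟩) := by
  have hT := isTightMeasureSet_of_tendsto_mgf_gaussian hI h
  -- Tightness provides a limit along every ultrafilter; its Laplace transform identifies it as the
  -- normal law.
  refine (Filter.tendsto_iff_ultrafilter _ _ _).2 fun U hU => ?_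
  have h_compact : IsCompact (closure (Set.range P)) :=
    isCompact_closure_of_isTightMeasureSet (by
      refine hT.subset ?_
      rintro _ ⟨μ, ⟨n, rfl⟩, rfl⟩
      exact ⟨n, rfl⟩)
  obtain ⟨ν, -, hν⟩ := h_compact.ultrafilter_le_nhds (U.map P)
    (.trans (by simp) (monotone_principal subset_closure))
  have hν' : Tendsto P U (𝓝 ν) := hν
  have hs : ∀ s > 0, Integrable (fun x : ℝ => Real.exp (s * x)) (ν : Measure ℝ) ∧
      mgf id (ν : Measure ℝ) s = Real.exp (s ^ 2 / 2) := fun s hs =>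
    mgf_eq_of_tendsto_of_tendsto_mgf hν' (fun n => hI n s hs)
      (fun n => hI n (2 * s) (by positivity)) ((h s hs).mono_left hU)
      ((h (2 * s) (by positivity)).mono_left hU)
  have he : ν = ⟨gaussianReal 0 1, inferInstance⟩ := by
    apply Subtype.ext
    refine ext_of_mgf_eq_of_pos (μ := (ν : Measure ℝ)) (ν := gaussianReal 0 1)
      (fun s h0 => (hs s h0).1)
      (fun s _ => integrable_exp_mul_gaussianReal s) (fun s h0 => ?_)
    refine (hs s h0).2.trans ?_
    rw [mgf_id_gaussianReal]
    simp
  rw [← he]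
  exact hν'

/-! ### Words, Dyck words and their arcs -/

/-- The step of the word `u` at `x`: up for the left end of an arc, down for a right end. -/
def wordStep (u : ℕ → Bool) (x : ℕ) : ℤ := if u x then 1 else -1

/-- The restriction of the word `u` to `U` is a Dyck word. -/
def IsDyckOn (U : Finset ℕ) (u : ℕ → Bool) : Prop :=
  (∀ j, 0 ≤ ∑ x ∈ U with x ≤ j, wordStep u x) ∧ ∑ x ∈ U, wordStep u x = 0

/-- The letters `a` and `b` of the word `u` are matched as parentheses. -/
def IsArc (u : ℕ → Bool) (a b : ℕ) : Prop :=
  a < b ∧ u a = true ∧ u b = false ∧ IsDyckOn (Finset.Ioo a b) u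

theorem IsDyckOn.congr {U : Finset ℕ} {u v : ℕ → Bool} (h : IsDyckOn U u)
    (huv : ∀ x ∈ U, u x = v x) : IsDyckOn U v := by
  have hs : ∀ x ∈ U, wordStep v x = wordStep u x := fun x hx => by simp [wordStep, huv x hx]
  refine ⟨fun j => ?_, ?_⟩
  · rw [Finset.sum_congr rfl fun x hx => hs x (Finset.mem_filter.1 hx).1]
    exact h.1 j
  · rw [Finset.sum_congr rfl hs]
    exact h.2

theorem isDyckOn_congr {U : Finset ℕ} {u v : ℕ → Bool} (huv : ∀ x ∈ U, u x = v x) :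
    IsDyckOn U u ↔ IsDyckOn U v :=
  ⟨fun h => h.congr huv, fun h => h.congr fun x hx => (huv x hx).symm⟩

theorem isArc_congr {u v : ℕ → Bool} {a b : ℕ} (huv : ∀ x ∈ Finset.Icc a b, u x = v x) :
    IsArc u a b ↔ IsArc v a b := by
  unfold IsArc
  by_cases hab : a < b
  · rw [huv a (by simp [hab.le]), huv b (by simp [hab.le]),
      isDyckOn_congr fun x hx => huv x (Finset.Ioo_subset_Icc_self hx)]
  · simp [hab]

theorem sum_Ioo_split (f : ℕ → ℤ) {a c b : ℕ} (h1 : a < c) (h2 : c < b) :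
    ∑ x ∈ Finset.Ioo a b, f x = ∑ x ∈ Finset.Ioo a c, f x + f c + ∑ x ∈ Finset.Ioo c b, f x := by
  have : Finset.Ioo a b = (Finset.Ioo a c ∪ {c}) ∪ Finset.Ioo c b := by
    ext x; simp only [Finset.mem_Ioo, Finset.mem_union, Finset.mem_singleton]; omega
  rw [this, Finset.sum_union, Finset.sum_union, Finset.sum_singleton]
  · rw [Finset.disjoint_left]; intro x; simp only [Finset.mem_Ioo, Finset.mem_singleton]; omega
  · rw [Finset.disjoint_left]; intro x
    simp only [Finset.mem_Ioo, Finset.mem_union, Finset.mem_singleton]; omega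

theorem IsDyckOn.sum_Ioo_nonneg {u : ℕ → Bool} {a b c : ℕ} (h : IsDyckOn (Finset.Ioo a b) u)
    (hc : c ≤ b) : 0 ≤ ∑ x ∈ Finset.Ioo a c, wordStep u x := by
  rcases Nat.eq_zero_or_pos c with rfl | h0
  · simp
  · have := h.1 (c - 1)
    rwa [show (Finset.Ioo a b).filter (· ≤ c - 1) = Finset.Ioo a c by
      ext x; simp only [Finset.mem_filter, Finset.mem_Ioo]; omega] at this

theorem IsDyckOn.sum_Ioc_nonneg {u : ℕ → Bool} {a b c : ℕ} (h : IsDyckOn (Finset.Ioo a b) u)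
    (hac : a < c) (hc : c < b) : 0 ≤ ∑ x ∈ Finset.Ioo a c, wordStep u x + wordStep u c := by
  have h1 := h.sum_Ioo_nonneg (c := c + 1) hc
  rw [sum_Ioo_split _ hac (Nat.lt_succ_self c)] at h1
  simpa [show Finset.Ioo c (c + 1) = ∅ by ext x; simp] using h1

theorem wordStep_true {u : ℕ → Bool} {a : ℕ} (h : u a = true) : wordStep u a = 1 := by
  simp [wordStep, h]

theorem wordStep_false {u : ℕ → Bool} {a : ℕ} (h : u a = false) : wordStep u a = -1 := by
  simp [wordStep, h]

namespace IsArc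

variable {u : ℕ → Bool} {a b c d : ℕ}

/-- If `b < c`, the path inside the longer arc would be at height `0` just before `b` and at `-1`
after it. -/
theorem right_unique (h : IsArc u a b) (h' : IsArc u a c) : b = c := by
  have key : ∀ {b c}, IsArc u a b → IsArc u a c → ¬ b < c := by
    intro b c h h' hbc
    have h1 := h'.2.2.2.sum_Ioc_nonneg h.1 hbc
    rw [h.2.2.2.2, wordStep_false h.2.2.1] at h1
    omega
  exact le_antisymm (not_lt.1 (key h' h)) (not_lt.1 (key h h'))

theorem left_unique (h : IsArc u a c) (h' : IsArc u b c) : a = b := by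
  have key : ∀ {a b}, IsArc u a c → IsArc u b c → ¬ a < b := by
    intro a b h h' hab
    have h1 := h.2.2.2.2
    rw [sum_Ioo_split _ hab h'.1, h'.2.2.2.2, wordStep_true h'.2.1] at h1
    have h2 := h.2.2.2.sum_Ioo_nonneg h'.1.le
    omega
  exact le_antisymm (not_lt.1 (key h' h)) (not_lt.1 (key h h'))

/-- In a crossing, the interior of the first arc would have sum at least `1`: nonnegative before
`c`, an up step at `c`, and nonnegative after it as a prefix of the second arc's interior. -/
theorem not_crossing (h : IsArc u a b) (h' : IsArc u c d) : ¬ (a < c ∧ c < b ∧ b < d) := by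
  rintro ⟨h1, h2, h3⟩
  have h4 := h.2.2.2.2
  rw [sum_Ioo_split _ h1 h2, wordStep_true h'.2.1] at h4
  have h5 := h.2.2.2.sum_Ioo_nonneg h2.le
  have h6 := h'.2.2.2.sum_Ioo_nonneg h3.le
  omega

end IsArc

/-! ### Non-crossing matchings and Dyck words -/

namespace IsNCMatching

variable {V : Finset ℕ} {m : ℕ → ℕ}

theorem mem_of_mem (h : IsNCMatching V m) {x : ℕ} (hx : x ∈ V) : m x ∈ V := by
  rw [← h.ne_iff] at hx ⊢
  rw [h.invol]
  exact hx.symm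

theorem eq_of_notMem (h : IsNCMatching V m) {x : ℕ} (hx : x ∉ V) : m x = x := by
  by_contra hne
  exact hx ((h.ne_iff x).1 hne)

theorem mem_of_lt (h : IsNCMatching V m) {x : ℕ} (hx : x < m x) : x ∈ V :=
  (h.ne_iff x).1 hx.ne'

/-- The interior of an arc is stable under the matching. -/
theorem mem_Ioo (h : IsNCMatching V m) {a x : ℕ} (hx : x ∈ Finset.Ioo a (m a)) :
    m x ∈ Finset.Ioo a (m a) := by
  rw [Finset.mem_Ioo] at hx ⊢
  have h1 := h.noncrossing a x
  have h2 := h.noncrossing (m x) a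
  rw [h.invol] at h2
  have h3 : m x ≠ a := fun e => by have := h.invol x; rw [e] at this; omega
  have h4 : m x ≠ m a := fun e => by
    have := h.invol x; rw [e, h.invol] at this; omega
  omega

/-- The word of a non-crossing matching, restricted to a stable set of moved points, is Dyck. -/
theorem isDyckOn (h : IsNCMatching V m) {U : Finset ℕ} (hUV : U ⊆ V) (hU : ∀ x ∈ U, m x ∈ U)
    {u : ℕ → Bool} (hu : ∀ x ∈ U, u x = decide (x < m x)) : IsDyckOn U u := by
  have hne : ∀ x ∈ U, m x ≠ x := fun x hx => (h.ne_iff x).2 (hUV hx)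
  have hs : ∀ x ∈ U, wordStep u x = if x < m x then 1 else -1 := by
    intro x hx; simp [wordStep, hu x hx]
  constructor
  · intro j
    rw [Finset.sum_congr rfl fun x hx => hs x (Finset.mem_filter.1 hx).1, Finset.sum_ite,
      Finset.sum_const, Finset.sum_const]
    have : ((U.filter (· ≤ j)).filter fun x => ¬ x < m x).card
        ≤ ((U.filter (· ≤ j)).filter fun x => x < m x).card := by
      refine Finset.card_le_card_of_injOn m (fun x hx => ?_) (fun x _ y _ hxy => ?_)
      · simp only [Finset.coe_filter, Finset.mem_filter, Set.mem_ofPred_eq] at hx ⊢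
        have := hne x hx.1.1
        rw [h.invol]
        exact ⟨⟨hU x hx.1.1, by omega⟩, by omega⟩
      · have := congrArg m hxy
        rwa [h.invol, h.invol] at this
    simp only [nsmul_eq_mul]
    have : (((U.filter (· ≤ j)).filter fun x => ¬ x < m x).card : ℤ)
        ≤ ((U.filter (· ≤ j)).filter fun x => x < m x).card := by exact_mod_cast this
    linarith
  · refine Finset.sum_involution (fun x _ => m x) ?_ ?_ ?_ ?_
    · intro x hx
      rw [hs x hx, hs _ (hU x hx), h.invol]
      have := hne x hx
      split_ifs <;> omega
    · exact fun x hx _ => hne x hx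
    · exact fun x hx => hU x hx
    · exact fun x _ => h.invol x

theorem isArc (h : IsNCMatching V m) {u : ℕ → Bool} (hu : ∀ x ∈ V, u x = decide (x < m x))
    {a : ℕ} (ha : a < m a) (hV : Finset.Ioo a (m a) ⊆ V) : IsArc u a (m a) := by
  refine ⟨ha, ?_, ?_, h.isDyckOn hV (fun x hx => h.mem_Ioo hx) fun x hx => hu x (hV hx)⟩
  · rw [hu a (h.mem_of_lt ha)]; simpa using ha
  · rw [hu _ (h.mem_of_mem (h.mem_of_lt ha)), h.invol]; simpa using ha.le

end IsNCMatching

theorem sum_filter_le_insert_pair {U : Finset ℕ} {c d : ℕ} (hcd : c < d) (hc : c ∉ U) (hd : d ∉ U)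
    (f : ℕ → ℤ) (hf : f c + f d = 0) (j : ℕ) :
    ∑ x ∈ insert c (insert d U) with x ≤ j, f x
      = ∑ x ∈ U with x ≤ j, f x + if c ≤ j ∧ j < d then f c else 0 := by
  have hc' : c ∉ insert d U := by simp [hc, hcd.ne]
  rw [Finset.sum_filter, Finset.sum_insert hc', Finset.sum_insert hd, Finset.sum_filter]
  split_ifs <;> omega

/-- An arc between two adjacent points can be added to a non-crossing matching. -/
theorem IsNCMatching.insert_pair {V : Finset ℕ} {m : ℕ → ℕ} (h : IsNCMatching V m) {c d : ℕ}
    (hcd : c < d) (hc : c ∉ V) (hd : d ∉ V) (hgap : ∀ x ∈ V, ¬ (c ≤ x ∧ x < d)) :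
    IsNCMatching (insert c (insert d V)) (fun x => if x = c then d else if x = d then c else m x)
    where
  ne_iff x := by
    simp only [Finset.mem_insert]
    rw [← h.ne_iff x]
    split_ifs with h1 h2
    · simp [h1, hcd.ne']
    · simp [h2, hcd.ne]
    · simp [h1, h2]
  invol x := by
    have e1 : m x = c → x = c := fun hx => by rw [← h.invol x, hx, h.eq_of_notMem hc]
    have e2 : m x = d → x = d := fun hx => by rw [← h.invol x, hx, h.eq_of_notMem hd]
    have e3 := h.invol x
    by_cases h1 : x = c
    · simp [h1]
    · by_cases h2 : x = d
      · simp [h2]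
      · have f1 : m x ≠ c := fun hx => h1 (e1 hx)
        have f2 : m x ≠ d := fun hx => h2 (e2 hx)
        simp [h1, h2, f1, f2, e3]
  noncrossing a b := by
    have hV : ∀ x, m x ≠ x → x < c ∨ d < x := by
      intro x hx
      have hxV := (h.ne_iff x).1 hx
      have h1 := hgap x hxV
      have h2 : x ≠ d := fun e => hd (e ▸ hxV)
      omega
    have n1 := h.noncrossing a b
    have ga := hV a
    have gb := hV b
    have ga' := hV (m a)
    have gb' := hV (m b)
    rw [h.invol] at ga' gb'
    clear hV hgap h hc hd
    generalize m a = p at *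
    generalize m b = q at *
    rintro ⟨h1, h2, h3⟩
    split_ifs at h2 h3 <;> omega

/-- Every Dyck word comes from a non-crossing matching. -/
theorem IsDyckOn.exists_matching {U : Finset ℕ} {u : ℕ → Bool} (h : IsDyckOn U u) :
    ∃ m, IsNCMatching U m ∧ ∀ x ∈ U, u x = decide (x < m x) := by
  induction hn : U.card using Nat.strong_induction_on generalizing U with
  | _ n ih =>
  rcases U.eq_empty_or_nonempty with rfl | hne
  · exact ⟨id, ⟨by simp, by simp, by simp; intros; omega⟩, by simp⟩
  have hdown : (U.filter fun x => u x = false).Nonempty := by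
    by_contra hemp
    rw [Finset.not_nonempty_iff_eq_empty, Finset.filter_eq_empty_iff] at hemp
    have h2 := h.2
    rw [Finset.sum_congr rfl fun x hx => wordStep_true (u := u) (a := x)
      (by simpa using hemp hx)] at h2
    simp at h2
    exact hne.ne_empty h2
  -- Let `d` be the first down letter and `c` the point of `U` just before it, necessarily an up
  -- letter. They are adjacent in `U`, so they are matched and deleted, and the induction applies to
  -- the rest.
  set d := (U.filter fun x => u x = false).min' hdown with hd
  have hdm := Finset.min'_mem _ hdown
  rw [← hd, Finset.mem_filter] at hdm
  have hdmin : ∀ x ∈ U, x < d → u x = true := by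
    intro x hx hxd
    by_contra hux
    have := Finset.min'_le (U.filter fun x => u x = false) x (by simp [hx, hux])
    omega
  have hbef : (U.filter fun x => x < d).Nonempty := by
    by_contra hemp
    rw [Finset.not_nonempty_iff_eq_empty, Finset.filter_eq_empty_iff] at hemp
    have h1 := h.1 d
    rw [show U.filter (· ≤ d) = {d} by
      ext x
      simp only [Finset.mem_filter, Finset.mem_singleton]
      constructor
      · rintro ⟨hx, hxd⟩; have := hemp hx; omega
      · rintro rfl; exact ⟨hdm.1, le_rfl⟩, Finset.sum_singleton, wordStep_false hdm.2] at h1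
    omega
  set c := (U.filter fun x => x < d).max' hbef with hc
  have hcm := Finset.max'_mem _ hbef
  rw [← hc, Finset.mem_filter] at hcm
  have hcmax : ∀ x ∈ U, x < d → x ≤ c := fun x hx hxd =>
    Finset.le_max' (U.filter fun x => x < d) x (by simp [hx, hxd])
  have hcu := hdmin c hcm.1 hcm.2
  set U' := (U.erase c).erase d with hU'
  have hcU' : c ∉ U' := by simp [hU']
  have hdU' : d ∉ U' := by simp [hU']
  have hUU : insert c (insert d U') = U := by
    ext x
    simp only [hU', Finset.mem_insert, Finset.mem_erase]
    constructor
    · rintro (rfl | rfl | h) <;> [exact hcm.1; exact hdm.1; exact h.2.2]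
    · intro hx; by_cases h1 : x = c <;> by_cases h2 : x = d <;> simp [h1, h2, hx]
  have hsum : wordStep u c + wordStep u d = 0 := by
    rw [wordStep_true hcu, wordStep_false hdm.2]; rfl
  have hgap : ∀ x ∈ U', ¬ (c ≤ x ∧ x < d) := by
    rintro x hx ⟨h1, h2⟩
    have h3 := hcmax x (by rw [← hUU]; simp [hx]) h2
    exact hcU' ((le_antisymm h3 h1) ▸ hx)
  have hD : IsDyckOn U' u := by
    constructor
    · intro j
      by_cases hj : c ≤ j ∧ j < d
      · have h0 : c ≠ 0 ∨ c = 0 := by omega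
        rcases h0 with h0 | h0
        · have h1 := h.1 (c - 1)
          rw [← hUU, sum_filter_le_insert_pair hcm.2 hcU' hdU' _ hsum,
            if_neg (by omega), add_zero] at h1
          rwa [show U'.filter (· ≤ j) = U'.filter (· ≤ c - 1) by
            ext x
            simp only [Finset.mem_filter]
            refine and_congr_right fun hx => ?_
            have := hgap x hx
            omega]
        · rw [show U'.filter (· ≤ j) = ∅ by
            rw [Finset.filter_eq_empty_iff]
            intro x hx hxj
            exact hgap x hx ⟨by omega, by omega⟩]
          simp
      · have h1 := h.1 j
        rwa [← hUU, sum_filter_le_insert_pair hcm.2 hcU' hdU' _ hsum, if_neg hj, add_zero] at h1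
    · have h2 := h.2
      rw [← hUU, Finset.sum_insert (by simp [hcU', hcm.2.ne]), Finset.sum_insert hdU'] at h2
      linarith
  have hcard : U'.card < n := by
    rw [← hn, ← hUU, Finset.card_insert_of_notMem (by simp [hcU', hcm.2.ne]),
      Finset.card_insert_of_notMem hdU']
    omega
  obtain ⟨m, hm, hmu⟩ := ih _ hcard hD rfl
  refine ⟨_, hUU ▸ hm.insert_pair hcm.2 hcU' hdU' hgap, fun x hx => ?_⟩
  rw [← hUU] at hx
  simp only [Finset.mem_insert] at hx
  have hcd := hcm.2
  split_ifs with h1 h2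
  · rw [h1, hcu]; simp [hcd]
  · rw [h2, hdm.2]; simp [hcd.le]
  · exact hmu x (by tauto)

/-! ### Faces -/

theorem mem_innerVertices {m : ℕ → ℕ} {a x : ℕ} :
    x ∈ innerVertices m a ↔
      (a < x ∧ x < m a) ∧ m x = x ∧ ∀ b < x, x < m b → b ≤ a := by
  simp [innerVertices]

theorem mem_outerVertices {m : ℕ → ℕ} {R x : ℕ} :
    x ∈ outerVertices m R ↔ (1 ≤ x ∧ x ≤ R) ∧ m x = x ∧ ∀ b < x, ¬ x < m b := by
  simp [outerVertices]

/-- The points of `U` off the arcs which are enclosed by no arc with ends in `U`. -/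
def outerPart (m : ℕ → ℕ) (U : Finset ℕ) : Finset ℕ :=
  U.filter fun x => m x = x ∧ ∀ b ∈ U, b < x → ¬ x < m b

theorem outerPart_Ioo (m : ℕ → ℕ) (a : ℕ) :
    outerPart m (Finset.Ioo a (m a)) = innerVertices m a := by
  ext x
  simp only [outerPart, Finset.mem_filter, mem_innerVertices, Finset.mem_Ioo]
  refine and_congr_right fun hx => and_congr_right fun _ => ?_
  constructor
  · intro hb b hbx hxb
    by_contra hab
    exact hb b (by omega) hbx hxb
  · intro hb b hb1 hb2 hb3
    have := hb b hb2 hb3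
    omega

theorem outerPart_Icc {V : Finset ℕ} {m : ℕ → ℕ} {R : ℕ} (h : IsNCMatching V m)
    (hV : V ⊆ Finset.Icc 1 R) : outerPart m (Finset.Icc 1 R) = outerVertices m R := by
  ext x
  simp only [outerPart, Finset.mem_filter, mem_outerVertices, Finset.mem_Icc]
  refine and_congr_right fun hx => and_congr_right fun _ => ?_
  constructor
  · intro hb b hbx hxb
    exact hb b (Finset.mem_Icc.1 (hV (h.mem_of_lt (by omega)))) hbx hxb
  · exact fun hb b _ => hb b

/-- The decomposition of a stable convex set according to the faces. -/
theorem sum_faces {V : Finset ℕ} {m : ℕ → ℕ} (h : IsNCMatching V m) {U : Finset ℕ}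
    (hconv : ∀ x ∈ U, ∀ y ∈ U, ∀ z, x ≤ z → z ≤ y → z ∈ U) (hU : ∀ x ∈ U, m x ∈ U)
    {α : Type*} [AddCommMonoid α] (g : ℕ → α) :
    ∑ x ∈ U, g x = ∑ x ∈ outerPart m U, g x +
      ∑ a ∈ U with a < m a, (g a + g (m a) + ∑ x ∈ innerVertices m a, g x) := by
  classical
  have e1 : ∑ x ∈ U with m x < x, g x = ∑ a ∈ U with a < m a, g (m a) := by
    refine Finset.sum_nbij' m m ?_ ?_ ?_ ?_ ?_
    · intro x hx
      simp only [Finset.mem_filter] at hx ⊢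
      exact ⟨hU x hx.1, by rw [h.invol]; exact hx.2⟩
    · intro x hx
      simp only [Finset.mem_filter] at hx ⊢
      exact ⟨hU x hx.1, by rw [h.invol]; exact hx.2⟩
    · exact fun x _ => h.invol x
    · exact fun x _ => h.invol x
    · intro x _; rw [h.invol]
  have e2 : ∑ x ∈ U with m x = x, g x = ∑ x ∈ outerPart m U, g x +
      ∑ a ∈ U with a < m a, ∑ x ∈ innerVertices m a, g x := by
    rw [← Finset.sum_biUnion, ← Finset.sum_union]
    · refine Finset.sum_congr ?_ fun _ _ => rfl
      ext x
      simp only [Finset.mem_filter, Finset.mem_union, outerPart, Finset.mem_biUnion,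
        mem_innerVertices]
      constructor
      · rintro ⟨hx, hmx⟩
        by_cases hb : ∃ b ∈ U, b < x ∧ x < m b
        · right
          have hne : (U.filter fun b => b < x ∧ x < m b).Nonempty := by
            obtain ⟨b, h1, h2⟩ := hb
            exact ⟨b, Finset.mem_filter.2 ⟨h1, h2⟩⟩
          have hmem := Finset.max'_mem _ hne
          have hmax := fun b hb => Finset.le_max' (U.filter fun b => b < x ∧ x < m b) b hb
          -- The innermost arc around `x` is the one with the largest left end.
          set a := (U.filter fun b => b < x ∧ x < m b).max' hne
          rw [Finset.mem_filter] at hmem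
          refine ⟨a, ⟨hmem.1, by omega⟩, hmem.2, hmx, fun b hbx hxb => ?_⟩
          by_cases hbU : b ∈ U
          · exact hmax b (Finset.mem_filter.2 ⟨hbU, hbx, hxb⟩)
          · by_contra hab
            exact hbU (hconv a hmem.1 x hx b (by omega) hbx.le)
        · left
          push Not at hb
          exact ⟨hx, hmx, fun b h1 h2 => not_lt.2 (hb b h1 h2)⟩
      · rintro (⟨hx, hmx, -⟩ | ⟨a, ⟨ha, ham⟩, hx, hmx, -⟩)
        · exact ⟨hx, hmx⟩
        · exact ⟨hconv a ha (m a) (hU a ha) x hx.1.le hx.2.le, hmx⟩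
    · rw [Finset.disjoint_left]
      intro x hx hx'
      simp only [outerPart, Finset.mem_filter, Finset.mem_biUnion, mem_innerVertices] at hx hx'
      obtain ⟨a, ⟨ha, -⟩, hxa, -⟩ := hx'
      exact hx.2.2 a ha hxa.1 hxa.2
    · intro a ha b hb hab
      rw [Function.onFun, Finset.disjoint_left]
      intro x hx hx'
      rw [mem_innerVertices] at hx hx'
      exact hab (le_antisymm (hx'.2.2 a hx.1.1 hx.1.2) (hx.2.2 b hx'.1.1 hx'.1.2))
  have e3 : ∑ x ∈ U, g x = ∑ x ∈ U with x < m x, g x +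
      (∑ x ∈ U with m x < x, g x + ∑ x ∈ U with m x = x, g x) := by
    rw [← Finset.sum_filter_add_sum_filter_not U (fun x => x < m x)]
    congr 1
    rw [← Finset.sum_filter_add_sum_filter_not (U.filter fun x => ¬ x < m x) (fun x => m x < x),
      Finset.filter_filter, Finset.filter_filter]
    congr 1 <;> refine Finset.sum_congr (Finset.filter_congr fun x _ => ?_) fun _ _ => rfl <;> omega
  rw [e3, e1, e2, Finset.sum_add_distrib, Finset.sum_add_distrib]
  abel

/-- Given that the word is compatible with the bounded faces, it is Dyck on a stable convex set if
and only if it is Dyck on the outer part. -/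
theorem isDyckOn_iff_outerPart {V : Finset ℕ} {m : ℕ → ℕ} (h : IsNCMatching V m) {U : Finset ℕ}
    (hconv : ∀ x ∈ U, ∀ y ∈ U, ∀ z, x ≤ z → z ≤ y → z ∈ U) (hU : ∀ x ∈ U, m x ∈ U)
    {u : ℕ → Bool} (hu : ∀ a ∈ U, a < m a →
      u a = true ∧ u (m a) = false ∧ IsDyckOn (innerVertices m a) u) :
    IsDyckOn U u ↔ IsDyckOn (outerPart m U) u := by
  -- The height at `j` is the height of the outer word plus, for each arc, `1` while the arc
  -- straddles `j` and the height of the word on its inner face. An arc that does not straddle `j`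
  -- contributes `0`.
  have hpre : ∀ j, ∑ x ∈ U with x ≤ j, wordStep u x = ∑ x ∈ outerPart m U with x ≤ j, wordStep u x
      + ∑ a ∈ U with a < m a, ((if a ≤ j ∧ j < m a then 1 else 0)
        + ∑ x ∈ innerVertices m a with x ≤ j, wordStep u x) := by
    intro j
    simp only [Finset.sum_filter (· ≤ j)]
    rw [sum_faces h hconv hU]
    congr 1
    refine Finset.sum_congr rfl fun a ha => ?_
    rw [Finset.mem_filter] at ha
    obtain ⟨h1, h2, -⟩ := hu a ha.1 ha.2
    rw [wordStep_true h1, wordStep_false h2]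
    congr 1
    split_ifs <;> omega
  have hinner : ∀ j, ∀ a ∈ U.filter (fun a => a < m a), j < a ∨ m a ≤ j →
      (((if a ≤ j ∧ j < m a then 1 else 0) : ℤ)
        + ∑ x ∈ innerVertices m a with x ≤ j, wordStep u x) = 0 := by
    intro j a ha hj
    rw [Finset.mem_filter] at ha
    rw [if_neg (by omega), zero_add]
    rcases hj with hj | hj
    · rw [Finset.filter_eq_empty_iff.2, Finset.sum_empty]
      intro x hx
      have := (mem_innerVertices.1 hx).1
      omega
    · rw [Finset.filter_true_of_mem]
      · exact (hu a ha.1 ha.2).2.2.2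
      · intro x hx
        have := (mem_innerVertices.1 hx).1
        omega
  have htot : ∑ x ∈ U, wordStep u x = ∑ x ∈ outerPart m U, wordStep u x := by
    rw [sum_faces h hconv hU, add_eq_left]
    refine Finset.sum_eq_zero fun a ha => ?_
    rw [Finset.mem_filter] at ha
    obtain ⟨h1, h2, h3⟩ := hu a ha.1 ha.2
    rw [wordStep_true h1, wordStep_false h2, h3.2]
    rfl
  constructor
  · intro hD
    refine ⟨fun j => ?_, htot ▸ hD.2⟩
    -- If some arc straddles `j`, take the outermost one, starting at `a`. No outer point lies in
    -- `[a, j]`, so `j` may be replaced by `a - 1`, which no arc straddles by non-crossing and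
    -- minimality of `a`.
    by_cases hstr : ∃ a ∈ U, a ≤ j ∧ j < m a
    · have hne : (U.filter fun a => a ≤ j ∧ j < m a).Nonempty := by
        obtain ⟨b, h1, h2⟩ := hstr
        exact ⟨b, Finset.mem_filter.2 ⟨h1, h2⟩⟩
      have hmem := Finset.min'_mem _ hne
      have hmin := fun b hb => Finset.min'_le (U.filter fun a => a ≤ j ∧ j < m a) b hb
      set a := (U.filter fun a => a ≤ j ∧ j < m a).min' hne
      rw [Finset.mem_filter] at hmem
      have hout : ∀ x ∈ outerPart m U, ¬ (a ≤ x ∧ x ≤ j) := by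
        intro x hx hx'
        simp only [outerPart, Finset.mem_filter] at hx
        have h1 := hx.2.2 a hmem.1
        have h2 : x ≠ a := fun e => by rw [e] at hx; omega
        omega
      rcases Nat.eq_zero_or_pos a with h0 | h0
      · rw [Finset.filter_eq_empty_iff.2, Finset.sum_empty]
        intro x hx hxj
        exact hout x hx ⟨by omega, hxj⟩
      · have h1 := hD.1 (a - 1)
        rw [hpre, add_comm, Finset.sum_eq_zero, zero_add] at h1
        · rwa [show (outerPart m U).filter (· ≤ j) = (outerPart m U).filter (· ≤ a - 1) by
            ext x
            simp only [Finset.mem_filter]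
            refine and_congr_right fun hx => ?_
            have := hout x hx
            omega]
        · intro b hb
          refine hinner _ b hb ?_
          by_contra hcon
          rw [Finset.mem_filter] at hb
          have h2 := h.noncrossing b a
          have h3 : m b ≠ a := fun e => by
            have := h.invol b; rw [e] at this; omega
          have h4 : m b ≠ m a := fun e => by
            have := h.invol b; rw [e, h.invol] at this; omega
          have := hmin b (Finset.mem_filter.2 ⟨hb.1, by omega, by omega⟩)
          omega
    · have h1 := hD.1 j
      rw [hpre, add_comm, Finset.sum_eq_zero, zero_add] at h1
      · exact h1
      · intro b hb
        refine hinner _ b hb ?_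
        by_contra hcon
        exact hstr ⟨b, (Finset.mem_filter.1 hb).1, by omega, by omega⟩
  · intro hD
    refine ⟨fun j => ?_, htot ▸ hD.2⟩
    rw [hpre]
    refine add_nonneg (hD.1 j) (Finset.sum_nonneg fun a ha => ?_)
    rw [Finset.mem_filter] at ha
    refine add_nonneg (by split_ifs <;> omega) ((hu a ha.1 ha.2).2.2.1 j)

theorem ordConnected_Ioo (a b : ℕ) : ∀ x ∈ Finset.Ioo a b, ∀ y ∈ Finset.Ioo a b, ∀ z,
    x ≤ z → z ≤ y → z ∈ Finset.Ioo a b := by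
  simp only [Finset.mem_Ioo]; omega

theorem ordConnected_Icc (a b : ℕ) : ∀ x ∈ Finset.Icc a b, ∀ y ∈ Finset.Icc a b, ∀ z,
    x ≤ z → z ≤ y → z ∈ Finset.Icc a b := by
  simp only [Finset.mem_Icc]; omega

/-- The arcs of `m` all occur in the word `u`. -/
def HasArcs (u : ℕ → Bool) (m : ℕ → ℕ) : Prop := ∀ a, a < m a → IsArc u a (m a)

/-- The arcs of a matching occur in a word iff the word is compatible with each bounded face. -/
theorem hasArcs_iff {V : Finset ℕ} {m : ℕ → ℕ} (h : IsNCMatching V m) {u : ℕ → Bool} :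
    HasArcs u m ↔ ∀ a, a < m a →
      u a = true ∧ u (m a) = false ∧ IsDyckOn (innerVertices m a) u := by
  constructor
  · intro hA a
    -- Induction on the length of the arc: arcs nested inside it are shorter, so their faces are
    -- already known to be compatible.
    induction hn : m a - a using Nat.strong_induction_on generalizing a with
    | _ n ih =>
    intro ha
    have hA' := hA a ha
    refine ⟨hA'.2.1, hA'.2.2.1, ?_⟩
    rw [← outerPart_Ioo m a, ← isDyckOn_iff_outerPart h (ordConnected_Ioo _ _)
      (fun x hx => h.mem_Ioo hx)]
    · exact hA'.2.2.2
    · intro b hb hbm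
      have hb' := h.mem_Ioo hb
      rw [Finset.mem_Ioo] at hb hb'
      exact ih _ (by omega) b rfl hbm
  · intro hA a ha
    refine ⟨ha, (hA a ha).1, (hA a ha).2.1, ?_⟩
    rw [isDyckOn_iff_outerPart h (ordConnected_Ioo _ _) (fun x hx => h.mem_Ioo hx)
      (fun b _ hb => hA b hb), outerPart_Ioo m a]
    exact (hA a ha).2.2

/-- This is what decouples the conditioning: once the arcs are present, their faces are balanced and
only the letters exposed to the unbounded face matter. -/
theorem HasArcs.isDyckOn_iff {V : Finset ℕ} {m : ℕ → ℕ} (h : IsNCMatching V m) {u : ℕ → Bool}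
    {R : ℕ} (hV : V ⊆ Finset.Icc 1 R) (hA : HasArcs u m) :
    IsDyckOn (Finset.Icc 1 R) u ↔ IsDyckOn (outerVertices m R) u := by
  rw [isDyckOn_iff_outerPart h (ordConnected_Icc _ _), outerPart_Icc h hV]
  · intro x hx
    by_cases hxV : x ∈ V
    · exact hV (h.mem_of_mem hxV)
    · rwa [h.eq_of_notMem hxV]
  · exact fun a _ ha => (hasArcs_iff h).1 hA a ha

theorem card_faces {V : Finset ℕ} {m : ℕ → ℕ} (h : IsNCMatching V m) {R : ℕ}
    (hV : V ⊆ Finset.Icc 1 R) : R = (outerVertices m R).card +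
      ∑ a ∈ Finset.Icc 1 R with a < m a, (2 + (innerVertices m a).card) := by
  have := sum_faces h (ordConnected_Icc 1 R) (fun x hx => by
    by_cases hxV : x ∈ V
    · exact hV (h.mem_of_mem hxV)
    · rwa [h.eq_of_notMem hxV]) (fun _ => 1)
  rw [outerPart_Icc h hV] at this
  simpa using this

/-! ### Independent fair bits -/

/-- The law of a family of independent fair bits. -/
noncomputable def coins (ι : Type*) : Measure (ι → Bool) :=
  Measure.infinitePi fun _ => uniformOn (Set.univ : Set Bool)

instance (ι : Type*) : IsProbabilityMeasure (coins ι) :=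
  inferInstanceAs (IsProbabilityMeasure (Measure.infinitePi _))

section coins

variable {ι : Type*}

theorem DependsOn.exists_comp_finset {β : Type*} {f : (ι → Bool) → β} {T : Finset ι}
    (h : DependsOn f (T : Set ι)) : ∃ g : (T → Bool) → β, f = g ∘ fun ω i => ω i := by
  have : Nonempty β := ⟨f fun _ => false⟩
  exact dependsOn_iff_exists_comp.1 h

/-- Such a function factors through a finite discrete space, so measurability never has to be
checked on its formula. -/
theorem DependsOn.measurable {β : Type*} [MeasurableSpace β] {f : (ι → Bool) → β}
    {T : Finset ι} (h : DependsOn f (T : Set ι)) : Measurable f := by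
  obtain ⟨g, rfl⟩ := h.exists_comp_finset
  exact (Measurable.of_discrete (f := g)).comp (by fun_prop)

theorem DependsOn.measurableSet {p : (ι → Bool) → Prop} {T : Finset ι}
    (h : DependsOn p (T : Set ι)) : MeasurableSet {ω | p ω} :=
  measurableSet_setOfPred.2 h.measurable

theorem iIndepFun_coins : iIndepFun (fun (i : ι) (ω : ι → Bool) => ω i) (coins ι) :=
  iIndepFun_infinitePi (X := fun _ b => b) fun _ => measurable_id

theorem coins_and {p q : (ι → Bool) → Prop} {S T : Finset ι}
    (hp : DependsOn p (S : Set ι)) (hq : DependsOn q (T : Set ι)) (h : Disjoint S T) :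
    (coins ι).real {ω | p ω ∧ q ω} = (coins ι).real {ω | p ω} * (coins ι).real {ω | q ω} := by
  obtain ⟨f, rfl⟩ := hp.exists_comp_finset
  obtain ⟨g, rfl⟩ := hq.exists_comp_finset
  have hi := (iIndepFun_coins (ι := ι)).indepFun_finset S T h fun i => measurable_pi_apply i
  have := hi.measure_inter_preimage_eq_mul {a | f a} {a | g a} (Set.toFinite _).measurableSet
    (Set.toFinite _).measurableSet
  simp only [measureReal_def, ← ENNReal.toReal_mul]
  exact congrArg ENNReal.toReal this

theorem DependsOn.and {p q : (ι → Bool) → Prop} {S : Set ι}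
    (hp : DependsOn p S) (hq : DependsOn q S) : DependsOn (fun ω => p ω ∧ q ω) S :=
  fun _ _ h => congrArg₂ And (hp h) (hq h)

theorem coins_forall {κ : Type*} [DecidableEq κ] {p : κ → (ι → Bool) → Prop} {T : κ → Finset ι}
    (hp : ∀ k, DependsOn (p k) (T k : Set ι)) (s : Finset κ)
    (h : (s : Set κ).PairwiseDisjoint T) :
    (coins ι).real {ω | ∀ k ∈ s, p k ω} = ∏ k ∈ s, (coins ι).real {ω | p k ω} := by
  classical
  induction s using Finset.induction_on with
  | empty => simp
  | insert a s ha ih =>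
    rw [Finset.prod_insert ha, ← ih (h.subset (by simp))]
    simp only [Finset.forall_mem_insert]
    refine coins_and (T := s.biUnion T) (hp a) (fun ω ω' hω => ?_) ?_
    · refine propext (forall₂_congr fun k hk => Eq.to_iff (hp k fun i hi => hω i ?_))
      simp only [Finset.coe_biUnion, Set.mem_iUnion]
      exact ⟨k, hk, hi⟩
    · rw [Finset.disjoint_biUnion_right]
      intro k hk
      exact h (by simp) (by simp [hk]) fun e => ha (e ▸ hk)

theorem iIndepFun_of_dependsOn {κ : Type*} {β : κ → Type*}
    [∀ k, MeasurableSpace (β k)] {f : (k : κ) → (ι → Bool) → β k} {T : κ → Finset ι}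
    (hf : ∀ k, DependsOn (f k) (T k : Set ι)) (h : Pairwise fun j k => Disjoint (T j) (T k)) :
    iIndepFun f (coins ι) := by
  classical
  rw [iIndepFun_iff_measure_inter_preimage_eq_mul]
  intro s t _
  have := coins_forall (p := fun k ω => f k ω ∈ t k) (T := T)
    (fun k ω ω' hω => congrArg (· ∈ t k) (hf k hω)) s fun j _ k _ hjk => h hjk
  rw [← ENNReal.toReal_eq_toReal_iff' (measure_ne_top _ _)
    (ENNReal.prod_ne_top fun _ _ => measure_ne_top _ _), ENNReal.toReal_prod]
  rw [← measureReal_def]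
  convert! this using 2
  ext ω
  simp

theorem coins_apply (i : ι) (b : Bool) : (coins ι).real {ω | ω i = b} = 1 / 2 := by
  have : (coins ι) {ω | ω i = b} = uniformOn (Set.univ : Set Bool) {b} := by
    have := (measurePreserving_eval_infinitePi
      (fun _ : ι => uniformOn (Set.univ : Set Bool)) i).measure_preimage
      (measurableSet_singleton b).nullMeasurableSet
    exact this
  rw [measureReal_def, this, uniformOn_univ]
  simp

theorem coins_map_injective {κ : Type*} {e : κ → ι} (he : Function.Injective e) :
    (coins ι).map (fun ω k => ω (e k)) = coins κ :=
  Measure.map_infinitePi_infinitePi_of_inj he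

end coins

/-! ### Probabilities of Dyck words -/

/-- The word on one side of the axis (`true`: above, `false`: below) encoded by a family of bits. -/
def sideWord (s : Bool) (ω : ℕ × Bool → Bool) (x : ℕ) : Bool := ω (x, s)

/-- The restriction of `u` to `U` is a path from height `h` to `0` that stays nonnegative. -/
def IsDyckFrom (h : ℕ) (U : Finset ℕ) (u : ℕ → Bool) : Prop :=
  (∀ j, 0 ≤ (h : ℤ) + ∑ x ∈ U with x ≤ j, wordStep u x) ∧ (h : ℤ) + ∑ x ∈ U, wordStep u x = 0

theorem isDyckFrom_zero {U : Finset ℕ} {u : ℕ → Bool} : IsDyckFrom 0 U u ↔ IsDyckOn U u := by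
  simp [IsDyckFrom, IsDyckOn]

/-- First-step decomposition, mirrored by the recursion of `ballotProb`. A down step needs `0 < h`,
which also makes `h - 1` a genuine subtraction. -/
theorem isDyckFrom_insert {h a : ℕ} {U : Finset ℕ} {u : ℕ → Bool} (ha : ∀ x ∈ U, a < x) :
    IsDyckFrom h (insert a U) u ↔
      (u a = true ∧ IsDyckFrom (h + 1) U u) ∨ (u a = false ∧ 0 < h ∧ IsDyckFrom (h - 1) U u) := by
  have haU : a ∉ U := fun hh => lt_irrefl _ (ha a hh)
  have hpre : ∀ j, ∑ x ∈ insert a U with x ≤ j, wordStep u x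
      = if a ≤ j then wordStep u a + ∑ x ∈ U with x ≤ j, wordStep u x else 0 := by
    intro j
    rw [Finset.sum_filter, Finset.sum_insert haU, Finset.sum_filter]
    split_ifs with hj
    · rfl
    · rw [zero_add]
      refine Finset.sum_eq_zero fun x hx => if_neg ?_
      have := ha x hx
      omega
  have hlow : ∀ j, ¬ a ≤ j → ∑ x ∈ U with x ≤ j, wordStep u x = 0 := by
    intro j hj
    rw [Finset.filter_eq_empty_iff.2, Finset.sum_empty]
    intro x hx
    have := ha x hx
    omega
  have hself : ∑ x ∈ U with x ≤ a, wordStep u x = 0 := by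
    rw [Finset.filter_eq_empty_iff.2, Finset.sum_empty]
    intro x hx
    have := ha x hx
    omega
  unfold IsDyckFrom
  simp only [hpre, Finset.sum_insert haU]
  cases hu : u a
  · simp only [wordStep_false hu, Bool.false_eq_true, false_and, false_or, true_and]
    constructor
    · rintro ⟨h1, h2⟩
      have h3 := h1 a
      rw [if_pos le_rfl, hself] at h3
      have hh : 0 < h := by omega
      refine ⟨hh, fun j => ?_, ?_⟩
      · have h4 := h1 j
        split_ifs at h4 with hj
        · push_cast [Nat.cast_sub (show 1 ≤ h from hh)]; linarith
        · rw [hlow j hj]; positivity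
      · push_cast [Nat.cast_sub (show 1 ≤ h from hh)]; linarith
    · rintro ⟨hh, h1, h2⟩
      push_cast [Nat.cast_sub (show 1 ≤ h from hh)] at h1 h2
      refine ⟨fun j => ?_, by linarith⟩
      split_ifs with hj
      · have := h1 j; linarith
      · positivity
  · simp only [wordStep_true hu, true_and, Bool.true_eq_false, false_and, or_false]
    push_cast
    refine and_congr (forall_congr' fun j => ?_) (by rw [add_assoc])
    split_ifs with hj
    · rw [add_assoc]
    · rw [hlow j hj]
      constructor <;> intro <;> positivity

theorem IsDyckFrom.congr {h : ℕ} {U : Finset ℕ} {u v : ℕ → Bool} (huv : ∀ x ∈ U, u x = v x) :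
    IsDyckFrom h U u ↔ IsDyckFrom h U v := by
  have hs : ∀ x ∈ U, wordStep u x = wordStep v x := fun x hx => by simp [wordStep, huv x hx]
  unfold IsDyckFrom
  rw [Finset.sum_congr rfl hs]
  refine and_congr_left fun _ => forall_congr' fun j => ?_
  rw [Finset.sum_congr rfl fun x hx => hs x (Finset.mem_filter.1 hx).1]

/-- The bits of side `s` at the points of `U`. -/
def sideBits (s : Bool) (U : Finset ℕ) : Finset (ℕ × Bool) := U.map ⟨fun x => (x, s), fun _ _ h =>
  (Prod.mk.inj h).1⟩

theorem mem_sideBits {s t : Bool} {U : Finset ℕ} {x : ℕ} :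
    (x, t) ∈ sideBits s U ↔ x ∈ U ∧ s = t := by
  rw [sideBits, Finset.mem_map]
  constructor
  · rintro ⟨y, hy, h⟩
    obtain ⟨rfl, rfl⟩ := Prod.mk.inj h
    exact ⟨hy, rfl⟩
  · rintro ⟨h, rfl⟩
    exact ⟨x, h, rfl⟩

theorem disjoint_sideBits {s : Bool} {U V : Finset ℕ} (h : Disjoint U V) :
    Disjoint (sideBits s U) (sideBits s V) := by
  rw [Finset.disjoint_left] at h ⊢
  rintro ⟨x, t⟩ h1 h2
  rw [mem_sideBits] at h1 h2
  exact h h1.1 h2.1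

theorem disjoint_sideBits_of_ne {s t : Bool} (U V : Finset ℕ) (h : s ≠ t) :
    Disjoint (sideBits s U) (sideBits t V) := by
  rw [Finset.disjoint_left]
  rintro ⟨x, r⟩ h1 h2
  rw [mem_sideBits] at h1 h2
  exact h (h1.2.trans h2.2.symm)

theorem dependsOn_sideWord {s : Bool} {U : Finset ℕ} {p : (ℕ → Bool) → Prop}
    (hp : ∀ u v, (∀ x ∈ U, u x = v x) → (p u ↔ p v)) :
    DependsOn (fun ω => p (sideWord s ω)) (sideBits s U : Set (ℕ × Bool)) := by
  intro ω ω' h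
  refine propext (hp _ _ fun x hx => h (x, s) ?_)
  exact Finset.mem_coe.2 (mem_sideBits.2 ⟨hx, rfl⟩)

/-- The probability that a simple symmetric random walk started at `h` is nonnegative up to time `n`
and is at `0` at time `n`. -/
noncomputable def ballotProb : ℕ → ℕ → ℝ
  | 0, 0 => 1
  | 0, _ + 1 => 0
  | n + 1, 0 => ballotProb n 1 / 2
  | n + 1, h + 1 => (ballotProb n (h + 2) + ballotProb n h) / 2

/-- Induction on the least point of `U`: its letter is a fair bit independent of the others. The
positions of the points play no role, only their number. -/
theorem coins_isDyckFrom (s : Bool) (U : Finset ℕ) (h : ℕ) :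
    (coins (ℕ × Bool)).real {ω | IsDyckFrom h U (sideWord s ω)} = ballotProb U.card h := by
  induction U using Finset.induction_on_min generalizing h with
  | empty =>
    cases h with
    | zero => simp [IsDyckFrom, ballotProb]
    | succ h =>
      have : ¬ ((h : ℤ) + 1 = 0) := by omega
      simp [IsDyckFrom, ballotProb, this]
  | insert a U ha ih =>
    have haU : a ∉ U := fun hh => lt_irrefl _ (ha a hh)
    have hd : Disjoint (sideBits s {a}) (sideBits s U) :=
      disjoint_sideBits (Finset.disjoint_singleton_left.2 haU)
    have key : ∀ (b : Bool) (k : ℕ),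
        (coins (ℕ × Bool)).real {ω | sideWord s ω a = b ∧ IsDyckFrom k U (sideWord s ω)}
          = ballotProb U.card k / 2 := by
      intro b k
      rw [coins_and (dependsOn_sideWord (U := {a}) (p := fun u => u a = b) fun u v huv => by
          rw [huv a (by simp)])
        (dependsOn_sideWord (U := U) (p := fun u => IsDyckFrom k U u) fun u v huv =>
          IsDyckFrom.congr huv) hd, ih]
      have := coins_apply (a, s) b
      rw [show {ω : ℕ × Bool → Bool | sideWord s ω a = b} = {ω | ω (a, s) = b} from rfl, this]
      ring
    rw [Finset.card_insert_of_notMem haU]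
    simp only [isDyckFrom_insert ha]
    cases h with
    | zero => simpa [ballotProb] using key true 1
    | succ h =>
      rw [show {ω | (sideWord s ω a = true ∧ IsDyckFrom (h + 1 + 1) U (sideWord s ω)) ∨
          (sideWord s ω a = false ∧ 0 < h + 1 ∧ IsDyckFrom (h + 1 - 1) U (sideWord s ω))}
        = {ω | sideWord s ω a = true ∧ IsDyckFrom (h + 2) U (sideWord s ω)} ∪
          {ω | sideWord s ω a = false ∧ IsDyckFrom h U (sideWord s ω)} by
          ext ω; simp, measureReal_union, key, key, ballotProb]
      · ring
      · rw [Set.disjoint_left]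
        rintro ω ⟨h1, -⟩ ⟨h2, -⟩
        simp [h1] at h2
      · have hm : DependsOn (fun ω => sideWord s ω a = false ∧ IsDyckFrom h U (sideWord s ω))
            (sideBits s (insert a U) : Set (ℕ × Bool)) :=
          dependsOn_sideWord (p := fun u => u a = false ∧ IsDyckFrom h U u) fun u v huv => by
            rw [huv a (by simp), IsDyckFrom.congr fun x hx => huv x (by simp [hx])]
        exact hm.measurableSet

/-- The ballot numbers. -/
def ballotNumber (n : ℕ) : ℕ → ℤ
  | 0 => 1
  | j + 1 => n.choose (j + 1) - n.choose j

/-- Here `j` is the number of up steps of a path from `h` to `0` in `n` steps, and the count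
satisfies Pascal's rule. The vanishing statement is proved jointly, because the case `j = 0` uses it
for the height `h + 2`. -/
theorem ballotProb_eq (n : ℕ) :
    (∀ j h, n = 2 * j + h → ballotProb n h * 2 ^ n = ballotNumber n j) ∧
    (∀ h, (n < h ∨ Odd (n + h)) → ballotProb n h = 0) := by
  induction n with
  | zero =>
    refine ⟨fun j h e => ?_, fun h hh => ?_⟩
    · obtain rfl : j = 0 := by omega
      obtain rfl : h = 0 := by omega
      simp [ballotProb, ballotNumber]
    · cases h with
      | zero => simp at hh
      | succ h => simp [ballotProb]
  | succ n ih =>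
    refine ⟨fun j h e => ?_, fun h hh => ?_⟩
    · cases h with
      | zero =>
        obtain ⟨j, rfl⟩ : ∃ i, j = i + 1 := ⟨j - 1, by omega⟩
        have h1 := ih.1 j 1 (by omega)
        have hn : n = 2 * j + 1 := by omega
        have hb : ballotNumber (n + 1) (j + 1) = ballotNumber n j := by
          -- Boundary case `h = 0`: the two middle binomial coefficients of an odd row coincide,
          -- which replaces the missing down step.
          have hsymm : n.choose (j + 1) = n.choose j := by
            rw [hn, ← Nat.choose_symm_half]
          cases j with
          | zero => simp [ballotNumber, hn]
          | succ j =>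
            simp only [ballotNumber]
            rw [Nat.choose_succ_succ n (j + 1), Nat.choose_succ_succ n j, hsymm]
            push_cast
            ring
        rw [ballotProb, hb, ← h1, pow_succ]
        ring
      | succ h =>
        have h1 := ih.1 j h (by omega)
        cases j with
        | zero =>
          have h2 := ih.2 (h + 2) (by omega)
          rw [ballotProb, h2, pow_succ]
          simp only [ballotNumber, Int.cast_one] at h1 ⊢
          linarith
        | succ j =>
          have h2 := ih.1 j (h + 2) (by omega)
          have hb : ballotNumber (n + 1) (j + 1) = ballotNumber n (j + 1) + ballotNumber n j := by
            cases j with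
            | zero => simp [ballotNumber]
            | succ j =>
              simp only [ballotNumber]
              rw [Nat.choose_succ_succ n (j + 1), Nat.choose_succ_succ n j]
              push_cast
              ring
          rw [ballotProb, hb, pow_succ]
          push_cast
          linarith
    · cases h with
      | zero =>
        have h1 := ih.2 1 (by
          rcases hh with hh | hh
          · omega
          · right; simpa using hh)
        simp [ballotProb, h1]
      | succ h =>
        have h1 := ih.2 h (by
          rcases hh with hh | hh
          · left; omega
          · right; rw [Nat.odd_iff] at hh ⊢; omega)
        have h2 := ih.2 (h + 2) (by
          rcases hh with hh | hh
          · left; omega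
          · right; rw [Nat.odd_iff] at hh ⊢; omega)
        simp [ballotProb, h1, h2]

/-- The probability that `n` independent fair bits form a Dyck word. -/
noncomputable def dyckProb (n : ℕ) : ℝ := if Even n then (catalan (n / 2) : ℝ) / 2 ^ n else 0

theorem ballotNumber_two_mul (k : ℕ) : ballotNumber (2 * k) k = catalan k := by
  cases k with
  | zero => simp [ballotNumber]
  | succ k =>
    have h1 := succ_mul_catalan_eq_centralBinom (k + 1)
    have h2 := Nat.choose_succ_right_eq (2 * (k + 1)) k
    rw [show 2 * (k + 1) - k = k + 2 by omega] at h2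
    rw [Nat.centralBinom] at h1
    have h3 : ((k : ℤ) + 2) * ballotNumber (2 * (k + 1)) (k + 1) = (k + 2) * catalan (k + 1) := by
      simp only [ballotNumber]
      zify at h1 h2
      linarith
    exact mul_left_cancel₀ (by positivity) h3

theorem ballotProb_zero (n : ℕ) : ballotProb n 0 = dyckProb n := by
  unfold dyckProb
  split_ifs with h
  · obtain ⟨k, hk⟩ := h
    have h1 := (ballotProb_eq n).1 k 0 (by omega)
    rw [eq_div_iff (by positivity), h1, show n = 2 * k by omega, ballotNumber_two_mul]
    simp
  · exact (ballotProb_eq n).2 0 (Or.inr (by simpa using h))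

theorem coins_isDyckOn (s : Bool) (U : Finset ℕ) :
    (coins (ℕ × Bool)).real {ω | IsDyckOn U (sideWord s ω)} = dyckProb U.card := by
  rw [← ballotProb_zero, ← coins_isDyckFrom s U 0]
  simp only [isDyckFrom_zero]

/-! ### Probability of a set of arcs -/

theorem dyckProb_nonneg (n : ℕ) : 0 ≤ dyckProb n := by
  unfold dyckProb; split_ifs <;> positivity

theorem dyckProb_two_mul (k : ℕ) : dyckProb (2 * k) = catalan k / 4 ^ k := by
  rw [dyckProb, if_pos (even_two_mul k), pow_mul]
  norm_num

theorem even_of_dyckProb_ne_zero {n : ℕ} (h : dyckProb n ≠ 0) : Even n := by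
  by_contra hn
  exact h (if_neg hn)

theorem catalan_pos (n : ℕ) : 0 < catalan n := by
  have h1 := succ_mul_catalan_eq_centralBinom n
  have h2 := Nat.centralBinom_pos n
  rcases Nat.eq_zero_or_pos (catalan n) with h | h
  · rw [h] at h1; omega
  · exact h

theorem dyckProb_pos {n : ℕ} (h : Even n) : 0 < dyckProb n := by
  rw [dyckProb, if_pos h]
  have := catalan_pos (n / 2)
  positivity

/-- The probability that the arcs of `m` all occur in a uniform random word. -/
noncomputable def arcsProb (m : ℕ → ℕ) (R : ℕ) : ℝ :=
  ∏ a ∈ Finset.Icc 1 R with a < m a, dyckProb (innerVertices m a).card / 4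

theorem coins_faceEvent {m : ℕ → ℕ} (s : Bool) {a : ℕ}
    (ha : a < m a) :
    (coins (ℕ × Bool)).real {ω | sideWord s ω a = true ∧ sideWord s ω (m a) = false ∧
      IsDyckOn (innerVertices m a) (sideWord s ω)} = dyckProb (innerVertices m a).card / 4 := by
  have h1 : m a ∉ innerVertices m a := by rw [mem_innerVertices]; omega
  have h2 : a ∉ insert (m a) (innerVertices m a) := by
    rw [Finset.mem_insert, mem_innerVertices]; omega
  rw [coins_and (S := sideBits s {a}) (T := sideBits s (insert (m a) (innerVertices m a)))
    (dependsOn_sideWord (p := fun u => u a = true) fun u v huv => by rw [huv a (by simp)])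
    (dependsOn_sideWord (p := fun u => u (m a) = false ∧ IsDyckOn (innerVertices m a) u)
      fun u v huv => by
        rw [huv (m a) (by simp), isDyckOn_congr fun x hx => huv x (by simp [hx])])
    (disjoint_sideBits (Finset.disjoint_singleton_left.2 h2)),
    coins_and (S := sideBits s {m a}) (T := sideBits s (innerVertices m a))
    (dependsOn_sideWord (p := fun u => u (m a) = false) fun u v huv => by rw [huv (m a) (by simp)])
    (dependsOn_sideWord fun u v huv => isDyckOn_congr huv)
    (disjoint_sideBits (Finset.disjoint_singleton_left.2 h1)), coins_isDyckOn]
  have e1 : (coins (ℕ × Bool)).real {ω | sideWord s ω a = true} = 1 / 2 := coins_apply (a, s) true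
  have e2 : (coins (ℕ × Bool)).real {ω | sideWord s ω (m a) = false} = 1 / 2 :=
    coins_apply (m a, s) false
  rw [e1, e2]
  ring

/-- The vertices of an arc and of the face directly inside it. -/
def faceVertices (m : ℕ → ℕ) (a : ℕ) : Finset ℕ := insert a (insert (m a) (innerVertices m a))

/-- A fixed point has only one innermost enclosing arc and is the end of none. Hence events attached
to different faces read disjoint sets of bits. -/
theorem disjoint_faceVertices {V : Finset ℕ} {m : ℕ → ℕ} (h : IsNCMatching V m) {a b : ℕ}
    (ha : a < m a) (hb : b < m b) (hab : a ≠ b) :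
    Disjoint (faceVertices m a) (faceVertices m b) := by
  rw [Finset.disjoint_left]
  intro x hxa hxb
  simp only [faceVertices, Finset.mem_insert] at hxa hxb
  have h1 := h.invol a
  have h2 := h.invol b
  have h3 : m a ≠ m b := fun e => hab (by rw [← h1, ← h2, e])
  have h4 : m a = b → m b = a := fun e => by rw [← e, h1]
  rcases hxa with hxa | hxa | hxa <;> rcases hxb with hxb | hxb | hxb
  · omega
  · rw [← hxb, hxa] at h2; omega
  · have := (mem_innerVertices.1 hxb).2.1; subst hxa; omega
  · rw [← hxa, hxb] at h1; omega
  · omega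
  · have := (mem_innerVertices.1 hxb).2.1; rw [hxa, h1] at this; omega
  · have := (mem_innerVertices.1 hxa).2.1; subst hxb; omega
  · have := (mem_innerVertices.1 hxa).2.1; rw [hxb, h2] at this; omega
  · rw [mem_innerVertices] at hxa hxb
    exact hab (le_antisymm (hxb.2.2 a hxa.1.1 hxa.1.2) (hxa.2.2 b hxb.1.1 hxb.1.2))

theorem disjoint_outerVertices_faceVertices {V : Finset ℕ} {m : ℕ → ℕ} (h : IsNCMatching V m)
    (R : ℕ) {a : ℕ} (ha : a < m a) : Disjoint (outerVertices m R) (faceVertices m a) := by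
  rw [Finset.disjoint_left]
  intro x hx hxa
  simp only [faceVertices, Finset.mem_insert] at hxa
  rw [mem_outerVertices] at hx
  rcases hxa with hxa | hxa | hxa
  · subst hxa; omega
  · have h1 := h.invol a; rw [← hxa, hx.2.1] at h1; omega
  · rw [mem_innerVertices] at hxa
    exact hx.2.2 a hxa.1.1 hxa.1.2

theorem dependsOn_faceEvent (m : ℕ → ℕ) (s : Bool) (a : ℕ) :
    DependsOn (fun ω : ℕ × Bool → Bool => sideWord s ω a = true ∧ sideWord s ω (m a) = false ∧
      IsDyckOn (innerVertices m a) (sideWord s ω))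
      (sideBits s (faceVertices m a) : Set (ℕ × Bool)) :=
  dependsOn_sideWord (p := fun u => u a = true ∧ u (m a) = false ∧ IsDyckOn (innerVertices m a) u)
    fun u v huv => by
      rw [huv a (by simp [faceVertices]), huv (m a) (by simp [faceVertices]),
        isDyckOn_congr fun x hx => huv x (by simp [faceVertices, hx])]

theorem hasArcs_iff_forall_mem {V : Finset ℕ} {m : ℕ → ℕ} (h : IsNCMatching V m) {R : ℕ}
    (hV : V ⊆ Finset.Icc 1 R) {u : ℕ → Bool} : HasArcs u m ↔
      ∀ a ∈ (Finset.Icc 1 R).filter (fun a => a < m a),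
        u a = true ∧ u (m a) = false ∧ IsDyckOn (innerVertices m a) u := by
  rw [hasArcs_iff h]
  constructor
  · intro hh a ha
    exact hh a (Finset.mem_filter.1 ha).2
  · intro hh a ha
    exact hh a (Finset.mem_filter.2 ⟨hV (h.mem_of_lt ha), ha⟩)

/-- The event is a conjunction of one event per arc (two forced letters and a Dyck word on the inner
face), and these are independent. -/
theorem coins_hasArcs {V : Finset ℕ} {m : ℕ → ℕ} (h : IsNCMatching V m) {R : ℕ}
    (hV : V ⊆ Finset.Icc 1 R) (s : Bool) :
    (coins (ℕ × Bool)).real {ω | HasArcs (sideWord s ω) m} = arcsProb m R := by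
  simp only [hasArcs_iff_forall_mem h hV]
  rw [coins_forall (dependsOn_faceEvent m s), arcsProb]
  · exact Finset.prod_congr rfl fun a ha => coins_faceEvent s (Finset.mem_filter.1 ha).2
  · intro a ha b hb hab
    exact disjoint_sideBits (disjoint_faceVertices h (Finset.mem_filter.1 ha).2
      (Finset.mem_filter.1 hb).2 hab)

/-- Given the arcs, the word is Dyck exactly when its outer letters are, and these bits are disjoint
from those of the bounded faces. -/
theorem coins_hasArcs_and_isDyckOn {V : Finset ℕ} {m : ℕ → ℕ} (h : IsNCMatching V m) {R : ℕ}
    (hV : V ⊆ Finset.Icc 1 R) (s : Bool) :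
    (coins (ℕ × Bool)).real {ω | HasArcs (sideWord s ω) m ∧
      IsDyckOn (Finset.Icc 1 R) (sideWord s ω)}
      = arcsProb m R * dyckProb (outerVertices m R).card := by
  classical
  rw [← coins_hasArcs h hV s, ← coins_isDyckOn s (outerVertices m R)]
  rw [← coins_and (S := ((Finset.Icc 1 R).filter (fun a => a < m a)).biUnion
    fun a => sideBits s (faceVertices m a)) (T := sideBits s (outerVertices m R))]
  · congr 1
    ext ω
    exact and_congr_right fun hA => hA.isDyckOn_iff h hV
  · intro ω ω' hω
    simp only [hasArcs_iff_forall_mem h hV]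
    refine propext (forall₂_congr fun a ha => Eq.to_iff (dependsOn_faceEvent m s a fun i hi => ?_))
    refine hω i ?_
    simp only [Finset.coe_biUnion, Set.mem_iUnion]
    exact ⟨a, ha, hi⟩
  · exact dependsOn_sideWord fun u v huv => isDyckOn_congr huv
  · rw [Finset.disjoint_biUnion_left]
    intro a ha
    exact (disjoint_sideBits (disjoint_outerVertices_faceVertices h R
      (Finset.mem_filter.1 ha).2)).symm

theorem even_innerVertices_of_arcsProb_ne_zero {m : ℕ → ℕ} {R : ℕ} (h : arcsProb m R ≠ 0) :
    ∀ a ∈ (Finset.Icc 1 R).filter (fun a => a < m a), Even (innerVertices m a).card := by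
  intro a ha
  have := Finset.prod_ne_zero_iff.1 h a ha
  exact even_of_dyckProb_ne_zero fun e => this (by rw [e]; simp)

/-- Each face accounts for its two arc ends and its inner points, and by `card_faces` all these
exponents add up to `R` minus the number of outer points. Evenness is needed because `faceProduct`
rounds half-sizes down whereas `dyckProb` vanishes at odd arguments. -/
theorem arcsProb_eq {V : Finset ℕ} {m : ℕ → ℕ} (h : IsNCMatching V m) {R : ℕ}
    (hV : V ⊆ Finset.Icc 1 R)
    (he : ∀ a ∈ (Finset.Icc 1 R).filter (fun a => a < m a), Even (innerVertices m a).card) :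
    arcsProb m R = faceProduct m R * 2 ^ (outerVertices m R).card / 2 ^ R := by
  have h1 : arcsProb m R = faceProduct m R /
      2 ^ (∑ a ∈ Finset.Icc 1 R with a < m a, (2 + (innerVertices m a).card)) := by
    rw [arcsProb, faceProduct, ← Finset.prod_pow_eq_pow_sum, Nat.cast_prod,
      ← Finset.prod_div_distrib]
    refine Finset.prod_congr rfl fun a ha => ?_
    rw [dyckProb, if_pos (he a ha), pow_add]
    field_simp
    norm_num
  have h2 := card_faces h hV
  have h3 : (2 : ℝ) ^ R = 2 ^ (outerVertices m R).card *
      2 ^ (∑ a ∈ Finset.Icc 1 R with a < m a, (2 + (innerVertices m a).card)) := by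
    rw [← pow_add, ← h2]
  rw [h1, h3]
  field_simp

/-! ### Translates of a set of arcs -/

/-- The translates by `t` of the arcs of `m` all occur in the word `u`. -/
def HasArcsAt (u : ℕ → Bool) (m : ℕ → ℕ) (t : ℕ) : Prop :=
  ∀ a, a < m a → IsArc u (a + t) (m a + t)

/-- The letter at the common point decides whether it opens or closes an arc, and its partner in the
word is unique. -/
theorem HasArcsAt.eq_of_add_eq {V : Finset ℕ} {m : ℕ → ℕ} (h : IsNCMatching V m) {u : ℕ → Bool}
    {s t x y : ℕ} (hs : HasArcsAt u m s) (ht : HasArcsAt u m t) (hx : x ∈ V) (hy : y ∈ V)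
    (hxy : x + s = y + t) : m x + s = m y + t := by
  have key : ∀ {x r}, HasArcsAt u m r → x ∈ V →
      (u (x + r) = true ∧ IsArc u (x + r) (m x + r)) ∨
        (u (x + r) = false ∧ IsArc u (m x + r) (x + r)) := by
    intro x r hr hx
    rcases lt_or_gt_of_ne ((h.ne_iff x).2 hx) with hlt | hlt
    · have := hr (m x) (by rwa [h.invol])
      rw [h.invol] at this
      exact Or.inr ⟨this.2.2.1, this⟩
    · have := hr x hlt
      exact Or.inl ⟨this.2.1, this⟩
  have kx := key hs hx
  have ky := key ht hy
  rw [← hxy] at ky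
  rcases kx with ⟨ux, ax⟩ | ⟨ux, ax⟩ <;> rcases ky with ⟨uy, ay⟩ | ⟨uy, ay⟩
  · exact ax.right_unique ay
  · simp [ux] at uy
  · simp [ux] at uy
  · exact ax.left_unique ay

/-- Translates of the arcs of a matching which occur together in a word form a matching. -/
theorem exists_union_matching {V : Finset ℕ} {m : ℕ → ℕ} (h : IsNCMatching V m) {A : Finset ℕ}
    {u : ℕ → Bool} (hu : ∀ t ∈ A, HasArcsAt u m t) :
    ∃ (V' : Finset ℕ) (m' : ℕ → ℕ), IsNCMatching V' m' ∧
      (∀ x, x ∈ V' ↔ ∃ t ∈ A, ∃ y ∈ V, x = y + t) ∧ ∀ t ∈ A, ∀ y ∈ V, m' (y + t) = m y + t := by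
  classical
  let V' : Finset ℕ := A.biUnion fun t => V.image (· + t)
  have hV' : ∀ x, x ∈ V' ↔ ∃ t ∈ A, ∃ y ∈ V, x = y + t := by
    intro x
    simp only [V', Finset.mem_biUnion, Finset.mem_image]
    exact exists_congr fun t => and_congr_right fun _ => exists_congr fun y =>
      and_congr_right fun _ => eq_comm
  -- A point may lie in several translates; an arbitrary one is chosen, and `HasArcsAt.eq_of_add_eq`
  -- shows the choice is immaterial.
  let m' : ℕ → ℕ := fun x => if hx : ∃ t ∈ A, ∃ y ∈ V, x = y + t then
    m (x - hx.choose) + hx.choose else x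
  have hm' : ∀ t ∈ A, ∀ y ∈ V, m' (y + t) = m y + t := by
    intro t ht y hy
    have hx : ∃ s ∈ A, ∃ z ∈ V, y + t = z + s := ⟨t, ht, y, hy, rfl⟩
    obtain ⟨hs, z, hz, hzs⟩ := hx.choose_spec
    have hz' : z = y + t - hx.choose := by omega
    simp only [m', dif_pos hx]
    rw [hz'] at hz
    exact HasArcsAt.eq_of_add_eq h (hu _ hs) (hu t ht) hz hy (by omega)
  have hout : ∀ x, x ∉ V' → m' x = x := by
    intro x hx
    rw [hV'] at hx
    simp only [m', dif_neg hx]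
  have harc : ∀ x, x < m' x → IsArc u x (m' x) := by
    intro x hx
    have hxV : x ∈ V' := by
      by_contra hc
      rw [hout x hc] at hx
      omega
    obtain ⟨t, ht, y, hy, rfl⟩ := (hV' x).1 hxV
    rw [hm' t ht y hy] at hx ⊢
    exact hu t ht y (by omega)
  refine ⟨V', m', ⟨fun x => ?_, fun x => ?_, fun a b => ?_⟩, hV', hm'⟩
  · constructor
    · intro hx
      by_contra hc
      exact hx (hout x hc)
    · intro hx
      obtain ⟨t, ht, y, hy, rfl⟩ := (hV' x).1 hx
      rw [hm' t ht y hy]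
      have := (h.ne_iff y).2 hy
      omega
  · by_cases hx : x ∈ V'
    · obtain ⟨t, ht, y, hy, rfl⟩ := (hV' x).1 hx
      rw [hm' t ht y hy, hm' t ht _ (h.mem_of_mem hy), h.invol]
    · rw [hout x hx, hout x hx]
  · rintro ⟨h1, h2, h3⟩
    exact (harc a (by omega)).not_crossing (harc b (by omega)) ⟨h1, h2, h3⟩

theorem hasArcs_union_iff {V V' : Finset ℕ} {m m' : ℕ → ℕ} {A : Finset ℕ}
    (h : IsNCMatching V m) (h' : IsNCMatching V' m')
    (hV' : ∀ x, x ∈ V' ↔ ∃ t ∈ A, ∃ y ∈ V, x = y + t)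
    (hm' : ∀ t ∈ A, ∀ y ∈ V, m' (y + t) = m y + t) (u : ℕ → Bool) :
    HasArcs u m' ↔ ∀ t ∈ A, HasArcsAt u m t := by
  constructor
  · intro hA t ht a ha
    have haV := h.mem_of_lt ha
    rw [← hm' t ht a haV]
    exact hA _ (by rw [hm' t ht a haV]; omega)
  · intro hA x hx
    obtain ⟨t, ht, y, hy, rfl⟩ := (hV' x).1 (h'.mem_of_lt hx)
    rw [hm' t ht y hy] at hx ⊢
    exact hA t ht y (by omega)

theorem hasArcsAt_congr {V : Finset ℕ} {m : ℕ → ℕ} (h : IsNCMatching V m) {L : ℕ}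
    (hV : V ⊆ Finset.Icc 1 L) {t : ℕ} {u v : ℕ → Bool}
    (huv : ∀ x ∈ Finset.Icc (t + 1) (t + L), u x = v x) :
    HasArcsAt u m t ↔ HasArcsAt v m t := by
  refine forall₂_congr fun a ha => isArc_congr fun x hx => huv x ?_
  have h1 := Finset.mem_Icc.1 (hV (h.mem_of_lt ha))
  have h2 := Finset.mem_Icc.1 (hV (h.mem_of_mem (h.mem_of_lt ha)))
  rw [Finset.mem_Icc] at hx ⊢
  omega

/-- The probability that translates of a set of arcs occur in a uniform Dyck word of length `R` is
obtained from the corresponding probability for uniform words by correcting for the number of points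
in the unbounded face. -/
theorem exists_coins_hasArcsAt_and_isDyckOn {V : Finset ℕ} {m : ℕ → ℕ} (h : IsNCMatching V m)
    {L R : ℕ} (hV : V ⊆ Finset.Icc 1 L) {A : Finset ℕ} (hA : ∀ t ∈ A, t + L ≤ R) (s : Bool) :
    ∃ k ≤ R, R ≤ k + L * A.card ∧ (Even R → Even k) ∧
      (coins (ℕ × Bool)).real {ω | (∀ t ∈ A, HasArcsAt (sideWord s ω) m t) ∧
        IsDyckOn (Finset.Icc 1 R) (sideWord s ω)} =
      (coins (ℕ × Bool)).real {ω | ∀ t ∈ A, HasArcsAt (sideWord s ω) m t} * dyckProb k := by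
  classical
  by_cases hq : (coins (ℕ × Bool)).real {ω | ∀ t ∈ A, HasArcsAt (sideWord s ω) m t} = 0
  -- If the arcs cannot occur together, both sides vanish and any admissible `k` will do. Otherwise
  -- some word realises them, so their union is a matching and `k` is its number of outer points.
  · refine ⟨R, le_rfl, by omega, id, ?_⟩
    rw [hq, zero_mul]
    refine le_antisymm ?_ measureReal_nonneg
    rw [← hq]
    exact measureReal_mono fun ω hω => hω.1
  obtain ⟨ω, hω⟩ : {ω | ∀ t ∈ A, HasArcsAt (sideWord s ω) m t}.Nonempty := by
    by_contra hemp
    rw [Set.not_nonempty_iff_eq_empty.1 hemp] at hq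
    simp at hq
  obtain ⟨V', m', h', hV', hm'⟩ := exists_union_matching h (u := sideWord s ω) hω
  have hVR : V' ⊆ Finset.Icc 1 R := by
    intro x hx
    obtain ⟨t, ht, y, hy, rfl⟩ := (hV' x).1 hx
    have := Finset.mem_Icc.1 (hV hy)
    have := hA t ht
    rw [Finset.mem_Icc]
    omega
  simp only [← hasArcs_union_iff h h' hV' hm'] at hq ⊢
  rw [coins_hasArcs_and_isDyckOn h' hVR, coins_hasArcs h' hVR]
  rw [coins_hasArcs h' hVR] at hq
  refine ⟨(outerVertices m' R).card, ?_, ?_, ?_, rfl⟩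
  · have := card_faces h' hVR
    omega
  -- A point that is not outer is covered by an arc of some translate, hence lies in one of the
  -- `A.card` windows of length `L`.
  · have hsub : Finset.Icc 1 R ⊆ outerVertices m' R ∪ A.biUnion fun t => Finset.Icc (t + 1) (t + L)
        := by
      intro x hx
      rw [Finset.mem_union]
      by_contra hcon
      push Not at hcon
      have key : ∀ y, y ∈ V' → (y ≤ x ∧ x ≤ m' y) → False := by
        intro y hy hxy
        obtain ⟨t, ht, z, hz, rfl⟩ := (hV' y).1 hy
        rw [hm' t ht z hz] at hxy
        have h1 := Finset.mem_Icc.1 (hV hz)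
        have h2 := Finset.mem_Icc.1 (hV (h.mem_of_mem hz))
        refine hcon.2 (Finset.mem_biUnion.2 ⟨t, ht, Finset.mem_Icc.2 ⟨by omega, by omega⟩⟩)
      refine hcon.1 (mem_outerVertices.2 ⟨Finset.mem_Icc.1 hx, ?_, fun b hb hxb => ?_⟩)
      · by_contra hne
        have hxV := (h'.ne_iff x).1 hne
        rcases lt_or_gt_of_ne hne with hlt | hlt
        · exact key (m' x) (h'.mem_of_mem hxV) ⟨hlt.le, by rw [h'.invol]⟩
        · exact key x hxV ⟨le_rfl, hlt.le⟩
      · exact key b (h'.mem_of_lt (hb.trans hxb)) ⟨hb.le, hxb.le⟩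
    have h1 := (Finset.card_le_card hsub).trans (Finset.card_union_le _ _)
    have h2 := Finset.card_biUnion_le_card_mul A (fun t => Finset.Icc (t + 1) (t + L)) L
      (fun t _ => by rw [Nat.card_Icc]; omega)
    rw [Nat.card_Icc] at h1
    rw [mul_comm L]
    omega
  · intro hR
    have h1 := card_faces h' hVR
    have h2 := even_innerVertices_of_arcsProb_ne_zero hq
    -- Positive probability forces every inner face to have an even number of points, so `k` has the
    -- parity of `R`.
    have h3 : Even (∑ a ∈ Finset.Icc 1 R with a < m' a, (2 + (innerVertices m' a).card)) :=
      Finset.even_sum _ fun a ha => (even_two).add (h2 a ha)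
    rw [h1] at hR
    exact (Nat.even_add.1 hR).2 h3

namespace Shape

/-- The arcs of the translate by `t` of the shape `S` all occur in the two words encoded by `ω`. -/
def Occurs (S : Shape) (t : ℕ) (ω : ℕ × Bool → Bool) : Prop :=
  HasArcsAt (sideWord true ω) S.loop.upper t ∧ HasArcsAt (sideWord false ω) S.loop.lower t

/-- The bits on which the occurrence of a translate by `t` of a shape of length `L` depends. -/
def window (t L : ℕ) : Finset (ℕ × Bool) := Finset.Icc (t + 1) (t + L) ×ˢ Finset.univ

theorem dependsOn_occurs (S : Shape) (t : ℕ) :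
    DependsOn (S.Occurs t) (window t (2 * S.halfLength) : Set (ℕ × Bool)) := by
  intro ω ω' h
  refine propext (and_congr ?_ ?_)
  · exact hasArcsAt_congr S.loop.upper_nc S.subset_base fun x hx => h (x, true) (by
      simpa [window] using hx)
  · exact hasArcsAt_congr S.loop.lower_nc S.subset_base fun x hx => h (x, false) (by
      simpa [window] using hx)

theorem measurableSet_occurs (S : Shape) (t : ℕ) : MeasurableSet {ω | S.Occurs t ω} :=
  (S.dependsOn_occurs t).measurableSet

theorem halfLength_pos (S : Shape) : 0 < S.halfLength := by
  have := Finset.mem_Icc.1 (S.subset_base S.one_mem)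
  omega

end Shape

/-! ### Components of a meandric system -/

namespace LoopSystem

/-- The arcs of the translate by `t` of the shape `S` are arcs of `M`. -/
def HasTranslate {V : Finset ℕ} (M : LoopSystem V) (S : Shape) (t : ℕ) : Prop :=
  ∀ x ∈ S.support, M.upper (x + t) = S.loop.upper x + t ∧ M.lower (x + t) = S.loop.lower x + t

variable {V : Finset ℕ} {M : LoopSystem V} {S : Shape} {t : ℕ}

theorem Joined.mem {x y : ℕ} (h : M.Joined x y) (hx : x ∈ V) : y ∈ V := by
  induction h with
  | refl => exact hx
  | tail _ hab ih =>
    rcases hab with rfl | rfl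
    · exact M.upper_nc.mem_of_mem ih
    · exact M.lower_nc.mem_of_mem ih

/-- The translated support is stable under both matchings of `M`, so nothing else is reached; all of
it is reached because `S` is a single loop. -/
theorem HasTranslate.setOf_joined (h : M.HasTranslate S t) :
    {y | M.Joined (1 + t) y} = (fun x => x + t) '' (S.support : Set ℕ) := by
  apply Set.Subset.antisymm
  · intro y hy
    change M.Joined (1 + t) y at hy
    induction hy with
    | refl => exact ⟨1, S.one_mem, rfl⟩
    | tail _ hab ih =>
      obtain ⟨x, hx, rfl⟩ := ih
      rcases hab with rfl | rfl
      · exact ⟨S.loop.upper x, S.loop.upper_nc.mem_of_mem hx, (h x hx).1.symm⟩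
      · exact ⟨S.loop.lower x, S.loop.lower_nc.mem_of_mem hx, (h x hx).2.symm⟩
  · rintro _ ⟨y, hy, rfl⟩
    have hj := S.connected 1 S.one_mem y hy
    change M.Joined (1 + t) (y + t)
    clear hy
    induction hj with
    | refl => exact Relation.ReflTransGen.refl
    | @tail b c h1b hbc ih =>
      have hb := Joined.mem h1b S.one_mem
      refine ih.tail ?_
      rcases hbc with rfl | rfl
      · exact Or.inl (h b hb).1.symm
      · exact Or.inr (h b hb).2.symm

theorem translate_injective (S : Shape) :
    Function.Injective fun t : ℕ => (fun x => x + t) '' (S.support : Set ℕ) := by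
  have key : ∀ s t : ℕ, (fun x => x + s) '' (S.support : Set ℕ)
      = (fun x => x + t) '' (S.support : Set ℕ) → t ≤ s := by
    intro s t h
    obtain ⟨x, hx, hxs⟩ := h ▸ Set.mem_image_of_mem (fun x => x + s) (Finset.mem_coe.2 S.one_mem)
    have := Finset.mem_Icc.1 (S.subset_base hx)
    simp only at hxs
    omega
  exact fun s t h => le_antisymm (key t s h.symm) (key s t h)

theorem isLeast_translate (S : Shape) (t : ℕ) :
    IsLeast ((fun x => x + t) '' (S.support : Set ℕ)) (1 + t) := by
  refine ⟨⟨1, S.one_mem, rfl⟩, ?_⟩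
  rintro _ ⟨x, hx, rfl⟩
  have := Finset.mem_Icc.1 (S.subset_base hx)
  simp only
  omega

end LoopSystem

namespace MeandricSystem

open LoopSystem

variable {n : ℕ} {M : MeandricSystem n} {S : Shape}

theorem isComponent_translate_iff {t : ℕ} :
    (M.IsComponent ((fun x => x + t) '' (S.support : Set ℕ)) ∧
      M.HasShape ((fun x => x + t) '' (S.support : Set ℕ)) S) ↔
    t + 2 * S.halfLength ≤ 2 * n ∧ LoopSystem.HasTranslate M S t := by
  constructor
  · rintro ⟨⟨x, hx, hC⟩, s, hs, hT⟩
    obtain rfl := translate_injective S hs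
    refine ⟨?_, hT⟩
    have h1 : 2 * S.halfLength + t ∈ (fun x => x + t) '' (S.support : Set ℕ) :=
      ⟨_, S.last_mem, rfl⟩
    rw [hC] at h1
    have h2 := Finset.mem_Icc.1 (Joined.mem h1 hx)
    omega
  · rintro ⟨ht, hT⟩
    refine ⟨⟨1 + t, ?_, hT.setOf_joined.symm⟩, t, rfl, hT⟩
    have := S.halfLength_pos
    rw [Finset.mem_Icc]
    omega

theorem hasShapeAt_iff {t : ℕ} : M.HasShapeAt S (1 + t) ↔
    t + 2 * S.halfLength ≤ 2 * n ∧ LoopSystem.HasTranslate M S t := by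
  rw [← isComponent_translate_iff]
  constructor
  · rintro ⟨C, hC, hS, hl⟩
    obtain ⟨s, rfl, hT⟩ := id hS
    have h1 := hl.unique (isLeast_translate S s)
    obtain rfl : t = s := by omega
    exact ⟨hC, hS⟩
  · rintro ⟨hC, hS⟩
    exact ⟨_, hC, hS, isLeast_translate S t⟩

open Classical in
theorem numComponents_eq : M.numComponents S =
    ((Finset.range (2 * n + 1 - 2 * S.halfLength)).filter
      fun t => LoopSystem.HasTranslate M S t).card := by
  have : {C : Set ℕ | M.IsComponent C ∧ M.HasShape C S} =
      (fun t : ℕ => (fun x => x + t) '' (S.support : Set ℕ)) ''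
        ((Finset.range (2 * n + 1 - 2 * S.halfLength)).filter
          fun t => LoopSystem.HasTranslate M S t : Set ℕ) := by
    ext C
    constructor
    · rintro ⟨hC, hS⟩
      obtain ⟨t, rfl, -⟩ := id hS
      refine ⟨t, ?_, rfl⟩
      have := isComponent_translate_iff.1 ⟨hC, hS⟩
      rw [Finset.mem_coe, Finset.mem_filter, Finset.mem_range]
      exact ⟨by omega, this.2⟩
    · rintro ⟨t, ht, rfl⟩
      rw [Finset.mem_coe, Finset.mem_filter, Finset.mem_range] at ht
      exact isComponent_translate_iff.2 ⟨by omega, ht.2⟩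
  rw [numComponents, this, Set.ncard_image_of_injective _ (translate_injective S),
    Set.ncard_coe_finset]

/-- The two words encoded by `ω` are the words of `M`. -/
def Encodes (M : MeandricSystem n) (ω : ℕ × Bool → Bool) : Prop :=
  ∀ x ∈ Finset.Icc 1 (2 * n), sideWord true ω x = decide (x < M.upper x) ∧
    sideWord false ω x = decide (x < M.lower x)

theorem eq_of_isArc {V : Finset ℕ} {a b : ℕ} {m : ℕ → ℕ} (h : IsNCMatching V m) {u : ℕ → Bool}
    (hV : V = Finset.Icc 1 (2 * n)) (hu : ∀ x ∈ V, u x = decide (x < m x)) (ha : a ∈ V)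
    (hab : IsArc u a b) : m a = b := by
  subst hV
  have h1 : a < m a := by
    have := hu a ha
    rw [hab.2.1] at this
    simpa using this.symm
  have h2 := h.mem_of_mem ha
  refine (h.isArc hu h1 fun x hx => ?_).right_unique hab
  rw [Finset.mem_Icc] at ha h2
  rw [Finset.mem_Ioo] at hx
  rw [Finset.mem_Icc]
  omega

/-- Since `l` moves every point of `[1, 2n]`, it is the parenthesis matching of its word: interiors
of its arcs are fully matched, and partners are unique. -/
theorem hasArcsAt_iff_of_word {V W : Finset ℕ} {m l : ℕ → ℕ} (hm : IsNCMatching W m)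
    (hl : IsNCMatching V l) {u : ℕ → Bool} {L t : ℕ} (hV : V = Finset.Icc 1 (2 * n))
    (hu : ∀ x ∈ V, u x = decide (x < l x)) (hW : W ⊆ Finset.Icc 1 L) (ht : t + L ≤ 2 * n) :
    HasArcsAt u m t ↔ ∀ x ∈ W, l (x + t) = m x + t := by
  have hmem : ∀ x ∈ W, x + t ∈ V := by
    intro x hx
    have := Finset.mem_Icc.1 (hW hx)
    rw [hV, Finset.mem_Icc]
    omega
  constructor
  · intro h x hx
    rcases lt_or_gt_of_ne ((hm.ne_iff x).2 hx) with hlt | hlt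
    · have h1 := h (m x) (by rwa [hm.invol])
      rw [hm.invol] at h1
      have h2 := eq_of_isArc hl hV hu (hmem _ (hm.mem_of_mem hx)) h1
      rw [← h2, hl.invol]
    · exact eq_of_isArc hl hV hu (hmem x hx) (h x hlt)
  · intro h a ha
    have haW := hm.mem_of_lt ha
    have h1 := h a haW
    rw [← h1]
    refine hl.isArc hu (by omega) ?_
    intro x hx
    have h2 := hmem a haW
    have h3 := hmem _ (hm.mem_of_mem haW)
    rw [← h1] at h3
    rw [hV, Finset.mem_Icc] at h2 h3 ⊢
    rw [Finset.mem_Ioo] at hx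
    omega

theorem Encodes.occurs_iff {ω : ℕ × Bool → Bool} (h : Encodes M ω) {t : ℕ}
    (ht : t + 2 * S.halfLength ≤ 2 * n) :
    S.Occurs t ω ↔ LoopSystem.HasTranslate M S t := by
  unfold Shape.Occurs LoopSystem.HasTranslate
  rw [hasArcsAt_iff_of_word S.loop.upper_nc M.upper_nc rfl (fun x hx => (h x hx).1) S.subset_base
    ht, hasArcsAt_iff_of_word S.loop.lower_nc M.lower_nc rfl (fun x hx => (h x hx).2)
    S.subset_base ht]
  exact ⟨fun hh x hx => ⟨hh.1 x hx, hh.2 x hx⟩, fun hh =>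
    ⟨fun x hx => (hh x hx).1, fun x hx => (hh x hx).2⟩⟩

theorem matching_unique {m l : ℕ → ℕ} (hm : IsNCMatching (Finset.Icc 1 (2 * n)) m)
    (hl : IsNCMatching (Finset.Icc 1 (2 * n)) l) {u : ℕ → Bool}
    (hu : ∀ x ∈ Finset.Icc 1 (2 * n), u x = decide (x < m x))
    (hu' : ∀ x ∈ Finset.Icc 1 (2 * n), u x = decide (x < l x)) : m = l := by
  funext x
  by_cases hx : x ∈ Finset.Icc 1 (2 * n)
  · have h := (hasArcsAt_iff_of_word (t := 0) hm hl rfl hu' (Finset.Subset.refl _) (by omega)).1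
      ((hasArcsAt_iff_of_word (t := 0) hm hm rfl hu (Finset.Subset.refl _) (by omega)).2
        fun x _ => rfl) x hx
    simpa using h.symm
  · rw [hm.eq_of_notMem hx, hl.eq_of_notMem hx]

theorem Encodes.unique {N : MeandricSystem n} {ω : ℕ × Bool → Bool} (h : Encodes M ω)
    (h' : Encodes N ω) : M = N :=
  LoopSystem.ext
    (matching_unique M.upper_nc N.upper_nc (fun x hx => (h x hx).1) fun x hx => (h' x hx).1)
    (matching_unique M.lower_nc N.lower_nc (fun x hx => (h x hx).2) fun x hx => (h' x hx).2)

/-- The two words encoded by `ω` are Dyck words up to time `R`. -/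
def BothDyck (R : ℕ) (ω : ℕ × Bool → Bool) : Prop :=
  IsDyckOn (Finset.Icc 1 R) (sideWord true ω) ∧ IsDyckOn (Finset.Icc 1 R) (sideWord false ω)

theorem bothDyck_iff_exists_encodes {ω : ℕ × Bool → Bool} :
    BothDyck (2 * n) ω ↔ ∃ M : MeandricSystem n, Encodes M ω := by
  constructor
  · rintro ⟨h1, h2⟩
    obtain ⟨m, hm, hmu⟩ := h1.exists_matching
    obtain ⟨l, hl, hlu⟩ := h2.exists_matching
    exact ⟨⟨m, l, hm, hl⟩, fun x hx => ⟨hmu x hx, hlu x hx⟩⟩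
  · rintro ⟨M, hM⟩
    exact ⟨M.upper_nc.isDyckOn (Finset.Subset.refl _) (fun x hx => M.upper_nc.mem_of_mem hx)
      fun x hx => (hM x hx).1, M.lower_nc.isDyckOn (Finset.Subset.refl _)
      (fun x hx => M.lower_nc.mem_of_mem hx) fun x hx => (hM x hx).2⟩

end MeandricSystem

/-! ### Ratios of probabilities of Dyck words -/

/-- The recurrence `(i + 2) * Cat (i + 1) = 2 * (2i + 1) * Cat i`. The ratio is `1 + O(1/i)`, so
shortening a long Dyck word slightly barely changes its probability. -/
theorem dyckProb_two_mul_succ (i : ℕ) :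
    dyckProb (2 * i) = dyckProb (2 * (i + 1)) * (1 + 3 / (2 * i + 1)) := by
  have h1 := succ_mul_catalan_eq_centralBinom (i + 1)
  have h2 := succ_mul_catalan_eq_centralBinom i
  have h3 := Nat.succ_mul_centralBinom_succ i
  rw [← h1, ← h2] at h3
  have h4 : ((i : ℝ) + 2) * catalan (i + 1) = 2 * (2 * i + 1) * catalan i := by
    have h5 : (i + 1) * ((i + 2) * catalan (i + 1)) = (i + 1) * (2 * (2 * i + 1) * catalan i) := by
      rw [h3]; ring
    exact_mod_cast Nat.eq_of_mul_eq_mul_left (Nat.succ_pos i) h5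
  rw [dyckProb_two_mul, dyckProb_two_mul, pow_succ]
  field_simp
  linarith

theorem dyckProb_anti {i j : ℕ} (h : i ≤ j) : dyckProb (2 * j) ≤ dyckProb (2 * i) := by
  induction j, h using Nat.le_induction with
  | base => exact le_rfl
  | succ j _ ih =>
    refine le_trans ?_ ih
    rw [dyckProb_two_mul_succ j]
    have := dyckProb_nonneg (2 * (j + 1))
    have h3 : (0 : ℝ) ≤ 3 / (2 * j + 1) := by positivity
    nlinarith

/-- The ratios telescope. As `2 * a ≤ n`, all indices stay at least `n / 2`, so each factor `1 + 3 /
(2i + 1)` is at most `exp (3 / n)`. -/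
theorem dyckProb_le_exp_mul {n a : ℕ} (h : 2 * a ≤ n) :
    dyckProb (2 * (n - a)) ≤ Real.exp (3 / n * a) * dyckProb (2 * n) := by
  induction a with
  | zero => simp
  | succ a ih =>
    have h1 := ih (by omega)
    have h2 : n - a = n - (a + 1) + 1 := by omega
    have h3 := dyckProb_two_mul_succ (n - (a + 1))
    rw [← h2] at h3
    have hn : (0 : ℝ) < n := by exact_mod_cast (by omega : 0 < n)
    have h4 : (n : ℝ) ≤ 2 * ((n - (a + 1) : ℕ) : ℝ) + 1 := by
      exact_mod_cast (by omega : n ≤ 2 * (n - (a + 1)) + 1)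
    have h5 : 1 + 3 / (2 * ((n - (a + 1) : ℕ) : ℝ) + 1) ≤ Real.exp (3 / n) := by
      have h6 : 3 / (2 * ((n - (a + 1) : ℕ) : ℝ) + 1) ≤ 3 / n :=
        div_le_div_of_nonneg_left (by norm_num) hn h4
      have := Real.add_one_le_exp (3 / (n : ℝ))
      linarith
    rw [h3]
    calc dyckProb (2 * (n - a)) * (1 + 3 / (2 * ((n - (a + 1) : ℕ) : ℝ) + 1))
        ≤ (Real.exp (3 / n * a) * dyckProb (2 * n)) * Real.exp (3 / n) :=
          mul_le_mul h1 h5 (by positivity)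
            (mul_nonneg (Real.exp_pos _).le (dyckProb_nonneg _))
      _ = Real.exp (3 / n * (a + 1 : ℕ)) * dyckProb (2 * n) := by
          rw [mul_right_comm, ← Real.exp_add]
          congr 2
          push_cast
          ring

theorem dyckProb_two_mul_le_one (n : ℕ) : dyckProb (2 * n) ≤ 1 := by
  have h := dyckProb_anti (Nat.zero_le n)
  simpa [dyckProb] using h

/-- A polynomial lower bound, from that on the central binomial coefficient. It need not be sharp,
as it is only set against an exponentially small factor. -/
theorem one_le_mul_dyckProb {n : ℕ} (hn : 0 < n) : 1 ≤ (2 * n * (n + 1) : ℝ) * dyckProb (2 * n) := by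
  have h1 := Nat.four_pow_le_two_mul_self_mul_centralBinom n hn
  rw [← succ_mul_catalan_eq_centralBinom] at h1
  have h2 : (4 : ℝ) ^ n ≤ 2 * n * ((n + 1) * catalan n) := by exact_mod_cast h1
  rw [dyckProb_two_mul, ← mul_div_assoc, le_div_iff₀ (by positivity)]
  linarith

/-! ### The law of a meandric system in terms of fair bits -/

namespace MeandricSystem

variable {n : ℕ}

/-- All `2n` letters of both words are prescribed. The value does not depend on `M`, so conditioning
the bits on the Dyck event gives the uniform law. -/
theorem coins_encodes (M : MeandricSystem n) :
    (coins (ℕ × Bool)).real {ω | Encodes M ω} = (1 / 2) ^ (4 * n) := by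
  classical
  have h := coins_forall (ι := ℕ × Bool) (κ := ℕ × Bool)
    (p := fun i ω => ω i = decide (i.1 < if i.2 then M.upper i.1 else M.lower i.1))
    (T := fun i => {i}) (fun i ω ω' hω => by
      have := hω i (by simp)
      simp only [this]) (Finset.Icc 1 (2 * n) ×ˢ Finset.univ) (by
      intro i _ j _ hij
      simpa using hij)
  simp only [coins_apply, Finset.prod_const, Finset.card_product, Nat.card_Icc, Finset.card_univ,
    Fintype.card_bool] at h
  rw [show 4 * n = (2 * n + 1 - 1) * 2 by omega, ← h]
  congr 1
  ext ω
  simp only [Encodes, sideWord, Set.mem_ofPred_eq, Finset.mem_product, Finset.mem_univ, and_true,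
    Prod.forall, Bool.forall_bool]
  exact ⟨fun h x => ⟨fun hx => (h x hx).2, fun hx => (h x hx).1⟩,
    fun h x hx => ⟨(h x).2 hx, (h x).1 hx⟩⟩

theorem dependsOn_encodes (M : MeandricSystem n) :
    DependsOn (Encodes M) (Finset.Icc 1 (2 * n) ×ˢ Finset.univ : Finset (ℕ × Bool)) := by
  intro ω ω' h
  refine propext (forall₂_congr fun x hx => ?_)
  have h1 := h (x, true) (by simpa using hx)
  have h2 := h (x, false) (by simpa using hx)
  simp only [sideWord, h1, h2]

theorem coins_bothDyck : (coins (ℕ × Bool)).real {ω | BothDyck (2 * n) ω} = dyckProb (2 * n) ^ 2 := by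
  have h := coins_and (S := sideBits true (Finset.Icc 1 (2 * n)))
    (T := sideBits false (Finset.Icc 1 (2 * n)))
    (dependsOn_sideWord (p := fun u => IsDyckOn (Finset.Icc 1 (2 * n)) u) fun u v huv =>
      isDyckOn_congr huv) (dependsOn_sideWord (p := fun u => IsDyckOn (Finset.Icc 1 (2 * n)) u)
      fun u v huv => isDyckOn_congr huv) (disjoint_sideBits_of_ne _ _ (by simp))
  rw [coins_isDyckOn, coins_isDyckOn, Nat.card_Icc, Nat.add_sub_cancel] at h
  rw [sq, ← h]
  rfl

/-- Expectations for a random meandric system are expectations conditionally on the event that both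
words are Dyck. -/
theorem integral_uniformMeandric_mul (g : MeandricSystem n → ℝ) {G : (ℕ × Bool → Bool) → ℝ}
    (hG : ∀ M ω, Encodes M ω → G ω = g M) :
    (∫ M, g M ∂uniformMeandric n) * dyckProb (2 * n) ^ 2
      = ∫ ω in {ω | BothDyck (2 * n) ω}, G ω ∂coins (ℕ × Bool) := by
  classical
  have : Fintype (MeandricSystem n) := Fintype.ofFinite _
  have : MeasurableSingletonClass (MeandricSystem n) := ⟨fun _ => trivial⟩
  have hm : ∀ M : MeandricSystem n, MeasurableSet {ω | Encodes M ω} := fun M =>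
    (dependsOn_encodes M).measurableSet
  have key : ∀ (f : MeandricSystem n → ℝ) (F : (ℕ × Bool → Bool) → ℝ),
      (∀ M ω, Encodes M ω → F ω = f M) →
      ∫ ω in {ω | BothDyck (2 * n) ω}, F ω ∂coins (ℕ × Bool) = (1 / 2) ^ (4 * n) * ∑ M, f M := by
    intro f F hF
    have hset : {ω | BothDyck (2 * n) ω} = ⋃ M : MeandricSystem n, {ω | Encodes M ω} := by
      ext ω
      simp [bothDyck_iff_exists_encodes]
    rw [hset, integral_iUnion_fintype hm, Finset.mul_sum]
    · refine Finset.sum_congr rfl fun M _ => ?_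
      rw [setIntegral_congr_fun (hm M) fun ω hω => hF M ω hω, setIntegral_const, coins_encodes,
        smul_eq_mul]
    · intro M N hMN
      rw [Function.onFun, Set.disjoint_left]
      exact fun ω h1 h2 => hMN (h1.unique h2)
    · intro M
      refine (integrableOn_congr_fun (fun ω hω => hF M ω hω) (hm M)).2 ?_
      exact integrableOn_const
  -- The constant function provides the normalisation: the number of systems times `2 ^ (-4n)` is
  -- the probability that both words are Dyck.
  have h1 := key (fun _ => 1) (fun _ => 1) fun _ _ _ => rfl
  rw [setIntegral_const, coins_bothDyck, smul_eq_mul, mul_one] at h1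
  rw [key g G hG, h1, integral_fintype .of_finite]
  have hr : ∀ M : MeandricSystem n, (uniformMeandric n).real {M}
      = 1 / Fintype.card (MeandricSystem n) := by
    intro M
    rw [measureReal_def, uniformMeandric, uniformOn_univ, Measure.count_singleton]
    simp
  have hc : (Fintype.card (MeandricSystem n) : ℝ) ≠ 0 := by
    exact_mod_cast Fintype.card_ne_zero
  simp only [hr, smul_eq_mul, ← Finset.mul_sum]
  simp only [Finset.sum_const, Finset.card_univ, nsmul_eq_mul, mul_one]
  field_simp

end MeandricSystem

/-! ### Comparison of the generating functions -/

namespace Shape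

variable (S : Shape)

open Classical in
/-- The number of occurrences of the shape `S` in the first `N` letters of the two words encoded by
`ω`. -/
noncomputable def count (N : ℕ) (ω : ℕ × Bool → Bool) : ℕ :=
  ((Finset.range (N + 1 - 2 * S.halfLength)).filter fun t => S.Occurs t ω).card

/-- The probability that `S` occurs at each of the places of `A`. -/
noncomputable def occursProb (A : Finset ℕ) : ℝ :=
  (coins (ℕ × Bool)).real {ω | ∀ t ∈ A, S.Occurs t ω}

theorem measurableSet_forall_occurs (A : Finset ℕ) :
    MeasurableSet {ω | ∀ t ∈ A, S.Occurs t ω} := by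
  rw [show {ω | ∀ t ∈ A, S.Occurs t ω} = ⋂ t ∈ A, {ω | S.Occurs t ω} by ext; simp]
  exact A.measurableSet_biInter fun t _ => S.measurableSet_occurs t

/-- The power is a product over places of `1 + v * 1_{occurs}`, expanded over subsets. -/
theorem pow_count (N : ℕ) (v : ℝ) (ω : ℕ × Bool → Bool) :
    (1 + v) ^ S.count N ω = ∑ A ∈ (Finset.range (N + 1 - 2 * S.halfLength)).powerset,
      v ^ A.card * {ω | ∀ t ∈ A, S.Occurs t ω}.indicator 1 ω := by
  classical
  have h : (1 + v) ^ S.count N ω = ∏ t ∈ Finset.range (N + 1 - 2 * S.halfLength),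
      (1 + if S.Occurs t ω then v else 0) := by
    rw [count, ← Finset.prod_const, Finset.prod_filter]
    refine Finset.prod_congr rfl fun t _ => ?_
    split_ifs <;> simp
  rw [h, Finset.prod_one_add]
  refine Finset.sum_congr rfl fun A _ => ?_
  by_cases hA : ∀ t ∈ A, S.Occurs t ω
  · rw [Set.indicator_of_mem (show ω ∈ {ω | ∀ t ∈ A, S.Occurs t ω} from hA),
      Finset.prod_congr rfl fun t ht => if_pos (hA t ht)]
    simp
  · rw [Set.indicator_of_notMem (show ω ∉ {ω | ∀ t ∈ A, S.Occurs t ω} from hA)]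
    push Not at hA
    obtain ⟨t, ht, h2⟩ := hA
    rw [Finset.prod_eq_zero ht (if_neg h2)]
    simp

theorem setIntegral_pow_count (N : ℕ) (v : ℝ) (D : Set (ℕ × Bool → Bool)) :
    ∫ ω in D, (1 + v) ^ S.count N ω ∂coins (ℕ × Bool) =
      ∑ A ∈ (Finset.range (N + 1 - 2 * S.halfLength)).powerset,
        v ^ A.card * (coins (ℕ × Bool)).real ({ω | ∀ t ∈ A, S.Occurs t ω} ∩ D) := by
  simp only [pow_count]
  rw [integral_finsetSum]
  · refine Finset.sum_congr rfl fun A _ => ?_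
    rw [integral_const_mul, integral_indicator_one (S.measurableSet_forall_occurs A),
      measureReal_restrict_apply (S.measurableSet_forall_occurs A)]
  · intro A _
    exact ((integrable_const (1 : ℝ)).indicator (S.measurableSet_forall_occurs A)).const_mul _

/-- The generating function of the number of occurrences in `N` uniform random letters. -/
noncomputable def genFun (N : ℕ) (v : ℝ) : ℝ :=
  ∫ ω, (1 + v) ^ S.count N ω ∂coins (ℕ × Bool)

theorem genFun_eq (N : ℕ) (v : ℝ) : S.genFun N v =
    ∑ A ∈ (Finset.range (N + 1 - 2 * S.halfLength)).powerset, v ^ A.card * S.occursProb A := by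
  have := S.setIntegral_pow_count N v Set.univ
  rw [setIntegral_univ] at this
  simp only [Set.inter_univ] at this
  exact this

theorem dependsOn_forall_hasArcsAt {V : Finset ℕ} {m : ℕ → ℕ} (h : IsNCMatching V m) {L R : ℕ}
    (hV : V ⊆ Finset.Icc 1 L) {A : Finset ℕ} (hA : ∀ t ∈ A, t + L ≤ R) (s : Bool) :
    DependsOn (fun ω => ∀ t ∈ A, HasArcsAt (sideWord s ω) m t)
      (sideBits s (Finset.Icc 1 R) : Set (ℕ × Bool)) := by
  refine dependsOn_sideWord (p := fun u => ∀ t ∈ A, HasArcsAt u m t) fun u v huv => ?_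
  refine forall₂_congr fun t ht => hasArcsAt_congr h hV fun x hx => huv x ?_
  have := hA t ht
  rw [Finset.mem_Icc] at hx ⊢
  omega

theorem occursProb_eq_mul {R : ℕ} {A : Finset ℕ} (hA : ∀ t ∈ A, t + 2 * S.halfLength ≤ R) :
    S.occursProb A = (coins (ℕ × Bool)).real
        {ω | ∀ t ∈ A, HasArcsAt (sideWord true ω) S.loop.upper t} *
      (coins (ℕ × Bool)).real {ω | ∀ t ∈ A, HasArcsAt (sideWord false ω) S.loop.lower t} := by
  rw [← coins_and (dependsOn_forall_hasArcsAt S.loop.upper_nc S.subset_base hA true)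
    (dependsOn_forall_hasArcsAt S.loop.lower_nc S.subset_base hA false)
    (disjoint_sideBits_of_ne _ _ (by simp)), occursProb]
  congr 1
  ext ω
  exact forall₂_and

/-- The two sides of the axis use disjoint bits, so `exists_coins_hasArcsAt_and_isDyckOn` applies to
each; the remaining lengths are even, hence of the form `2 * i` and `2 * j`. -/
theorem coins_occurs_and_bothDyck {n : ℕ} {A : Finset ℕ}
    (hA : ∀ t ∈ A, t + 2 * S.halfLength ≤ 2 * n) :
    ∃ i j : ℕ, i ≤ n ∧ j ≤ n ∧ n ≤ i + S.halfLength * A.card ∧ n ≤ j + S.halfLength * A.card ∧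
      (coins (ℕ × Bool)).real {ω | (∀ t ∈ A, S.Occurs t ω) ∧ MeandricSystem.BothDyck (2 * n) ω} =
        S.occursProb A * (dyckProb (2 * i) * dyckProb (2 * j)) := by
  obtain ⟨k, hk1, hk2, hk3, hk⟩ :=
    exists_coins_hasArcsAt_and_isDyckOn S.loop.upper_nc S.subset_base hA true
  obtain ⟨l, hl1, hl2, hl3, hl⟩ :=
    exists_coins_hasArcsAt_and_isDyckOn S.loop.lower_nc S.subset_base hA false
  obtain ⟨i, hi⟩ := hk3 (even_two_mul n)
  obtain ⟨j, hj⟩ := hl3 (even_two_mul n)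
  have hdep' : ∀ s : Bool, DependsOn (fun ω => IsDyckOn (Finset.Icc 1 (2 * n)) (sideWord s ω))
      (sideBits s (Finset.Icc 1 (2 * n)) : Set (ℕ × Bool)) := fun s =>
    dependsOn_sideWord (p := fun u => IsDyckOn (Finset.Icc 1 (2 * n)) u) fun u v huv =>
      isDyckOn_congr huv
  have hdisj := disjoint_sideBits_of_ne (s := true) (t := false) (Finset.Icc 1 (2 * n))
    (Finset.Icc 1 (2 * n)) (by simp)
  have hu := dependsOn_forall_hasArcsAt S.loop.upper_nc S.subset_base hA true
  have hl' := dependsOn_forall_hasArcsAt S.loop.lower_nc S.subset_base hA false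
  refine ⟨i, j, by omega, by omega, ?_, ?_, ?_⟩
  · rw [mul_assoc] at hk2; omega
  · rw [mul_assoc] at hl2; omega
  · have e2 : {ω | (∀ t ∈ A, S.Occurs t ω) ∧ MeandricSystem.BothDyck (2 * n) ω} =
        {ω | ((∀ t ∈ A, HasArcsAt (sideWord true ω) S.loop.upper t) ∧
          IsDyckOn (Finset.Icc 1 (2 * n)) (sideWord true ω)) ∧
          ((∀ t ∈ A, HasArcsAt (sideWord false ω) S.loop.lower t) ∧
          IsDyckOn (Finset.Icc 1 (2 * n)) (sideWord false ω))} := by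
      ext ω
      have : (∀ t ∈ A, S.Occurs t ω) ↔ (∀ t ∈ A, HasArcsAt (sideWord true ω) S.loop.upper t) ∧
        ∀ t ∈ A, HasArcsAt (sideWord false ω) S.loop.lower t := forall₂_and
      simp only [Set.mem_ofPred_eq, this, MeandricSystem.BothDyck]
      tauto
    rw [e2, coins_and (hu.and (hdep' true)) (hl'.and (hdep' false)) hdisj, hk, hl,
      S.occursProb_eq_mul hA,
      show k = 2 * i by omega, show l = 2 * j by omega]
    ring

/-- The generating function of the number of components of shape `S`. -/
noncomputable def meandricGenFun (n : ℕ) (v : ℝ) : ℝ :=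
  ∫ M, (1 + v) ^ M.numComponents S ∂uniformMeandric n

theorem meandricGenFun_mul (n : ℕ) (v : ℝ) :
    S.meandricGenFun n v * dyckProb (2 * n) ^ 2 =
      ∑ A ∈ (Finset.range (2 * n + 1 - 2 * S.halfLength)).powerset, v ^ A.card *
        (coins (ℕ × Bool)).real
          {ω | (∀ t ∈ A, S.Occurs t ω) ∧ MeandricSystem.BothDyck (2 * n) ω} := by
  classical
  rw [meandricGenFun, MeandricSystem.integral_uniformMeandric_mul _
    (G := fun ω => (1 + v) ^ S.count (2 * n) ω), setIntegral_pow_count]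
  · rfl
  · intro M ω hM
    rw [MeandricSystem.numComponents_eq, count]
    congr 2
    refine Finset.filter_congr fun t ht => ?_
    rw [Finset.mem_range] at ht
    exact hM.occurs_iff (by omega)

theorem mem_powerset_range {n : ℕ} {A : Finset ℕ}
    (hA : A ∈ (Finset.range (2 * n + 1 - 2 * S.halfLength)).powerset) :
    ∀ t ∈ A, t + 2 * S.halfLength ≤ 2 * n := by
  intro t ht
  have := Finset.mem_range.1 (Finset.mem_powerset.1 hA ht)
  omega

theorem occursProb_nonneg (A : Finset ℕ) : 0 ≤ S.occursProb A := measureReal_nonneg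

/-- Term by term: `i, j ≤ n` and `dyckProb` decreases along even lengths, so conditioning can only
increase each joint occurrence probability. -/
theorem genFun_le_meandricGenFun (n : ℕ) {v : ℝ} (hv : 0 ≤ v) :
    S.genFun (2 * n) v ≤ S.meandricGenFun n v := by
  have hd : 0 < dyckProb (2 * n) := dyckProb_pos (even_two_mul n)
  refine le_of_mul_le_mul_right ?_ (pow_pos hd 2)
  rw [meandricGenFun_mul, genFun_eq, Finset.sum_mul]
  refine Finset.sum_le_sum fun A hA => ?_
  obtain ⟨i, j, hi, hj, -, -, h⟩ := S.coins_occurs_and_bothDyck (S.mem_powerset_range hA)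
  rw [h, mul_assoc]
  refine mul_le_mul_of_nonneg_left ?_ (pow_nonneg hv _)
  refine mul_le_mul_of_nonneg_left ?_ (S.occursProb_nonneg A)
  rw [sq]
  exact mul_le_mul (dyckProb_anti hi) (dyckProb_anti hj) hd.le (dyckProb_nonneg _)

/-- For `|A| ≤ n / (2ℓ)` conditioning costs at most a factor `exp (6ℓ / n)` per place, which is
absorbed into `v`. For larger `A` the Dyck probabilities are bounded by `1`: replacing `v` by `2 *
v` gains `2 ^ |A|`, which pays for the exponentially small prefactor. -/
theorem meandricGenFun_le {n : ℕ} (hn : 0 < n) {v : ℝ} (hv : 0 ≤ v) :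
    S.meandricGenFun n v ≤ S.genFun (2 * n) (v * Real.exp (6 * S.halfLength / n)) +
      (2 * n * (n + 1)) ^ 2 * Real.exp (- (Real.log 2 * (n / (2 * S.halfLength)))) *
        S.genFun (2 * n) (2 * v) := by
  have hd : 0 < dyckProb (2 * n) := dyckProb_pos (even_two_mul n)
  have hl : (0 : ℝ) < S.halfLength := by exact_mod_cast S.halfLength_pos
  have hn' : (0 : ℝ) < n := by exact_mod_cast hn
  refine le_of_mul_le_mul_right ?_ (pow_pos hd 2)
  rw [meandricGenFun_mul, genFun_eq, genFun_eq, Finset.mul_sum, ← Finset.sum_add_distrib,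
    Finset.sum_mul]
  refine Finset.sum_le_sum fun A hA => ?_
  obtain ⟨i, j, hi, hj, hi', hj', h⟩ := S.coins_occurs_and_bothDyck (S.mem_powerset_range hA)
  rw [h]
  have hQ := S.occursProb_nonneg A
  set q := S.occursProb A
  set r := A.card
  have key : dyckProb (2 * i) * dyckProb (2 * j) ≤
      (Real.exp (6 * S.halfLength / n) ^ r + (2 * n * (n + 1)) ^ 2 *
        Real.exp (- (Real.log 2 * (n / (2 * S.halfLength)))) * 2 ^ r) * dyckProb (2 * n) ^ 2 := by
    by_cases hr : 2 * (S.halfLength * r) ≤ n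
    · have hb : ∀ i, i ≤ n → n ≤ i + S.halfLength * r →
          dyckProb (2 * i) ≤ Real.exp (3 * S.halfLength / n * r) * dyckProb (2 * n) := by
        intro i hi hi'
        have := dyckProb_le_exp_mul (n := n) (a := n - i) (by omega)
        rw [Nat.sub_sub_self hi] at this
        refine this.trans (mul_le_mul_of_nonneg_right (Real.exp_le_exp.2 ?_) hd.le)
        have h2 : ((n - i : ℕ) : ℝ) ≤ S.halfLength * r := by
          exact_mod_cast (by omega : n - i ≤ S.halfLength * r)
        calc 3 / (n : ℝ) * ((n - i : ℕ) : ℝ) ≤ 3 / n * (S.halfLength * r) :=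
              mul_le_mul_of_nonneg_left h2 (by positivity)
          _ = 3 * S.halfLength / n * r := by ring
      calc dyckProb (2 * i) * dyckProb (2 * j)
          ≤ (Real.exp (3 * S.halfLength / n * r) * dyckProb (2 * n)) *
            (Real.exp (3 * S.halfLength / n * r) * dyckProb (2 * n)) :=
            mul_le_mul (hb i hi hi') (hb j hj hj') (dyckProb_nonneg _)
              (mul_nonneg (Real.exp_pos _).le hd.le)
        _ = Real.exp (6 * S.halfLength / n) ^ r * dyckProb (2 * n) ^ 2 := by
            rw [← Real.exp_nat_mul, mul_mul_mul_comm, ← Real.exp_add, sq]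
            congr 2
            ring
        _ ≤ _ := by
            refine mul_le_mul_of_nonneg_right ?_ (by positivity)
            exact le_add_of_nonneg_right (by positivity)
    · have h1 : 1 ≤ (2 * n * (n + 1) : ℝ) ^ 2 * dyckProb (2 * n) ^ 2 := by
        rw [← mul_pow]
        exact one_le_pow₀ (one_le_mul_dyckProb hn)
      have h2 : 1 ≤ Real.exp (- (Real.log 2 * (n / (2 * S.halfLength)))) * 2 ^ r := by
        have h3 : (2 : ℝ) ^ r = Real.exp (Real.log 2 * r) := by
          rw [mul_comm, Real.exp_nat_mul, Real.exp_log two_pos]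
        rw [h3, ← Real.exp_add]
        refine Real.one_le_exp ?_
        have h4 : (n : ℝ) / (2 * S.halfLength) ≤ r := by
          rw [div_le_iff₀ (by positivity)]
          have : (n : ℝ) < 2 * (S.halfLength * r) := by exact_mod_cast (by omega)
          linarith
        have := mul_le_mul_of_nonneg_left h4 (Real.log_nonneg one_le_two)
        linarith
      calc dyckProb (2 * i) * dyckProb (2 * j) ≤ 1 * 1 :=
            mul_le_mul (dyckProb_two_mul_le_one i) (dyckProb_two_mul_le_one j)
              (dyckProb_nonneg _) zero_le_one
        _ ≤ ((2 * n * (n + 1) : ℝ) ^ 2 * dyckProb (2 * n) ^ 2) *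
            (Real.exp (- (Real.log 2 * (n / (2 * S.halfLength)))) * 2 ^ r) :=
            mul_le_mul h1 h2 zero_le_one (zero_le_one.trans h1)
        _ ≤ _ := by
            have : 0 ≤ Real.exp (6 * S.halfLength / n) ^ r * dyckProb (2 * n) ^ 2 := by positivity
            linarith
  calc v ^ r * (q * (dyckProb (2 * i) * dyckProb (2 * j)))
      ≤ v ^ r * (q * ((Real.exp (6 * S.halfLength / n) ^ r + (2 * n * (n + 1)) ^ 2 *
        Real.exp (- (Real.log 2 * (n / (2 * S.halfLength)))) * 2 ^ r) * dyckProb (2 * n) ^ 2)) :=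
        mul_le_mul_of_nonneg_left (mul_le_mul_of_nonneg_left key hQ) (pow_nonneg hv _)
    _ = _ := by rw [mul_pow, mul_pow]; ring

end Shape

/-! ### Sums of a stationary `L`-dependent sequence -/

/-- `ξ` is a stationary `L`-dependent sequence with values in `[0, 1]`, with mean `d` and
correlations `p`. -/
structure IsDependentSequence {Ω : Type*} [MeasurableSpace Ω] (P : Measure Ω) (ξ : ℕ → Ω → ℝ)
    (L : ℕ) (d : ℝ) (p : ℕ → ℝ) : Prop where
  pos : 0 < L
  measurable : ∀ t, Measurable (ξ t)
  mem_Icc : ∀ t ω, ξ t ω ∈ Set.Icc (0 : ℝ) 1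
  indep : ∀ T : ℕ → Finset ℕ, (∀ i j, i ≠ j → ∀ s ∈ T i, ∀ t ∈ T j, s + L ≤ t ∨ t + L ≤ s) →
    iIndepFun (fun i ω => ∑ t ∈ T i, ξ t ω) P
  ident : ∀ s M, IdentDistrib (fun ω => ∑ i ∈ Finset.range M, ξ (s + i) ω)
    (fun ω => ∑ i ∈ Finset.range M, ξ i ω) P P
  mean : ∀ t, ∫ ω, ξ t ω ∂P = d
  corr : ∀ t r, ∫ ω, ξ t ω * ξ (t + r) ω ∂P = p r
  corr_of_le : ∀ r, L ≤ r → p r = d ^ 2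

namespace IsDependentSequence

variable {Ω : Type*} [MeasurableSpace Ω] {P : Measure Ω} {ξ : ℕ → Ω → ℝ} {L : ℕ} {d : ℝ}
  {p : ℕ → ℝ}

/-- The centered partial sums. -/
noncomputable def centeredSum (ξ : ℕ → Ω → ℝ) (d : ℝ) (M : ℕ) (ω : Ω) : ℝ :=
  ∑ t ∈ Finset.range M, (ξ t ω - d)

theorem measurable_centeredSum (h : IsDependentSequence P ξ L d p) (M : ℕ) :
    Measurable (centeredSum ξ d M) :=
  Finset.measurable_fun_sum _ fun t _ => (h.measurable t).sub_const d

variable [IsProbabilityMeasure P]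

theorem integrable (h : IsDependentSequence P ξ L d p) (t : ℕ) : Integrable (ξ t) P :=
  Integrable.of_mem_Icc 0 1 (h.measurable t).aemeasurable (Eventually.of_forall (h.mem_Icc t))

theorem integrable_mul (h : IsDependentSequence P ξ L d p) (s t : ℕ) :
    Integrable (fun ω => ξ s ω * ξ t ω) P := by
  refine Integrable.of_mem_Icc 0 1 ((h.measurable s).mul (h.measurable t)).aemeasurable
    (Eventually.of_forall fun ω => ?_)
  have h1 := h.mem_Icc s ω
  have h2 := h.mem_Icc t ω
  exact ⟨mul_nonneg h1.1 h2.1, mul_le_one₀ h1.2 h2.1 h2.2⟩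

theorem mean_mem (h : IsDependentSequence P ξ L d p) : d ∈ Set.Icc (0 : ℝ) 1 := by
  rw [← h.mean 0]
  refine ⟨integral_nonneg fun ω => (h.mem_Icc 0 ω).1, ?_⟩
  have := integral_mono (h.integrable 0) (integrable_const (1 : ℝ)) fun ω => (h.mem_Icc 0 ω).2
  simpa using this

theorem abs_centeredSum_le (h : IsDependentSequence P ξ L d p) (M : ℕ) (ω : Ω) :
    |centeredSum ξ d M ω| ≤ M := by
  refine (Finset.abs_sum_le_sum_abs _ _).trans ?_
  have : ∀ t ∈ Finset.range M, |ξ t ω - d| ≤ 1 := by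
    intro t _
    have h1 := h.mem_Icc t ω
    have h2 := h.mean_mem
    rw [abs_le]
    constructor <;> linarith [h1.1, h1.2, h2.1, h2.2]
  simpa using Finset.sum_le_card_nsmul _ _ _ this

theorem integrable_comp_centeredSum (h : IsDependentSequence P ξ L d p) (M : ℕ) {f : ℝ → ℝ}
    (hf : Continuous f) : Integrable (fun ω => f (centeredSum ξ d M ω)) P := by
  obtain ⟨C, hC⟩ := (isCompact_Icc (a := -(M : ℝ)) (b := M)).exists_bound_of_continuousOn
    hf.continuousOn
  refine Integrable.of_bound (hf.measurable.comp
    (h.measurable_centeredSum M)).aestronglyMeasurable C (Eventually.of_forall fun ω => ?_)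
  exact hC _ (abs_le.1 (h.abs_centeredSum_le M ω))

/-- Terms in one residue class modulo `L` are at mutual distance at least `L`, hence independent.
Hoeffding's lemma on `[0, 1]` gives the variance proxy `(1 / 2) ^ 2` for each. -/
theorem subgaussian_class (h : IsDependentSequence P ξ L d p) (c : ℕ) (s : Finset ℕ) :
    HasSubgaussianMGF (fun ω => ∑ j ∈ s, (ξ (c + j * L) ω - d)) (∑ _j ∈ s, (1 / 2) ^ 2) P := by
  have hi : iIndepFun (fun j ω => ξ (c + j * L) ω - d) P := by
    have h1 := h.indep (fun j => {c + j * L}) (by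
      intro i j hij s hs t ht
      rw [Finset.mem_singleton] at hs ht
      subst hs ht
      rcases lt_or_gt_of_ne hij with hlt | hlt
      · left
        have := Nat.mul_le_mul_right L (Nat.succ_le_of_lt hlt)
        rw [Nat.succ_mul] at this
        omega
      · right
        have := Nat.mul_le_mul_right L (Nat.succ_le_of_lt hlt)
        rw [Nat.succ_mul] at this
        omega)
    have h2 := h1.comp (fun _ x => x - d) fun _ => measurable_id.sub_const d
    simpa [Function.comp_def] using h2
  refine HasSubgaussianMGF.sum_of_iIndepFun hi (c := fun _ => (1 / 2) ^ 2) fun j _ => ?_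
  have h3 := hasSubgaussianMGF_of_mem_Icc (μ := P) (h.measurable (c + j * L)).aemeasurable
    (Eventually.of_forall (h.mem_Icc (c + j * L)))
  rw [h.mean] at h3
  simpa using h3

theorem sum_range_eq_sum_classes {L : ℕ} (hL : 0 < L) (M : ℕ) (f : ℕ → ℝ) :
    ∑ t ∈ Finset.range M, f t = ∑ c ∈ Finset.range L,
      ∑ j ∈ Finset.range M with c + j * L < M, f (c + j * L) := by
  rw [← Finset.sum_fiberwise_of_maps_to (g := fun t => t % L) (t := Finset.range L)
    fun t _ => Finset.mem_range.2 (Nat.mod_lt t hL)]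
  refine Finset.sum_congr rfl fun c hc => ?_
  rw [Finset.mem_range] at hc
  refine Finset.sum_nbij' (fun t => t / L) (fun j => c + j * L) ?_ ?_ ?_ ?_ ?_
  · intro t ht
    simp only [Finset.mem_filter, Finset.mem_range] at ht ⊢
    have h1 := Nat.mod_add_div' t L
    have h2 := Nat.div_le_self t L
    rw [ht.2] at h1
    exact ⟨by omega, by omega⟩
  · intro j hj
    simp only [Finset.mem_filter, Finset.mem_range] at hj ⊢
    exact ⟨hj.2, by rw [Nat.add_mul_mod_self_right, Nat.mod_eq_of_lt hc]⟩
  · intro t ht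
    simp only [Finset.mem_filter] at ht
    have h1 := Nat.mod_add_div' t L
    rw [ht.2] at h1
    exact h1
  · intro j _
    rw [Nat.add_mul_div_right _ _ hL, Nat.div_eq_of_lt hc, zero_add]
  · intro t ht
    simp only [Finset.mem_filter] at ht
    have h1 := Nat.mod_add_div' t L
    rw [ht.2] at h1
    rw [h1]

/-- The sum is split into `L` residue classes, recombined by convexity of `exp` as an average of
`exp (L * t * Y c)`. The constant is crude; what matters is that the exponent is linear in `M`. -/
theorem integral_exp_centeredSum_le (h : IsDependentSequence P ξ L d p) (M : ℕ) (t : ℝ) :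
    ∫ ω, Real.exp (t * centeredSum ξ d M ω) ∂P ≤ Real.exp (t ^ 2 * (L ^ 2 * M)) := by
  set Y : ℕ → Ω → ℝ := fun c ω =>
    ∑ j ∈ Finset.range M with c + j * L < M, (ξ (c + j * L) ω - d) with hY
  have hsub : ∀ c, HasSubgaussianMGF (Y c)
      (∑ _j ∈ (Finset.range M).filter (fun j => c + j * L < M), (1 / 2) ^ 2) P := fun c =>
    h.subgaussian_class c _
  have hL : (0 : ℝ) < L := by exact_mod_cast h.pos
  have hYi : ∀ c, Integrable (fun ω => Real.exp (L * t * Y c ω)) P := fun c =>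
    (hsub c).integrable_exp_mul _
  have hpt : ∀ ω, Real.exp (t * centeredSum ξ d M ω) ≤
      ∑ c ∈ Finset.range L, (1 / L : ℝ) * Real.exp (L * t * Y c ω) := by
    intro ω
    have h1 : t * centeredSum ξ d M ω = ∑ c ∈ Finset.range L, (1 / L : ℝ) • (L * t * Y c ω) := by
      rw [centeredSum, sum_range_eq_sum_classes h.pos, Finset.mul_sum]
      refine Finset.sum_congr rfl fun c _ => ?_
      rw [hY, smul_eq_mul]
      field_simp
    rw [h1]
    have := convexOn_exp.map_sum_le (t := Finset.range L) (w := fun _ => (1 / L : ℝ))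
      (p := fun c => L * t * Y c ω) (fun _ _ => by positivity) (by simp [hL.ne'])
      (fun _ _ => Set.mem_univ _)
    simpa only [smul_eq_mul] using this
  have hle : ∀ c, ∫ ω, Real.exp (L * t * Y c ω) ∂P ≤ Real.exp (t ^ 2 * (L ^ 2 * M)) := by
    intro c
    refine ((hsub c).mgf_le (L * t)).trans (Real.exp_le_exp.2 ?_)
    have hcard : (((Finset.range M).filter (fun j => c + j * L < M)).card : ℝ) ≤ M := by
      exact_mod_cast (Finset.card_filter_le _ _).trans (Finset.card_range M).le
    simp only [Finset.sum_const, nsmul_eq_mul]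
    push_cast
    have h1 : 0 ≤ ((L : ℝ) * t) ^ 2 := sq_nonneg _
    have h2 : (((Finset.range M).filter (fun j => c + j * L < M)).card : ℝ) * ((L : ℝ) * t) ^ 2
      ≤ M * ((L : ℝ) * t) ^ 2 := mul_le_mul_of_nonneg_right hcard h1
    have h3 : 0 ≤ (M : ℝ) * ((L : ℝ) * t) ^ 2 := by positivity
    have h4 : t ^ 2 * ((L : ℝ) ^ 2 * M) = M * ((L : ℝ) * t) ^ 2 := by ring
    rw [h4]
    norm_num
    linarith
  calc ∫ ω, Real.exp (t * centeredSum ξ d M ω) ∂P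
      ≤ ∫ ω, ∑ c ∈ Finset.range L, (1 / L : ℝ) * Real.exp (L * t * Y c ω) ∂P :=
        integral_mono (h.integrable_comp_centeredSum M (f := fun y => Real.exp (t * y))
          (by fun_prop)) (integrable_finsetSum _ fun c _ => (hYi c).const_mul _) hpt
    _ = ∑ c ∈ Finset.range L, (1 / L : ℝ) * ∫ ω, Real.exp (L * t * Y c ω) ∂P := by
        rw [integral_finsetSum _ fun c _ => (hYi c).const_mul _]
        simp only [integral_const_mul]
    _ ≤ ∑ _c ∈ Finset.range L, (1 / L : ℝ) * Real.exp (t ^ 2 * (L ^ 2 * M)) :=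
        Finset.sum_le_sum fun c _ => mul_le_mul_of_nonneg_left (hle c) (by positivity)
    _ = Real.exp (t ^ 2 * (L ^ 2 * M)) := by
        rw [Finset.sum_const, Finset.card_range, nsmul_eq_mul]
        field_simp

theorem abs_exp_sub_taylor_le (x : ℝ) :
    |Real.exp x - 1 - x - x ^ 2 / 2| ≤ |x| ^ 3 * Real.exp |x| := by
  have h := Complex.norm_exp_sub_sum_le_norm_mul_exp (x : ℂ) 3
  simp only [Finset.sum_range_succ, Finset.sum_range_zero, Complex.norm_real, Real.norm_eq_abs] at h
  have e : Complex.exp x - (0 + (x : ℂ) ^ 0 / (Nat.factorial 0 : ℕ) + (x : ℂ) ^ 1 /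
      (Nat.factorial 1 : ℕ) + (x : ℂ) ^ 2 / (Nat.factorial 2 : ℕ)) =
      ((Real.exp x - 1 - x - x ^ 2 / 2 : ℝ) : ℂ) := by
    push_cast [Nat.factorial]
    ring
  rw [e, Complex.norm_real, Real.norm_eq_abs] at h
  exact h

theorem integral_centeredSum (h : IsDependentSequence P ξ L d p) (M : ℕ) :
    ∫ ω, centeredSum ξ d M ω ∂P = 0 := by
  have hi : ∀ t, Integrable (fun ω => ξ t ω - d) P := fun t =>
    (h.integrable t).sub (integrable_const d)
  unfold centeredSum
  rw [integral_finsetSum _ fun t _ => hi t]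
  refine Finset.sum_eq_zero fun t _ => ?_
  rw [integral_sub (h.integrable t) (integrable_const d), h.mean]
  simp

/-- Second order expansion of the Laplace transform of a centered partial sum. -/
theorem abs_integral_exp_sub_le (h : IsDependentSequence P ξ L d p) {M : ℕ} (hM : 0 < M) {t : ℝ}
    (ht : 0 ≤ t) (htM : t * √M ≤ 1) :
    |∫ ω, Real.exp (t * centeredSum ξ d M ω) ∂P - 1
      - t ^ 2 / 2 * ∫ ω, centeredSum ξ d M ω ^ 2 ∂P| ≤
      12 * Real.exp (4 * L ^ 2) * (t * √M) ^ 3 := by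
  have hM' : (0 : ℝ) < √M := Real.sqrt_pos.2 (by exact_mod_cast hM)
  -- The natural scale, with `a ^ 2 * M = 1`. The Taylor remainder is `(t√M) ^ 3` times a function
  -- of `|a * Y|` bounded by `6 * exp (2 |a * Y|)`, whose expectation is bounded uniformly in `M` by
  -- the subgaussian estimate at `2a` and `-2a`.
  set a : ℝ := 1 / √M with ha
  have ha0 : 0 < a := by positivity
  have hta : t ≤ a := by rw [ha, le_div_iff₀ hM']; exact htM
  have haM : a ^ 2 * M = 1 := by
    rw [ha, div_pow, Real.sq_sqrt (by positivity)]
    have : (0 : ℝ) < M := by exact_mod_cast hM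
    field_simp
  set Y := centeredSum ξ d M
  have hint : ∀ {f : ℝ → ℝ}, Continuous f → Integrable (fun ω => f (Y ω)) P := fun hf =>
    h.integrable_comp_centeredSum M hf
  have e1 : ∫ ω, Real.exp (t * Y ω) ∂P - 1 - t ^ 2 / 2 * ∫ ω, Y ω ^ 2 ∂P =
      ∫ ω, (Real.exp (t * Y ω) - 1 - t * Y ω - (t * Y ω) ^ 2 / 2) ∂P := by
    rw [integral_sub (hint (f := fun y => Real.exp (t * y) - 1 - t * y) (by fun_prop))
        (hint (f := fun y => (t * y) ^ 2 / 2) (by fun_prop)),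
      integral_sub (hint (f := fun y => Real.exp (t * y) - 1) (by fun_prop))
        (hint (f := fun y => t * y) (by fun_prop)),
      integral_sub (hint (f := fun y => Real.exp (t * y)) (by fun_prop)) (integrable_const 1),
      integral_const_mul, h.integral_centeredSum M, ← integral_const_mul]
    simp only [integral_const, probReal_univ, smul_eq_mul, mul_one, mul_zero, sub_zero]
    congr 2
    funext ω
    ring
  have hpt : ∀ ω, |Real.exp (t * Y ω) - 1 - t * Y ω - (t * Y ω) ^ 2 / 2| ≤
      6 * (t * √M) ^ 3 * (Real.exp (2 * a * Y ω) + Real.exp (-(2 * a) * Y ω)) := by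
    intro ω
    refine (abs_exp_sub_taylor_le _).trans ?_
    set y := |a * Y ω| with hy
    have hy0 : 0 ≤ y := abs_nonneg _
    have h1 : |t * Y ω| = (t * √M) * y := by
      rw [hy, abs_mul, abs_mul, abs_of_nonneg ht, abs_of_pos ha0, ha]
      field_simp
    have h2 : y ^ 3 ≤ 6 * Real.exp y := by
      have := Real.pow_div_factorial_le_exp y hy0 3
      norm_num [Nat.factorial] at this
      linarith
    have h3 : Real.exp |t * Y ω| ≤ Real.exp y := by
      rw [h1]
      exact Real.exp_le_exp.2 (mul_le_of_le_one_left hy0 htM)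
    have h4 : Real.exp y * Real.exp y ≤ Real.exp (2 * a * Y ω) + Real.exp (-(2 * a) * Y ω) := by
      rw [← Real.exp_add]
      rcases le_total 0 (a * Y ω) with h0 | h0
      · rw [hy, abs_of_nonneg h0]
        have e : a * Y ω + a * Y ω = 2 * a * Y ω := by ring
        rw [e]
        exact le_add_of_nonneg_right (Real.exp_pos _).le
      · rw [hy, abs_of_nonpos h0]
        have e : -(a * Y ω) + -(a * Y ω) = -(2 * a) * Y ω := by ring
        rw [e]
        exact le_add_of_nonneg_left (Real.exp_pos _).le
    have h5 : 0 ≤ (t * √M) ^ 3 := by positivity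
    calc |t * Y ω| ^ 3 * Real.exp |t * Y ω| ≤ ((t * √M) ^ 3 * (6 * Real.exp y)) * Real.exp y := by
          refine mul_le_mul ?_ h3 (Real.exp_pos _).le (by positivity)
          rw [h1, mul_pow]
          exact mul_le_mul_of_nonneg_left h2 h5
      _ = 6 * (t * √M) ^ 3 * (Real.exp y * Real.exp y) := by ring
      _ ≤ _ := mul_le_mul_of_nonneg_left h4 (by positivity)
  have hsg : ∀ s : ℝ, s ^ 2 = (2 * a) ^ 2 →
      ∫ ω, Real.exp (s * Y ω) ∂P ≤ Real.exp (4 * L ^ 2) := by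
    intro s hs
    refine (h.integral_exp_centeredSum_le M s).trans (Real.exp_le_exp.2 ?_)
    rw [hs]
    have : (2 * a) ^ 2 * ((L : ℝ) ^ 2 * M) = 4 * L ^ 2 * (a ^ 2 * M) := by ring
    rw [this, haM, mul_one]
  rw [e1]
  refine (abs_integral_le_integral_abs).trans ?_
  calc ∫ ω, |Real.exp (t * Y ω) - 1 - t * Y ω - (t * Y ω) ^ 2 / 2| ∂P
      ≤ ∫ ω, 6 * (t * √M) ^ 3 * (Real.exp (2 * a * Y ω) + Real.exp (-(2 * a) * Y ω)) ∂P :=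
        integral_mono (hint (f := fun y => |Real.exp (t * y) - 1 - t * y - (t * y) ^ 2 / 2|)
          (by fun_prop)) (hint (f := fun y => 6 * (t * √M) ^ 3 *
            (Real.exp (2 * a * y) + Real.exp (-(2 * a) * y))) (by fun_prop)) hpt
    _ = 6 * (t * √M) ^ 3 * (∫ ω, Real.exp (2 * a * Y ω) ∂P +
          ∫ ω, Real.exp (-(2 * a) * Y ω) ∂P) := by
        rw [integral_const_mul, integral_add
          (hint (f := fun y => Real.exp (2 * a * y)) (by fun_prop))
          (hint (f := fun y => Real.exp (-(2 * a) * y)) (by fun_prop))]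
    _ ≤ 6 * (t * √M) ^ 3 * (Real.exp (4 * L ^ 2) + Real.exp (4 * L ^ 2)) :=
        mul_le_mul_of_nonneg_left (add_le_add (hsg _ rfl) (hsg _ (by ring))) (by positivity)
    _ = _ := by ring

/-- The asymptotic variance. -/
noncomputable def asympVar (L : ℕ) (d : ℝ) (p : ℕ → ℝ) : ℝ :=
  (p 0 - d ^ 2) + 2 * ∑ r ∈ Finset.Ioo 0 L, (p r - d ^ 2)

theorem integral_centered_mul (h : IsDependentSequence P ξ L d p) (t r : ℕ) :
    ∫ ω, (ξ t ω - d) * (ξ (t + r) ω - d) ∂P = p r - d ^ 2 := by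
  have e : ∀ ω, (ξ t ω - d) * (ξ (t + r) ω - d) =
      ξ t ω * ξ (t + r) ω - d * ξ t ω - d * ξ (t + r) ω + d ^ 2 := fun ω => by ring
  simp only [e]
  have i1 := h.integrable_mul t (t + r)
  have i2 := (h.integrable t).const_mul d
  have i3 := (h.integrable (t + r)).const_mul d
  have i4 : Integrable (fun ω => ξ t ω * ξ (t + r) ω - d * ξ t ω) P := i1.sub i2
  have i5 : Integrable (fun ω => ξ t ω * ξ (t + r) ω - d * ξ t ω - d * ξ (t + r) ω) P := i4.sub i3
  rw [integral_add i5 (integrable_const _), integral_sub i4 i3, integral_sub i1 i2, h.corr,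
    integral_const_mul, integral_const_mul, h.mean, h.mean]
  simp only [integral_const, probReal_univ, smul_eq_mul]
  ring

/-- The new term adds its variance and twice its covariances with earlier terms. Only those at
distance less than `L` survive, and `L ≤ M` ensures that all of them are present. -/
theorem variance_succ (h : IsDependentSequence P ξ L d p) {M : ℕ} (hM : L ≤ M) :
    ∫ ω, centeredSum ξ d (M + 1) ω ^ 2 ∂P
      = ∫ ω, centeredSum ξ d M ω ^ 2 ∂P + asympVar L d p := by
  have hc : ∀ s t, Integrable (fun ω => (ξ s ω - d) * (ξ t ω - d)) P := by
    intro s t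
    have e : ∀ ω, (ξ s ω - d) * (ξ t ω - d) =
      ξ s ω * ξ t ω - d * ξ s ω - d * ξ t ω + d ^ 2 := fun ω => by ring
    simp only [e]
    exact (((h.integrable_mul s t).sub ((h.integrable s).const_mul d)).sub
      ((h.integrable t).const_mul d)).add (integrable_const _)
  have e : ∀ ω, centeredSum ξ d (M + 1) ω ^ 2 = centeredSum ξ d M ω ^ 2 +
      (2 * ∑ t ∈ Finset.range M, (ξ t ω - d) * (ξ M ω - d) + (ξ M ω - d) * (ξ M ω - d)) := by
    intro ω
    have : centeredSum ξ d (M + 1) ω = centeredSum ξ d M ω + (ξ M ω - d) := Finset.sum_range_succ _ _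
    rw [this, ← Finset.sum_mul]
    unfold centeredSum
    ring
  simp only [e]
  have hs : Integrable (fun ω => 2 * ∑ t ∈ Finset.range M, (ξ t ω - d) * (ξ M ω - d)) P :=
    (integrable_finsetSum _ fun t _ => hc t M).const_mul _
  have hs' : Integrable (fun ω => 2 * ∑ t ∈ Finset.range M, (ξ t ω - d) * (ξ M ω - d) +
      (ξ M ω - d) * (ξ M ω - d)) P := hs.add (hc M M)
  rw [integral_add (h.integrable_comp_centeredSum M (f := fun y => y ^ 2) (by fun_prop))
      hs', integral_add hs (hc M M), integral_const_mul,
    integral_finsetSum _ fun t _ => hc t M]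
  congr 1
  have h0 : ∫ ω, (ξ M ω - d) * (ξ M ω - d) ∂P = p 0 - d ^ 2 := h.integral_centered_mul M 0
  have h1 : ∑ t ∈ Finset.range M, ∫ ω, (ξ t ω - d) * (ξ M ω - d) ∂P
      = ∑ r ∈ Finset.Ioo 0 L, (p r - d ^ 2) := by
    have h2 : ∀ t ∈ Finset.range M, ∫ ω, (ξ t ω - d) * (ξ M ω - d) ∂P
        = p (M - 1 - t + 1) - d ^ 2 := by
      intro t ht
      rw [Finset.mem_range] at ht
      have := h.integral_centered_mul t (M - t)
      rw [Nat.add_sub_of_le ht.le] at this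
      rw [this, show M - 1 - t + 1 = M - t by omega]
    rw [Finset.sum_congr rfl h2, Finset.sum_range_reflect (fun r => p (r + 1) - d ^ 2) M]
    have h3 : Finset.Ioo 0 L = (Finset.range (L - 1)).image (· + 1) := by
      ext r
      simp only [Finset.mem_Ioo, Finset.mem_image, Finset.mem_range]
      constructor
      · intro hr; exact ⟨r - 1, by omega, by omega⟩
      · rintro ⟨q, hq, rfl⟩; omega
    rw [h3, Finset.sum_image (by intro a _ b _ hab; simpa using hab)]
    refine (Finset.sum_subset (Finset.range_mono (by omega)) fun r _ hr => ?_).symm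
    rw [Finset.mem_range] at hr
    rw [h.corr_of_le (r + 1) (by omega), sub_self]
  rw [h0, h1, asympVar]
  ring

theorem tendsto_variance_div (h : IsDependentSequence P ξ L d p) :
    Tendsto (fun M : ℕ => (∫ ω, centeredSum ξ d M ω ^ 2 ∂P) / M) atTop (𝓝 (asympVar L d p)) := by
  set v := ∫ ω, centeredSum ξ d L ω ^ 2 ∂P with hv
  have key : ∀ M, L ≤ M →
      ∫ ω, centeredSum ξ d M ω ^ 2 ∂P = v + (M - L) * asympVar L d p := by
    intro M hM
    induction M, hM using Nat.le_induction with
    | base => simp [hv]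
    | succ M hM ih =>
      rw [h.variance_succ hM, ih]
      push_cast
      ring
  have h1 : Tendsto (fun M : ℕ => (v - L * asympVar L d p) / (M : ℝ) + asympVar L d p) atTop
      (𝓝 (0 + asympVar L d p)) :=
    (tendsto_const_div_atTop_nhds_zero_nat _).add tendsto_const_nhds
  rw [zero_add] at h1
  refine h1.congr' ?_
  filter_upwards [eventually_ge_atTop L, eventually_gt_atTop 0] with M hM hM0
  rw [key M hM]
  have : (0 : ℝ) < M := by exact_mod_cast hM0
  field_simp
  ring

end IsDependentSequence

/-! ### Independent blocks and the central limit theorem in Laplace form -/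

theorem tendsto_one_add_pow_exp {k : ℕ → ℕ} {x : ℕ → ℝ} {c : ℝ} (hk : Tendsto k atTop atTop)
    (h : Tendsto (fun n => k n * x n) atTop (𝓝 c)) :
    Tendsto (fun n => (1 + x n) ^ k n) atTop (𝓝 (Real.exp c)) := by
  have hk' : Tendsto (fun n => (k n : ℝ)) atTop atTop := tendsto_natCast_atTop_atTop.comp hk
  have hx : Tendsto x atTop (𝓝 0) := by
    refine (h.div_atTop hk').congr' ?_
    filter_upwards [hk.eventually_gt_atTop 0] with n hn
    have : (k n : ℝ) ≠ 0 := by exact_mod_cast hn.ne'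
    field_simp
  have hx1 : Tendsto (fun n => 1 + x n) atTop (𝓝 1) := by simpa using hx.const_add 1
  have hpos : ∀ᶠ n in atTop, 0 < 1 + x n := hx1.eventually (lt_mem_nhds one_pos)
  have hlog : Tendsto (fun n => k n * Real.log (1 + x n)) atTop (𝓝 c) := by
    have hl : Tendsto (fun n => k n * x n * (1 + x n)⁻¹) atTop (𝓝 c) := by
      simpa using h.mul (hx1.inv₀ one_ne_zero)
    -- Squeeze by `1 - 1 / y ≤ log y ≤ y - 1` at `y = 1 + x n`.
    refine tendsto_of_tendsto_of_tendsto_of_le_of_le' hl h ?_ ?_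
    · filter_upwards [hpos] with n hn
      rw [mul_assoc]
      refine mul_le_mul_of_nonneg_left ?_ (Nat.cast_nonneg _)
      refine le_trans (le_of_eq ?_) (Real.one_sub_inv_le_log_of_pos hn)
      field_simp
      ring
    · filter_upwards [hpos] with n hn
      refine mul_le_mul_of_nonneg_left ?_ (Nat.cast_nonneg _)
      have := Real.log_le_sub_one_of_pos hn
      linarith
  refine ((Real.continuous_exp.tendsto c).comp hlog).congr' ?_
  filter_upwards [hpos] with n hn
  rw [Function.comp_apply, mul_comm, Real.exp_mul, Real.exp_log hn, Real.rpow_natCast]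

namespace IsDependentSequence

variable {Ω : Type*} [MeasurableSpace Ω] {P : Measure Ω} {ξ : ℕ → Ω → ℝ} {L : ℕ} {d : ℝ}
  {p : ℕ → ℝ}

/-- Blocks of length `M` separated by gaps of length `L` are independent, and by stationarity they
have the same law. -/
theorem integral_exp_blocks (h : IsDependentSequence P ξ L d p) (k M : ℕ) (t : ℝ) :
    ∫ ω, Real.exp (t * ∑ j ∈ Finset.range k, ∑ i ∈ Finset.range M, (ξ (j * (M + L) + i) ω - d)) ∂P
      = (∫ ω, Real.exp (t * centeredSum ξ d M ω) ∂P) ^ k := by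
  have hinj : ∀ j : ℕ, Function.Injective fun i => j * (M + L) + i := fun j a b hab => by
    simpa using hab
  set X : ℕ → Ω → ℝ := fun j ω => ∑ i ∈ Finset.range M, (ξ (j * (M + L) + i) ω - d) with hX
  have hind : iIndepFun X P := by
    have h1 := h.indep (fun j => (Finset.range M).image fun i => j * (M + L) + i) (by
      have key : ∀ i j a b : ℕ, i < j → a < M → i * (M + L) + a + L ≤ j * (M + L) + b := by
        intro i j a b hij ha
        have := Nat.mul_le_mul_right (M + L) (Nat.succ_le_of_lt hij)
        rw [Nat.succ_mul] at this
        omega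
      intro i j hij s hs t ht
      simp only [Finset.mem_image, Finset.mem_range] at hs ht
      obtain ⟨a, ha, rfl⟩ := hs
      obtain ⟨b, hb, rfl⟩ := ht
      rcases lt_or_gt_of_ne hij with hlt | hlt
      · exact Or.inl (key _ _ _ _ hlt ha)
      · exact Or.inr (key _ _ _ _ hlt hb))
    have h2 := h1.comp (fun _ x => x - M * d) fun _ => measurable_id.sub_const _
    refine h2.congr fun j => Eventually.of_forall fun ω => ?_
    simp only [Function.comp_apply, hX, Finset.sum_sub_distrib, Finset.sum_const,
      Finset.card_range, nsmul_eq_mul]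
    rw [Finset.sum_image fun a _ b _ hab => hinj j hab]
  have hmeas : ∀ j, Measurable (X j) := fun j =>
    Finset.measurable_fun_sum _ fun i _ => (h.measurable _).sub_const d
  have hmgf := hind.mgf_sum (t := t) hmeas (Finset.range k)
  have hid : ∀ j, mgf (X j) P t = ∫ ω, Real.exp (t * centeredSum ξ d M ω) ∂P := by
    intro j
    have h3 := (h.ident (j * (M + L)) M).comp (u := fun x => x - M * d)
      (measurable_id.sub_const _)
    have h4 := congrFun (mgf_congr_identDistrib h3) t
    have e1 : X j = (fun x => x - M * d) ∘
        (fun ω => ∑ i ∈ Finset.range M, ξ (j * (M + L) + i) ω) := by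
      funext ω
      simp [hX, Finset.sum_sub_distrib]
    have e2 : centeredSum ξ d M = (fun x => x - M * d) ∘
        (fun ω => ∑ i ∈ Finset.range M, ξ i ω) := by
      funext ω
      simp [centeredSum, Finset.sum_sub_distrib]
    rw [e1, h4, e2]
    rfl
  rw [Finset.prod_congr rfl fun j _ => hid j, Finset.prod_const, Finset.card_range] at hmgf
  rw [← hmgf, mgf]
  simp only [Finset.sum_apply, hX]

variable [IsProbabilityMeasure P]

/-- Exactly `N - k * M` terms lie outside the blocks, each at most `1` in absolute value. The bound
is deterministic, so it can be exponentiated. -/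
theorem abs_centeredSum_sub_blocks_le (h : IsDependentSequence P ξ L d p) {k M N : ℕ}
    (hN : k * (M + L) ≤ N) (ω : Ω) :
    |centeredSum ξ d N ω - ∑ j ∈ Finset.range k, ∑ i ∈ Finset.range M,
      (ξ (j * (M + L) + i) ω - d)| ≤ N - k * M := by
  set T : Finset ℕ := (Finset.range k ×ˢ Finset.range M).image fun x => x.1 * (M + L) + x.2 with hT
  have hinj : Set.InjOn (fun x : ℕ × ℕ => x.1 * (M + L) + x.2)
      (Finset.range k ×ˢ Finset.range M : Finset (ℕ × ℕ)) := by
    intro x hx y hy hxy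
    simp only [Finset.coe_product, Finset.coe_range, Set.mem_prod, Set.mem_Iio] at hx hy hxy
    have hpos : 0 < M + L := by omega
    have h1 : x.1 = y.1 := by
      have := congrArg (· / (M + L)) hxy
      simpa only [mul_comm _ (M + L), Nat.mul_add_div hpos,
        Nat.div_eq_of_lt (show x.2 < M + L by omega), Nat.div_eq_of_lt (show y.2 < M + L by omega),
        add_zero] using this
    rw [h1] at hxy
    exact Prod.ext h1 (by omega)
  have hsub : T ⊆ Finset.range N := by
    intro s hs
    simp only [hT, Finset.mem_image, Finset.mem_product, Finset.mem_range] at hs ⊢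
    obtain ⟨x, ⟨h1, h2⟩, rfl⟩ := hs
    have := Nat.mul_le_mul_right (M + L) (Nat.succ_le_of_lt h1)
    rw [Nat.succ_mul] at this
    omega
  have hsum : ∑ j ∈ Finset.range k, ∑ i ∈ Finset.range M, (ξ (j * (M + L) + i) ω - d)
      = ∑ s ∈ T, (ξ s ω - d) := by
    rw [hT, Finset.sum_image hinj, Finset.sum_product]
  have hcard : T.card = k * M := by
    rw [hT, Finset.card_image_of_injOn hinj, Finset.card_product, Finset.card_range,
      Finset.card_range]
  rw [hsum, centeredSum, ← Finset.sum_sdiff hsub, add_sub_cancel_right]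
  refine (Finset.abs_sum_le_sum_abs _ _).trans ?_
  have h1 : ∀ s ∈ Finset.range N \ T, |ξ s ω - d| ≤ 1 := by
    intro s _
    have h1 := h.mem_Icc s ω
    have h2 := h.mean_mem
    rw [abs_le]
    constructor <;> linarith [h1.1, h1.2, h2.1, h2.2]
  refine (Finset.sum_le_card_nsmul _ _ _ h1).trans (le_of_eq ?_)
  rw [nsmul_eq_mul, mul_one, Finset.card_sdiff_of_subset hsub, Nat.cast_sub (Finset.card_le_card hsub),
    hcard, Finset.card_range]
  push_cast
  rfl

/-- Since `t ^ 2 * k * M` converges and `k → ∞`, one has `t√M → 0`. The cubic error summed over `k`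
blocks is of order `(t ^ 2 * k * M) * t√M → 0`, and the quadratic term converges by the asymptotics
of the variance. -/
theorem tendsto_integral_exp_pow (h : IsDependentSequence P ξ L d p) {k M : ℕ → ℕ} {t : ℕ → ℝ}
    {v : ℝ} (hk : Tendsto k atTop atTop) (hM : Tendsto M atTop atTop) (ht : ∀ n, 0 ≤ t n)
    (hv : Tendsto (fun n => t n ^ 2 * (k n * M n)) atTop (𝓝 v)) :
    Tendsto (fun n => (∫ ω, Real.exp (t n * centeredSum ξ d (M n) ω) ∂P) ^ k n) atTop
      (𝓝 (Real.exp (v / 2 * asympVar L d p))) := by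
  have hk' : Tendsto (fun n => (k n : ℝ)) atTop atTop := tendsto_natCast_atTop_atTop.comp hk
  have h2 : Tendsto (fun n => (t n * √(M n)) ^ 2) atTop (𝓝 0) := by
    refine (hv.div_atTop hk').congr' ?_
    filter_upwards [hk.eventually_gt_atTop 0] with n hn
    have : (k n : ℝ) ≠ 0 := by exact_mod_cast hn.ne'
    rw [mul_pow, Real.sq_sqrt (Nat.cast_nonneg _)]
    field_simp
  have h1 : Tendsto (fun n => t n * √(M n)) atTop (𝓝 0) := by
    have := (Real.continuous_sqrt.tendsto 0).comp h2
    rw [Real.sqrt_zero] at this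
    refine this.congr fun n => ?_
    rw [Function.comp_apply, Real.sqrt_sq (mul_nonneg (ht n) (Real.sqrt_nonneg _))]
  set φ : ℕ → ℝ := fun n => ∫ ω, Real.exp (t n * centeredSum ξ d (M n) ω) ∂P with hφ
  set V : ℕ → ℝ := fun M => ∫ ω, centeredSum ξ d M ω ^ 2 ∂P with hV
  have hmain : Tendsto (fun n => t n ^ 2 * (k n * M n) / 2 * (V (M n) / M n)) atTop
      (𝓝 (v / 2 * asympVar L d p)) :=
    (hv.div_const 2).mul (h.tendsto_variance_div.comp hM)
  have herr : Tendsto (fun n => 12 * Real.exp (4 * L ^ 2) * ((t n ^ 2 * (k n * M n)) *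
      (t n * √(M n)))) atTop (𝓝 0) := by
    simpa using (hv.mul h1).const_mul (12 * Real.exp (4 * (L : ℝ) ^ 2))
  have hdiff : Tendsto (fun n => k n * (φ n - 1) - t n ^ 2 * (k n * M n) / 2 * (V (M n) / M n))
      atTop (𝓝 0) := by
    refine squeeze_zero_norm' ?_ herr
    filter_upwards [hM.eventually_gt_atTop 0, h1.eventually (ge_mem_nhds one_pos)] with n hn hn1
    have hb := h.abs_integral_exp_sub_le hn (ht n) hn1
    have hMn : (M n : ℝ) ≠ 0 := by exact_mod_cast hn.ne'
    have e : k n * (φ n - 1) - t n ^ 2 * (k n * M n) / 2 * (V (M n) / M n)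
        = k n * (φ n - 1 - t n ^ 2 / 2 * V (M n)) := by
      field_simp
    rw [e, Real.norm_eq_abs, abs_mul, abs_of_nonneg (Nat.cast_nonneg (k n))]
    refine (mul_le_mul_of_nonneg_left hb (Nat.cast_nonneg _)).trans (le_of_eq ?_)
    have : √(M n : ℝ) ^ 2 = M n := Real.sq_sqrt (Nat.cast_nonneg _)
    have e3 : (t n * √(M n)) ^ 3 = t n ^ 2 * √(M n) ^ 2 * (t n * √(M n)) := by ring
    rw [e3, this]
    ring
  have hsum := hdiff.add hmain
  simp only [sub_add_cancel, zero_add] at hsum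
  refine (tendsto_one_add_pow_exp hk hsum).congr fun n => ?_
  rw [hφ]
  ring

/-- Laplace transform form of the central limit theorem for stationary `L`-dependent sequences. -/
theorem tendsto_integral_exp (h : IsDependentSequence P ξ L d p) {N : ℕ → ℕ} {t : ℕ → ℝ} {v : ℝ}
    (hN : Tendsto N atTop atTop) (ht : ∀ n, 0 ≤ t n)
    (hv : Tendsto (fun n => t n ^ 2 * N n) atTop (𝓝 v)) :
    Tendsto (fun n => ∫ ω, Real.exp (t n * centeredSum ξ d (N n) ω) ∂P) atTop
      (𝓝 (Real.exp (v / 2 * asympVar L d p))) := by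
  have hsqrt : Tendsto Nat.sqrt atTop atTop :=
    tendsto_atTop.2 fun b => by
      filter_upwards [eventually_ge_atTop (b * b)] with n hn using Nat.le_sqrt.2 hn
  -- About `N ^ (1/4)` blocks: enough to tend to infinity, yet the `O(k)` discarded terms are
  -- negligible on the scale `1 / t`, of order at least `√N`.
  set k : ℕ → ℕ := fun n => Nat.sqrt (Nat.sqrt (N n)) with hkdef
  have hk : Tendsto k atTop atTop := hsqrt.comp (hsqrt.comp hN)
  have hk' : Tendsto (fun n => (k n : ℝ)) atTop atTop := tendsto_natCast_atTop_atTop.comp hk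
  have hkk : ∀ n, k n * k n ≤ Nat.sqrt (N n) := fun n => Nat.sqrt_le _
  have hk4 : ∀ n, k n * k n * (k n * k n) ≤ N n := fun n =>
    (Nat.mul_le_mul (hkk n) (hkk n)).trans (Nat.sqrt_le _)
  set M : ℕ → ℕ := fun n => N n / k n - L with hMdef
  have hMB : ∀ᶠ n in atTop, M n + L = N n / k n ∧ 0 < k n ∧ k n ≤ M n := by
    filter_upwards [hk.eventually_ge_atTop (L + 1)] with n hn
    have h1 : k n * k n ≤ N n / k n := by
      rw [Nat.le_div_iff_mul_le (by omega)]
      refine le_trans ?_ (hk4 n)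
      exact Nat.mul_le_mul_left _ (Nat.le_mul_self _)
    have h2 : k n * (L + 1) ≤ k n * k n := Nat.mul_le_mul_left _ hn
    have h3 : L ≤ k n * L := Nat.le_mul_of_pos_left _ (by omega)
    rw [mul_add, mul_one] at h2
    simp only [hMdef]
    omega
  have hM : Tendsto M atTop atTop := tendsto_atTop_mono' _ (hMB.mono fun n hn => hn.2.2) hk
  have hkB : ∀ n, k n * (N n / k n) ≤ N n := fun n => Nat.mul_div_le _ _
  -- The discarded terms are `k` gaps of length `L` and a division remainder smaller than `k`.
  have hrem : ∀ᶠ n in atTop, (0 : ℝ) ≤ N n - k n * M n ∧ (N n - k n * M n : ℝ) ≤ k n * (1 + L) := by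
    filter_upwards [hMB] with n hn
    have h1 := Nat.div_add_mod (N n) (k n)
    have h2 := Nat.mod_lt (N n) hn.2.1
    rw [← hn.1, mul_add] at h1
    have h3 : (k n : ℝ) * M n + k n * L + (N n % k n : ℕ) = N n := by exact_mod_cast h1
    have h4 : ((N n % k n : ℕ) : ℝ) ≤ k n := by exact_mod_cast h2.le
    have h5 : (0 : ℝ) ≤ (N n % k n : ℕ) := Nat.cast_nonneg _
    have h6 : (0 : ℝ) ≤ (k n : ℝ) * L := by positivity
    constructor <;> linarith
  have htk : Tendsto (fun n => t n * k n) atTop (𝓝 0) := by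
    have h1 : Tendsto (fun n => (t n * k n) ^ 2) atTop (𝓝 0) := by
      refine squeeze_zero' (Eventually.of_forall fun n => sq_nonneg _) ?_ (hv.div_atTop hk')
      filter_upwards [hk.eventually_gt_atTop 0] with n hn
      have hk0 : (0 : ℝ) < k n := by exact_mod_cast hn
      rw [mul_pow, mul_div_assoc]
      refine mul_le_mul_of_nonneg_left ?_ (sq_nonneg _)
      rw [le_div_iff₀ hk0]
      have h2 : k n ^ 2 * k n ≤ N n := by
        refine le_trans ?_ (hk4 n)
        rw [pow_two]
        exact Nat.mul_le_mul_left _ (Nat.le_mul_self _)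
      exact_mod_cast h2
    have := (Real.continuous_sqrt.tendsto 0).comp h1
    rw [Real.sqrt_zero] at this
    refine this.congr fun n => ?_
    rw [Function.comp_apply, Real.sqrt_sq (mul_nonneg (ht n) (Nat.cast_nonneg _))]
  have htrem : Tendsto (fun n => t n * (N n - k n * M n)) atTop (𝓝 0) := by
    have h1 : Tendsto (fun n => t n * k n * (1 + L)) atTop (𝓝 0) := by
      simpa using htk.mul_const (1 + (L : ℝ))
    refine squeeze_zero' ?_ ?_ h1
    · filter_upwards [hrem] with n hn using mul_nonneg (ht n) hn.1
    · filter_upwards [hrem] with n hn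
      rw [mul_assoc]
      exact mul_le_mul_of_nonneg_left hn.2 (ht n)
  have ht0 : Tendsto t atTop (𝓝 0) := by
    refine squeeze_zero' (Eventually.of_forall ht) ?_ htk
    filter_upwards [hk.eventually_gt_atTop 0] with n hn
    exact le_mul_of_one_le_right (ht n) (by exact_mod_cast hn)
  have hv' : Tendsto (fun n => t n ^ 2 * (k n * M n)) atTop (𝓝 v) := by
    have h1 := hv.sub (ht0.mul htrem)
    rw [mul_zero, sub_zero] at h1
    refine h1.congr fun n => ?_
    ring
  have hpow := h.tendsto_integral_exp_pow hk hM ht hv'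
  -- For `c = -1` and `c = 1` these are the two sides of the final sandwich.
  have hexp : ∀ c : ℝ, Tendsto (fun n => Real.exp (c * (t n * (N n - k n * M n))) *
      (∫ ω, Real.exp (t n * centeredSum ξ d (M n) ω) ∂P) ^ k n) atTop
      (𝓝 (Real.exp (v / 2 * asympVar L d p))) := by
    intro c
    have h1 := (Real.continuous_exp.tendsto _).comp (htrem.const_mul c)
    rw [mul_zero, Real.exp_zero] at h1
    simpa using h1.mul hpow
  have hint : ∀ n c, Integrable (fun ω => Real.exp (c + t n * ∑ j ∈ Finset.range (k n),
      ∑ i ∈ Finset.range (M n), (ξ (j * (M n + L) + i) ω - d))) P := by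
    intro n c
    refine Integrable.of_bound (C := Real.exp (c + t n * ∑ j ∈ Finset.range (k n),
      ∑ i ∈ Finset.range (M n), (1 - d))) ?_ (Eventually.of_forall fun ω => ?_)
    · refine (Real.measurable_exp.comp (((Finset.measurable_fun_sum _ fun j _ =>
        Finset.measurable_fun_sum _ fun i _ => (h.measurable _).sub_const d).const_mul
        _).const_add _)).aestronglyMeasurable
    · rw [Real.norm_eq_abs, Real.abs_exp]
      refine Real.exp_le_exp.2 (add_le_add le_rfl (mul_le_mul_of_nonneg_left ?_ (ht n)))
      exact Finset.sum_le_sum fun j _ => Finset.sum_le_sum fun i _ =>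
        sub_le_sub_right (h.mem_Icc _ ω).2 d
  have hsplit : ∀ n c, Real.exp c * (∫ ω, Real.exp (t n * centeredSum ξ d (M n) ω) ∂P) ^ k n
      = ∫ ω, Real.exp (c + t n * ∑ j ∈ Finset.range (k n),
      ∑ i ∈ Finset.range (M n), (ξ (j * (M n + L) + i) ω - d)) ∂P := by
    intro n c
    rw [← h.integral_exp_blocks, ← integral_const_mul]
    simp only [Real.exp_add]
  have hI : ∀ n, Integrable (fun ω => Real.exp (t n * centeredSum ξ d (N n) ω)) P := fun n =>
    h.integrable_comp_centeredSum (N n) (f := fun y => Real.exp (t n * y)) (by fun_prop)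
  refine tendsto_of_tendsto_of_tendsto_of_le_of_le' (hexp (-1)) (hexp 1) ?_ ?_
  · filter_upwards [hMB] with n hn
    rw [hsplit]
    refine integral_mono (hint _ _) (hI n) fun ω => Real.exp_le_exp.2 ?_
    have h1 := h.abs_centeredSum_sub_blocks_le (k := k n) (M := M n) (N := N n)
      (by rw [hn.1]; exact hkB n) ω
    have h2 := mul_le_mul_of_nonneg_left (abs_le.1 h1).1 (ht n)
    linarith
  · filter_upwards [hMB] with n hn
    rw [hsplit]
    refine integral_mono (hI n) (hint _ _) fun ω => Real.exp_le_exp.2 ?_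
    have h1 := h.abs_centeredSum_sub_blocks_le (k := k n) (M := M n) (N := N n)
      (by rw [hn.1]; exact hkB n) ω
    have h2 := mul_le_mul_of_nonneg_left (abs_le.1 h1).2 (ht n)
    linarith

end IsDependentSequence

/-! ### The occurrences of a shape form a stationary dependent sequence -/

theorem isDyckOn_Ioo_add {u : ℕ → Bool} {a b t : ℕ} :
    IsDyckOn (Finset.Ioo (a + t) (b + t)) u ↔ IsDyckOn (Finset.Ioo a b) fun x => u (x + t) := by
  have hmap : Finset.Ioo (a + t) (b + t) = (Finset.Ioo a b).map (addRightEmbedding t) :=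
    (Finset.map_add_right_Ioo a b t).symm
  have hsum : ∀ U : Finset ℕ, ∑ x ∈ U.map (addRightEmbedding t), wordStep u x
      = ∑ x ∈ U, wordStep (fun x => u (x + t)) x := fun U => Finset.sum_map _ _ _
  have hle : ∀ j, ∑ x ∈ (Finset.Ioo a b).map (addRightEmbedding t) with x ≤ j + t, wordStep u x
      = ∑ x ∈ Finset.Ioo a b with x ≤ j, wordStep (fun x => u (x + t)) x := by
    intro j
    rw [Finset.filter_map, hsum]
    refine Finset.sum_congr (Finset.filter_congr fun x _ => ?_) fun _ _ => rfl
    simp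
  rw [IsDyckOn, IsDyckOn, hmap, hsum]
  refine and_congr_left fun _ => ⟨fun h j => (hle j) ▸ h (j + t), fun h j => ?_⟩
  rcases le_total t j with htj | htj
  · have := h (j - t)
    rwa [← hle, Nat.sub_add_cancel htj] at this
  -- For `j ≤ t` the prefix is empty: all shifted points exceed `t`.
  · rw [Finset.sum_eq_zero]
    intro x hx
    simp only [Finset.mem_filter, Finset.mem_map, Finset.mem_Ioo, addRightEmbedding_apply] at hx
    omega

theorem hasArcsAt_add {u : ℕ → Bool} {m : ℕ → ℕ} {s t : ℕ} :
    HasArcsAt u m (s + t) ↔ HasArcsAt (fun x => u (x + s)) m t := by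
  refine forall₂_congr fun a _ => ?_
  rw [show a + (s + t) = a + t + s by omega, show m a + (s + t) = m a + t + s by omega, IsArc,
    IsArc, isDyckOn_Ioo_add, Nat.add_lt_add_iff_right]

namespace Shape

variable (S : Shape)

theorem occurs_add {s t : ℕ} {ω : ℕ × Bool → Bool} :
    S.Occurs (s + t) ω ↔ S.Occurs t fun i => ω (i.1 + s, i.2) := by
  rw [Occurs, Occurs, hasArcsAt_add, hasArcsAt_add]
  rfl

theorem coins_map_shift (s : ℕ) :
    (coins (ℕ × Bool)).map (fun ω i => ω (i.1 + s, i.2)) = coins (ℕ × Bool) := by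
  refine coins_map_injective (e := fun i : ℕ × Bool => (i.1 + s, i.2)) ?_
  rintro ⟨a, b⟩ ⟨a', b'⟩ h
  simp only [Prod.mk.injEq, Nat.add_right_cancel_iff] at h
  exact Prod.ext h.1 h.2

/-- The indicator function of the occurrence of `S` at `t`. -/
noncomputable def occursIndicator (t : ℕ) : (ℕ × Bool → Bool) → ℝ :=
  {ω | S.Occurs t ω}.indicator 1

theorem occursIndicator_congr {s t : ℕ} {ω ω' : ℕ × Bool → Bool}
    (h : S.Occurs s ω ↔ S.Occurs t ω') : S.occursIndicator s ω = S.occursIndicator t ω' := by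
  simp only [occursIndicator, Set.indicator, Set.mem_ofPred_eq, Pi.one_apply]
  split_ifs <;> tauto

theorem occursIndicator_add (s t : ℕ) (ω : ℕ × Bool → Bool) :
    S.occursIndicator (s + t) ω = S.occursIndicator t fun i => ω (i.1 + s, i.2) :=
  S.occursIndicator_congr S.occurs_add

theorem measurable_occursIndicator (t : ℕ) : Measurable (S.occursIndicator t) :=
  measurable_one.indicator (S.measurableSet_occurs t)

theorem dependsOn_occursIndicator (t : ℕ) :
    DependsOn (S.occursIndicator t) (window t (2 * S.halfLength) : Set (ℕ × Bool)) :=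
  fun _ _ h => S.occursIndicator_congr (iff_of_eq (S.dependsOn_occurs t h))

theorem disjoint_window {s t L : ℕ} (h : s + L ≤ t ∨ t + L ≤ s) :
    Disjoint (window s L) (window t L) := by
  rw [Finset.disjoint_left]
  rintro ⟨x, b⟩ h1 h2
  simp only [window, Finset.mem_product, Finset.mem_Icc] at h1 h2
  omega

theorem integral_occursIndicator (t : ℕ) :
    ∫ ω, S.occursIndicator t ω ∂coins (ℕ × Bool) = S.occursProb {t} := by
  rw [occursIndicator, integral_indicator_one (S.measurableSet_occurs t), occursProb]
  simp

theorem occursProb_add {s : ℕ} (A : Finset ℕ) :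
    S.occursProb (A.map (addLeftEmbedding s)) = S.occursProb A := by
  rw [occursProb, occursProb]
  conv_rhs => rw [← coins_map_shift s]
  rw [map_measureReal_apply (by fun_prop) (S.measurableSet_forall_occurs A)]
  congr 1
  ext ω
  simp [occurs_add]

theorem occursProb_singleton (t : ℕ) : S.occursProb {t} = S.occursProb {0} := by
  rw [← S.occursProb_add (s := t) {0}]
  simp

theorem occursProb_pair (s r : ℕ) : S.occursProb {s, s + r} = S.occursProb {0, r} := by
  rw [← S.occursProb_add (s := s) {0, r}]
  simp

/-- An occurrence at `t` reads only the letters `t + 1, …, t + 2ℓ`, which gives the range of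
dependence; stationarity is the shift invariance of the fair bits. -/
theorem isDependentSequence : IsDependentSequence (coins (ℕ × Bool)) S.occursIndicator
    (2 * S.halfLength) (S.occursProb {0}) fun r => S.occursProb {0, r} where
  pos := by have := S.halfLength_pos; omega
  measurable := S.measurable_occursIndicator
  mem_Icc t ω := by
    simp only [occursIndicator, Set.indicator, Pi.one_apply]
    split_ifs <;> simp
  indep T hT := by
    refine iIndepFun_of_dependsOn
      (T := fun i => (T i).biUnion fun t => window t (2 * S.halfLength)) (fun i => ?_) ?_
    · intro ω ω' h
      refine Finset.sum_congr rfl fun t ht => S.dependsOn_occursIndicator t fun x hx => h x ?_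
      exact Finset.mem_coe.2 (Finset.mem_biUnion.2 ⟨t, ht, hx⟩)
    · intro i j hij
      simp only [Finset.disjoint_biUnion_left, Finset.disjoint_biUnion_right]
      exact fun t ht s hs => disjoint_window (hT i j hij s hs t ht)
  ident s M := by
    have hm : ∀ s, Measurable fun ω => ∑ i ∈ Finset.range M, S.occursIndicator (s + i) ω :=
      fun s => Finset.measurable_fun_sum _ fun i _ => S.measurable_occursIndicator _
    have h0 := hm 0
    simp only [zero_add] at h0
    refine ⟨(hm s).aemeasurable, h0.aemeasurable, ?_⟩
    conv_rhs => rw [← coins_map_shift s]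
    rw [Measure.map_map h0 (by fun_prop)]
    congr 1
    funext ω
    simp only [Function.comp_apply, occursIndicator_add]
  mean t := by rw [integral_occursIndicator, occursProb_singleton]
  corr t r := by
    rw [← S.occursProb_pair t r, occursProb,
      ← integral_indicator_one (S.measurableSet_forall_occurs _)]
    refine integral_congr_ae (Eventually.of_forall fun ω => ?_)
    simp only [occursIndicator, Set.indicator, Set.mem_ofPred_eq, Pi.one_apply,
      Finset.mem_insert, Finset.mem_singleton, forall_eq_or_imp, forall_eq]
    split_ifs <;> simp_all
  corr_of_le r hr := by
    have h := coins_and (S.dependsOn_occurs 0) (S.dependsOn_occurs r)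
      (disjoint_window (Or.inl (by omega)))
    have h1 := S.occursProb_singleton r
    simp only [occursProb, Finset.mem_insert, Finset.mem_singleton, forall_eq_or_imp,
      forall_eq] at h1 ⊢
    rw [h, h1, sq]

theorem count_eq_sum (N : ℕ) (ω : ℕ × Bool → Bool) : (S.count N ω : ℝ) =
    ∑ t ∈ Finset.range (N + 1 - 2 * S.halfLength), S.occursIndicator t ω := by
  classical
  rw [count, Finset.card_filter, Nat.cast_sum]
  refine Finset.sum_congr rfl fun t _ => ?_
  simp only [occursIndicator, Set.indicator, Set.mem_ofPred_eq, Pi.one_apply]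
  split_ifs <;> simp

end Shape

/-! ### The limit theorem, in terms of occurrence probabilities -/

theorem exp_sub_one_le (x : ℝ) : Real.exp x - 1 ≤ x * Real.exp x := by
  have h1 := Real.add_one_le_exp (-x)
  have h2 := mul_le_mul_of_nonneg_right h1 (Real.exp_pos x).le
  rw [← Real.exp_add, neg_add_cancel, Real.exp_zero] at h2
  linarith

theorem tendsto_div_sqrt (l : ℝ) : Tendsto (fun n : ℕ => l / √n) atTop (𝓝 0) :=
  tendsto_const_nhds.div_atTop (Real.tendsto_sqrt_atTop.comp tendsto_natCast_atTop_atTop)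

namespace Shape

variable (S : Shape)

theorem count_le (N : ℕ) (ω : ℕ × Bool → Bool) : S.count N ω ≤ N := by
  classical
  have h := S.halfLength_pos
  rw [count]
  refine (Finset.card_filter_le _ _).trans ?_
  rw [Finset.card_range]
  omega

theorem measurable_count (N : ℕ) : Measurable fun ω => (S.count N ω : ℝ) := by
  simp only [count_eq_sum]
  exact Finset.measurable_fun_sum _ fun t _ => S.measurable_occursIndicator t

theorem pow_count_eq_exp (N : ℕ) {v : ℝ} (hv : 0 ≤ v) (ω : ℕ × Bool → Bool) :
    (1 + v) ^ S.count N ω = Real.exp (Real.log (1 + v) * S.count N ω) := by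
  rw [mul_comm, Real.exp_nat_mul, Real.exp_log (by linarith)]

theorem integrable_pow_count (N : ℕ) {v : ℝ} (hv : 0 ≤ v) :
    Integrable (fun ω => (1 + v) ^ S.count N ω) (coins (ℕ × Bool)) := by
  simp only [S.pow_count_eq_exp N hv]
  refine Integrable.of_bound (C := Real.exp (Real.log (1 + v) * N))
    (Real.measurable_exp.comp ((S.measurable_count N).const_mul _)).aestronglyMeasurable
    (Eventually.of_forall fun ω => ?_)
  rw [Real.norm_eq_abs, Real.abs_exp]
  refine Real.exp_le_exp.2 (mul_le_mul_of_nonneg_left ?_ (Real.log_nonneg (by linarith)))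
  exact_mod_cast S.count_le N ω

theorem genFun_pos (N : ℕ) {v : ℝ} (hv : 0 ≤ v) : 0 < S.genFun N v := by
  have h1 := integral_mono (integrable_const (1 : ℝ)) (S.integrable_pow_count N hv)
    fun ω => one_le_pow₀ (M₀ := ℝ) (n := S.count N ω) (by linarith)
  simp only [integral_const, probReal_univ, smul_eq_mul, mul_one] at h1
  exact one_pos.trans_le h1

/-- The count is at most `N`, so a factor `exp e` in the base costs at most `exp (N * e)`. This
suffices both when `N * e → 0` and against an exponentially small prefactor. -/
theorem genFun_le_mul (N : ℕ) {v w e : ℝ} (hv : 0 ≤ v) (hw : 0 ≤ w) (he : 0 ≤ e)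
    (h : 1 + w ≤ (1 + v) * Real.exp e) : S.genFun N w ≤ Real.exp (N * e) * S.genFun N v := by
  rw [genFun, genFun, ← integral_const_mul]
  refine integral_mono (S.integrable_pow_count N hw) ((S.integrable_pow_count N hv).const_mul _)
    fun ω => ?_
  calc (1 + w) ^ S.count N ω ≤ ((1 + v) * Real.exp e) ^ S.count N ω :=
        pow_le_pow_left₀ (by linarith) h _
    _ = Real.exp (S.count N ω * e) * (1 + v) ^ S.count N ω := by
        rw [mul_pow, ← Real.exp_nat_mul, mul_comm]
    _ ≤ Real.exp (N * e) * (1 + v) ^ S.count N ω := by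
        refine mul_le_mul_of_nonneg_right (Real.exp_le_exp.2 ?_) (pow_nonneg (by linarith) _)
        exact mul_le_mul_of_nonneg_right (by exact_mod_cast S.count_le N ω) he

/-- The asymptotic variance of the number of occurrences, per letter. -/
noncomputable def letterVar : ℝ :=
  IsDependentSequence.asympVar (2 * S.halfLength) (S.occursProb {0}) fun r => S.occursProb {0, r}

theorem tendsto_genFun {l : ℝ} (hl : 0 < l) :
    Tendsto (fun n : ℕ => Real.exp (-(l / √n * (n * (2 * S.occursProb {0})))) *
      S.genFun (2 * n) (Real.exp (l / √n) - 1)) atTop (𝓝 (Real.exp (l ^ 2 * S.letterVar))) := by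
  have hL := S.halfLength_pos
  set N : ℕ → ℕ := fun n => 2 * n + 1 - 2 * S.halfLength with hN
  have hNt : Tendsto N atTop atTop := tendsto_atTop.2 fun b => by
    filter_upwards [eventually_ge_atTop (b + 2 * S.halfLength)] with n hn
    simp only [hN]
    omega
  have hcast : ∀ᶠ n : ℕ in atTop, (N n : ℝ) = 2 * n + 1 - 2 * S.halfLength := by
    filter_upwards [eventually_ge_atTop S.halfLength] with n hn
    simp only [hN]
    rw [Nat.cast_sub (by omega)]
    push_cast
    ring
  have h1 : Tendsto (fun n : ℕ => (l / √n) ^ 2 * N n) atTop (𝓝 (2 * l ^ 2)) := by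
    have h2 : Tendsto (fun n : ℕ => 2 * l ^ 2 + l ^ 2 * (1 - 2 * S.halfLength) / n) atTop
        (𝓝 (2 * l ^ 2 + 0)) :=
      (tendsto_const_div_atTop_nhds_zero_nat _).const_add _
    rw [add_zero] at h2
    refine h2.congr' ?_
    filter_upwards [hcast, eventually_gt_atTop 0] with n hn hn0
    have : (n : ℝ) ≠ 0 := by exact_mod_cast hn0.ne'
    rw [hn, div_pow, Real.sq_sqrt (Nat.cast_nonneg n)]
    field_simp
    ring
  have h2 := S.isDependentSequence.tendsto_integral_exp hNt
    (fun n => by positivity) h1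
  rw [show 2 * l ^ 2 / 2 = l ^ 2 by ring] at h2
  -- There are `2n + 1 - 2ℓ` places rather than `2n`; the bounded change in the centring disappears
  -- after multiplication by `l / √n`.
  have h3 : Tendsto (fun n : ℕ => Real.exp (l / √n * ((1 - 2 * S.halfLength) * S.occursProb {0})))
      atTop (𝓝 1) := by
    have := (Real.continuous_exp.tendsto _).comp
      ((tendsto_div_sqrt l).mul_const ((1 - 2 * S.halfLength) * S.occursProb {0}))
    rwa [zero_mul, Real.exp_zero] at this
  have h4 := h3.mul h2
  rw [one_mul] at h4
  refine h4.congr' ?_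
  filter_upwards [hcast] with n hn
  rw [genFun, ← integral_const_mul, ← integral_const_mul]
  refine integral_congr_ae (Eventually.of_forall fun ω => ?_)
  simp only [IsDependentSequence.centeredSum]
  rw [add_sub_cancel, ← Real.exp_nat_mul, ← Real.exp_add, ← Real.exp_add, Finset.sum_sub_distrib,
    S.count_eq_sum, Finset.sum_const, Finset.card_range, nsmul_eq_mul]
  change Real.exp (_ + _ * (_ - (N n : ℝ) * _)) = _
  rw [hn]
  congr 1
  ring

/-- The upper bound has two terms. Passing from `v` to `v * exp (c / n)` multiplies `1 + v` by at
most `exp (e n)`, where `n * e n → 0`. The other term is polynomial times `exp (-κ n)`, while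
doubling `v` costs only `exp (2 n v)` with `v → 0`. -/
theorem tendsto_meandricGenFun_div {l : ℝ} (hl : 0 < l) :
    Tendsto (fun n : ℕ => S.meandricGenFun n (Real.exp (l / √n) - 1) /
      S.genFun (2 * n) (Real.exp (l / √n) - 1)) atTop (𝓝 1) := by
  set v : ℕ → ℝ := fun n => Real.exp (l / √n) - 1 with hv
  have hv0 : ∀ n, 0 ≤ v n := fun n => sub_nonneg.2 (Real.one_le_exp (by positivity))
  have hvt : Tendsto v atTop (𝓝 0) := by
    have := ((Real.continuous_exp.tendsto _).comp (tendsto_div_sqrt l)).sub_const 1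
    rwa [Real.exp_zero, sub_self] at this
  have hL : (0 : ℝ) < S.halfLength := by exact_mod_cast S.halfLength_pos
  set c : ℝ := 6 * S.halfLength with hc
  set κ : ℝ := Real.log 2 / (2 * S.halfLength) with hκ
  have hκ0 : 0 < κ := div_pos (Real.log_pos one_lt_two) (by positivity)
  set e : ℕ → ℝ := fun n => v n * (Real.exp (c / n) - 1) with he
  have he0 : ∀ n, 0 ≤ e n := fun n =>
    mul_nonneg (hv0 n) (sub_nonneg.2 (Real.one_le_exp (by positivity)))
  have he1 : Tendsto (fun n : ℕ => (2 * n : ℕ) * e n) atTop (𝓝 0) := by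
    have h1 : Tendsto (fun n : ℕ => 2 * v n * (c * Real.exp (c / n))) atTop (𝓝 0) := by
      have h2 := ((Real.continuous_exp.tendsto _).comp
        (tendsto_const_div_atTop_nhds_zero_nat c)).const_mul c
      simpa using (hvt.const_mul 2).mul h2
    refine squeeze_zero' (Eventually.of_forall fun n => mul_nonneg (Nat.cast_nonneg _) (he0 n)) ?_ h1
    filter_upwards [eventually_gt_atTop 0] with n hn
    have hn' : (0 : ℝ) < n := by exact_mod_cast hn
    have h3 : n * (Real.exp (c / n) - 1) ≤ c * Real.exp (c / n) := by
      refine (mul_le_mul_of_nonneg_left (exp_sub_one_le _) hn'.le).trans (le_of_eq ?_)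
      field_simp
    have := mul_le_mul_of_nonneg_left h3 (mul_nonneg two_pos.le (hv0 n))
    simp only [he]
    push_cast
    linarith
  have hpoly : Tendsto (fun n : ℕ => (2 * n * (n + 1) : ℝ) ^ 2 *
      Real.exp (-(Real.log 2 * (n / (2 * S.halfLength)))) * Real.exp ((2 * n : ℕ) * v n)) atTop
      (𝓝 0) := by
    have h1 := (tendsto_pow_const_mul_const_pow_of_abs_lt_one 4 (r := Real.exp (-(κ / 2)))
      (by rw [Real.abs_exp]; exact Real.exp_lt_one_iff.2 (by linarith))).const_mul 16
    rw [mul_zero] at h1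
    refine squeeze_zero' (Eventually.of_forall fun n => by positivity) ?_ h1
    -- Once `v n ≤ κ / 4`, the exponent `-κ n + 2 n v` is at most `-κ n / 2`.
    filter_upwards [eventually_ge_atTop 1, hvt.eventually (ge_mem_nhds (by positivity : 0 < κ / 4))]
      with n hn hvn
    have hn' : (1 : ℝ) ≤ n := by exact_mod_cast hn
    rw [mul_assoc, ← Real.exp_add, ← Real.exp_nat_mul, ← mul_assoc]
    refine mul_le_mul ?_ (Real.exp_le_exp.2 ?_) (Real.exp_pos _).le (by positivity)
    · have h2 : (2 * n * (n + 1) : ℝ) ≤ 4 * n ^ 2 := by nlinarith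
      calc (2 * n * (n + 1) : ℝ) ^ 2 ≤ (4 * n ^ 2) ^ 2 := pow_le_pow_left₀ (by positivity) h2 2
        _ = 16 * n ^ 4 := by ring
    · have h3 : Real.log 2 * (n / (2 * S.halfLength)) = n * κ := by rw [hκ]; ring
      have h4 := mul_le_mul_of_nonneg_left hvn (by positivity : (0 : ℝ) ≤ 2 * n)
      rw [h3]
      push_cast
      linarith
  have hup : Tendsto (fun n : ℕ => Real.exp ((2 * n : ℕ) * e n) + (2 * n * (n + 1) : ℝ) ^ 2 *
      Real.exp (-(Real.log 2 * (n / (2 * S.halfLength)))) * Real.exp ((2 * n : ℕ) * v n)) atTop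
      (𝓝 1) := by
    have := ((Real.continuous_exp.tendsto _).comp he1).add hpoly
    rwa [Real.exp_zero, add_zero] at this
  refine tendsto_of_tendsto_of_tendsto_of_le_of_le' tendsto_const_nhds hup ?_ ?_
  · refine Eventually.of_forall fun n => ?_
    rw [le_div_iff₀ (S.genFun_pos _ (hv0 n)), one_mul]
    exact S.genFun_le_meandricGenFun n (hv0 n)
  · filter_upwards [eventually_gt_atTop 0] with n hn
    rw [div_le_iff₀ (S.genFun_pos _ (hv0 n)), add_mul, mul_assoc _ (Real.exp _) (S.genFun _ _)]
    refine (S.meandricGenFun_le hn (hv0 n)).trans (add_le_add ?_ ?_)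
    · refine S.genFun_le_mul _ (hv0 n) (mul_nonneg (hv0 n) (Real.exp_pos _).le) (he0 n) ?_
      have h1 := Real.add_one_le_exp (e n)
      have h2 := mul_le_mul_of_nonneg_left h1 (by linarith [hv0 n] : 0 ≤ 1 + v n)
      refine le_trans ?_ h2
      have h3 := mul_nonneg (hv0 n) (he0 n)
      simp only [he] at h3 ⊢
      linarith
    · refine mul_le_mul_of_nonneg_left ?_ (by positivity)
      refine S.genFun_le_mul _ (hv0 n) (mul_nonneg two_pos.le (hv0 n)) (hv0 n) ?_
      have h1 := Real.add_one_le_exp (v n)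
      have h2 := mul_le_mul_of_nonneg_left h1 (by linarith [hv0 n] : 0 ≤ 1 + v n)
      nlinarith [sq_nonneg (v n)]

theorem tendsto_meandric_laplace {l : ℝ} (hl : 0 < l) :
    Tendsto (fun n : ℕ => ∫ M, Real.exp (l / √n * (LoopSystem.numComponents M S -
      n * (2 * S.occursProb {0}))) ∂uniformMeandric n) atTop
      (𝓝 (Real.exp (l ^ 2 * S.letterVar))) := by
  have h := (S.tendsto_genFun hl).mul (S.tendsto_meandricGenFun_div hl)
  rw [mul_one] at h
  refine h.congr fun n => ?_
  have hv0 : 0 ≤ Real.exp (l / √n) - 1 := sub_nonneg.2 (Real.one_le_exp (by positivity))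
  rw [mul_assoc, mul_div_cancel₀ _ (S.genFun_pos _ hv0).ne', meandricGenFun, ← integral_const_mul]
  congr 1
  funext M
  rw [add_sub_cancel, ← Real.exp_nat_mul, ← Real.exp_add]
  ring_nf

theorem tendstoInDistribution_of_sq_eq {σ : ℝ} (hσ : 0 < σ) (hσ2 : σ ^ 2 = 2 * S.letterVar) :
    TendstoInDistribution
      (fun (n : ℕ) (M : MeandricSystem n) =>
        ((M.numComponents S : ℝ) - n * (2 * S.occursProb {0})) / (σ * Real.sqrt n))
      atTop (id : ℝ → ℝ) uniformMeandric (gaussianReal 0 1) where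
  forall_aemeasurable n := measurable_from_top.aemeasurable
  aemeasurable_limit := aemeasurable_id
  tendsto := by
    have hm : ∀ n : ℕ, Measurable fun M : MeandricSystem n =>
        ((M.numComponents S : ℝ) - n * (2 * S.occursProb {0})) / (σ * Real.sqrt n) :=
      fun n => measurable_from_top
    have hlim : (⟨(gaussianReal 0 1).map id, Measure.isProbabilityMeasure_map aemeasurable_id⟩ :
        ProbabilityMeasure ℝ) = ⟨gaussianReal 0 1, inferInstance⟩ := Subtype.ext Measure.map_id
    rw [hlim]
    refine tendsto_gaussian_of_tendsto_mgf (fun n s _ => ?_) fun s hs => ?_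
    · change Integrable _ ((uniformMeandric n).map _)
      rw [integrable_map_measure (by fun_prop) (hm n).aemeasurable]
      exact .of_finite
    -- Parameter `s` for the normalised count means `l = s / σ`; the `2n` letters explain the factor
    -- `2` in `σ ^ 2 = 2 * letterVar`.
    · have h := S.tendsto_meandric_laplace (div_pos hs hσ)
      rw [div_pow, hσ2, show s ^ 2 / (2 * S.letterVar) * S.letterVar = s ^ 2 / 2 by
        have : S.letterVar ≠ 0 := by
          intro h0
          rw [h0, mul_zero] at hσ2
          exact hσ.ne' (pow_eq_zero_iff two_ne_zero |>.1 hσ2)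
        field_simp] at h
      refine h.congr fun n => ?_
      change _ = mgf id ((uniformMeandric n).map _) s
      rw [mgf_id_map (hm n).aemeasurable, mgf]
      refine integral_congr_ae (Eventually.of_forall fun M => ?_)
      simp only
      congr 1
      ring

end Shape

/-! ### Parities -/

theorem card_Ioo_faces {V : Finset ℕ} {m : ℕ → ℕ} (h : IsNCMatching V m) (a : ℕ) :
    (Finset.Ioo a (m a)).card = (innerVertices m a).card +
      ∑ b ∈ Finset.Ioo a (m a) with b < m b, (2 + (innerVertices m b).card) := by
  have := sum_faces h (ordConnected_Ioo a (m a)) (fun x hx => h.mem_Ioo hx) (fun _ => 1)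
  rw [outerPart_Ioo] at this
  simpa using this

/-- An arc of odd length has an even number of interior points; by induction each nested face uses
an even number of them, so an even number remains. -/
theorem even_card_innerVertices {V : Finset ℕ} {m : ℕ → ℕ} (h : IsNCMatching V m)
    (hodd : ∀ a, a < m a → Odd (m a - a)) {a : ℕ} (ha : a < m a) :
    Even (innerVertices m a).card := by
  induction hn : m a - a using Nat.strong_induction_on generalizing a with
  | _ n ih =>
  have h1 := card_Ioo_faces h a
  have h2 : Even (∑ b ∈ Finset.Ioo a (m a) with b < m b, (2 + (innerVertices m b).card)) := by
    refine Finset.even_sum _ fun b hb => even_two.add ?_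
    rw [Finset.mem_filter] at hb
    have h3 := h.mem_Ioo hb.1
    rw [Finset.mem_Ioo] at hb h3
    exact ih _ (by omega) hb.2 rfl
  have h3 : Even (Finset.Ioo a (m a)).card := by
    have := hodd a ha
    rw [Nat.card_Ioo]
    rw [Nat.odd_iff] at this
    rw [Nat.even_iff]
    omega
  rw [h1] at h3
  exact (Nat.even_add.1 h3).2 h2

theorem even_card_inter_Ioo {V : Finset ℕ} {m : ℕ → ℕ} (h : IsNCMatching V m) (a : ℕ) :
    Even (V.filter fun x => a < x ∧ x < m a).card := by
  classical
  have h1 := sum_faces h (ordConnected_Ioo a (m a)) (fun x hx => h.mem_Ioo hx)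
    (fun x => if x ∈ V then 1 else 0)
  have h2 : ∀ (U : Finset ℕ), (∀ x ∈ U, m x = x) → ∑ x ∈ U, (if x ∈ V then 1 else 0) = 0 :=
    fun U hU => Finset.sum_eq_zero fun x hx => if_neg fun hxV => (h.ne_iff x).2 hxV (hU x hx)
  rw [outerPart_Ioo, h2 _ fun x hx => (mem_innerVertices.1 hx).2.1, zero_add,
    ← Finset.card_filter] at h1
  have h3 : V.filter (fun x => a < x ∧ x < m a) = (Finset.Ioo a (m a)).filter (· ∈ V) := by
    ext x
    simp only [Finset.mem_filter, Finset.mem_Ioo]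
    tauto
  rw [h3, h1]
  refine Finset.even_sum _ fun b hb => ?_
  have hb' := h.mem_of_lt (Finset.mem_filter.1 hb).2
  rw [h2 _ fun x hx => (mem_innerVertices.1 hx).2.1, if_pos hb', if_pos (h.mem_of_mem hb')]
  exact even_two

/-- All gaps between consecutive points of `V` are odd, so `y - x` has the parity of the number of
gaps, one more than the number of points in between. -/
theorem odd_sub_iff {V : Finset ℕ} (hV : ∀ x ∈ V, ∀ y ∈ V, x < y →
    (∀ z ∈ V, ¬ (x < z ∧ z < y)) → Odd (y - x)) {x y : ℕ} (hx : x ∈ V) (hy : y ∈ V) (hxy : x < y) :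
    Odd (y - x) ↔ Even (V.filter fun z => x < z ∧ z < y).card := by
  induction y using Nat.strong_induction_on with
  | _ y ih =>
  rcases (V.filter fun z => x < z ∧ z < y).eq_empty_or_nonempty with he | hne
  · have h1 := hV x hx y hy hxy fun z hz hz' => by
      have : z ∈ V.filter fun z => x < z ∧ z < y := Finset.mem_filter.2 ⟨hz, hz'⟩
      simp [he] at this
    simp [he, h1]
  · have hmem := Finset.max'_mem _ hne
    have hmax := fun b hb => Finset.le_max' (V.filter fun z => x < z ∧ z < y) b hb
    set z := (V.filter fun z => x < z ∧ z < y).max' hne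
    rw [Finset.mem_filter] at hmem
    have h1 := ih z hmem.2.2 hmem.1 hmem.2.1
    have h2 := hV z hmem.1 y hy hmem.2.2 fun w hw hw' => by
      have := hmax w (Finset.mem_filter.2 ⟨hw, by omega, hw'.2⟩)
      omega
    have h3 : V.filter (fun w => x < w ∧ w < y) =
        insert z (V.filter fun w => x < w ∧ w < z) := by
      ext w
      simp only [Finset.mem_filter, Finset.mem_insert]
      constructor
      · rintro ⟨hw, hw'⟩
        have := hmax w (Finset.mem_filter.2 ⟨hw, hw'⟩)
        rcases this.eq_or_lt with h | h
        · exact Or.inl h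
        · exact Or.inr ⟨hw, hw'.1, h⟩
      · rintro (rfl | ⟨hw, hw'⟩)
        · exact hmem
        · exact ⟨hw, by omega, by omega⟩
    rw [h3, Finset.card_insert_of_notMem (by simp)]
    rw [Nat.odd_iff] at h1 h2 ⊢
    rw [Nat.even_iff] at h1 ⊢
    omega

/-! ### The constants -/

theorem hasArcsAt_zero {u : ℕ → Bool} {m : ℕ → ℕ} : HasArcsAt u m 0 ↔ HasArcs u m := Iff.rfl

theorem four_rpow_half (k : ℕ) : (4 : ℝ) ^ ((k : ℝ) / 2) = 2 ^ k := by
  rw [show (4 : ℝ) = 2 ^ (2 : ℝ) by norm_num, ← Real.rpow_mul two_pos.le,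
    mul_div_cancel₀ _ (two_ne_zero' ℝ), Real.rpow_natCast]

theorem faceProduct_pos (m : ℕ → ℕ) (R : ℕ) : 0 < faceProduct m R :=
  Finset.prod_pos fun _ _ => catalan_pos _

/-- As the two supports are disjoint, at most one factor of the composition `m ∘ shiftMatching r m`
moves a given point. -/
theorem pairMatching_eq {V V' : Finset ℕ} {m m' : ℕ → ℕ} {r : ℕ} (h : IsNCMatching V m)
    (h' : IsNCMatching V' m') (hdisj : ∀ y ∈ V, y + r ∉ V)
    (hV' : ∀ x, x ∈ V' ↔ ∃ t ∈ ({0, r} : Finset ℕ), ∃ y ∈ V, x = y + t)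
    (hm' : ∀ t ∈ ({0, r} : Finset ℕ), ∀ y ∈ V, m' (y + t) = m y + t) : pairMatching r m = m' := by
  funext x
  unfold pairMatching shiftMatching
  by_cases hx : x ∈ V
  · have h1 := hm' 0 (by simp) x hx
    rw [add_zero, add_zero] at h1
    rw [h1]
    split_ifs with hxr
    · rfl
    · have h2 : x - r ∉ V := fun hn => hdisj _ hn (by rwa [Nat.sub_add_cancel (not_lt.1 hxr)])
      rw [h.eq_of_notMem h2, Nat.sub_add_cancel (not_lt.1 hxr)]
  · by_cases hy : r ≤ x ∧ x - r ∈ V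
    · have h1 := hm' r (by simp) _ hy.2
      rw [Nat.sub_add_cancel hy.1] at h1
      rw [if_neg (not_lt.2 hy.1), h1, h.eq_of_notMem (hdisj _ (h.mem_of_mem hy.2))]
    · have h1 : x ∉ V' := by
        rw [hV']
        rintro ⟨t, ht, y, hyV, rfl⟩
        rw [Finset.mem_insert, Finset.mem_singleton] at ht
        rcases ht with rfl | rfl
        · exact hx hyV
        · exact hy ⟨by omega, by rwa [Nat.add_sub_cancel]⟩
      rw [h'.eq_of_notMem h1]
      split_ifs with hxr
      · exact h.eq_of_notMem hx
      · rw [h.eq_of_notMem fun hn => hy ⟨not_lt.1 hxr, hn⟩, Nat.sub_add_cancel (not_lt.1 hxr),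
          h.eq_of_notMem hx]

/-- Positive probability yields a word containing both translates, so their union is a genuine
matching, and it also forces even inner faces. The formula for one matching then applies to the
union. -/
theorem coins_hasArcsAt_pair {V : Finset ℕ} {m : ℕ → ℕ} {L r : ℕ} (h : IsNCMatching V m)
    (hV : V ⊆ Finset.Icc 1 L) (hdisj : ∀ y ∈ V, y + r ∉ V) {s : Bool}
    (hne : (coins (ℕ × Bool)).real
      {ω | ∀ t ∈ ({0, r} : Finset ℕ), HasArcsAt (sideWord s ω) m t} ≠ 0) :
    (coins (ℕ × Bool)).real {ω | ∀ t ∈ ({0, r} : Finset ℕ), HasArcsAt (sideWord s ω) m t} =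
      faceProduct (pairMatching r m) (L + r) *
        2 ^ (outerVertices (pairMatching r m) (L + r)).card / 2 ^ (L + r) := by
  obtain ⟨ω, hω⟩ := nonempty_of_measureReal_ne_zero hne
  obtain ⟨V', m', h', hV', hm'⟩ := exists_union_matching h hω
  have hR : V' ⊆ Finset.Icc 1 (L + r) := by
    intro x hx
    obtain ⟨t, ht, y, hy, rfl⟩ := (hV' x).1 hx
    have := Finset.mem_Icc.1 (hV hy)
    rw [Finset.mem_insert, Finset.mem_singleton] at ht
    rw [Finset.mem_Icc]
    omega
  have heq : (coins (ℕ × Bool)).real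
      {ω | ∀ t ∈ ({0, r} : Finset ℕ), HasArcsAt (sideWord s ω) m t} = arcsProb m' (L + r) := by
    rw [← coins_hasArcs h' hR s]
    simp only [hasArcs_union_iff h h' hV' hm']
  rw [heq] at hne ⊢
  rw [pairMatching_eq h h' hdisj hV' hm']
  exact arcsProb_eq h' hR (even_innerVertices_of_arcsProb_ne_zero hne)

/-- For `n = 2k` this is `Cat k / 4 ^ k ≤ 1 / (k + 1)`, i.e. the central binomial coefficient is at
most `4 ^ k`. -/
theorem dyckProb_mul_le {n : ℕ} : dyckProb n * (2 + n) ≤ 2 := by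
  by_cases hn : Even n
  · obtain ⟨k, rfl⟩ := hn
    rw [← two_mul, dyckProb_two_mul, div_mul_eq_mul_div, div_le_iff₀ (by positivity)]
    have h1 := succ_mul_catalan_eq_centralBinom k
    have h2 : k.centralBinom ≤ 4 ^ k := by
      rw [Nat.centralBinom, show 4 = 2 ^ 2 by norm_num, ← pow_mul]
      exact Nat.choose_le_two_pow _ _
    rw [← h1] at h2
    have h3 : ((k : ℝ) + 1) * catalan k ≤ 4 ^ k := by exact_mod_cast h2
    push_cast
    linarith
  · rw [dyckProb, if_neg hn]
    norm_num

/-- By `x + y ≤ x * y` for `x, y ≥ 2`; the lower bound on the product carries the induction. -/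
theorem sum_le_prod_of_two_le {ι : Type*} {s : Finset ι} {f : ι → ℝ} (hf : ∀ i ∈ s, 2 ≤ f i)
    (hs : s.Nonempty) : ∑ i ∈ s, f i ≤ ∏ i ∈ s, f i ∧ 2 ≤ ∏ i ∈ s, f i := by
  induction hs using Finset.Nonempty.cons_induction with
  | singleton a => simpa using hf
  | cons a s ha hs ih =>
    have h1 := ih fun i hi => hf i (Finset.mem_cons_of_mem hi)
    have h2 := hf a (Finset.mem_cons_self a s)
    rw [Finset.sum_cons, Finset.prod_cons]
    constructor <;> nlinarith [h1.1, h1.2]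

namespace Shape

variable (S : Shape)

/-- The support points inside an arc are paired by `m`, so the odd gap condition makes every arc of
odd length. -/
theorem even_card_innerVertices {m : ℕ → ℕ} (h : IsNCMatching S.support m) {a : ℕ} (ha : a < m a) :
    Even (innerVertices m a).card := by
  refine _root_.even_card_innerVertices h (fun b hb => ?_) ha
  have hbV := h.mem_of_lt hb
  exact (odd_sub_iff S.odd_gap hbV (h.mem_of_mem hbV) hb).2 (even_card_inter_Ioo h b)

theorem occursProb_zero_eq_mul : S.occursProb {0} =
    arcsProb S.loop.upper (2 * S.halfLength) * arcsProb S.loop.lower (2 * S.halfLength) := by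
  rw [S.occursProb_eq_mul (R := 2 * S.halfLength) (by simp)]
  simp only [Finset.mem_singleton, forall_eq, hasArcsAt_zero]
  rw [coins_hasArcs S.loop.upper_nc S.subset_base, coins_hasArcs S.loop.lower_nc S.subset_base]

theorem density_eq : S.density = S.K *
    (2 ^ (outerVertices S.loop.upper (2 * S.halfLength)).card *
      2 ^ (outerVertices S.loop.lower (2 * S.halfLength)).card) / 2 ^ (4 * S.halfLength) := by
  rw [density, cPlus, cMinus, Real.rpow_sub four_pos, Real.rpow_sub four_pos, four_rpow_half,
    four_rpow_half, show (2 : ℝ) * S.halfLength = ((4 * S.halfLength : ℕ) : ℝ) / 2 by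
      push_cast; ring, four_rpow_half]
  field_simp

theorem occursProb_zero : S.occursProb {0} = S.density := by
  rw [occursProb_zero_eq_mul, density_eq, arcsProb_eq S.loop.upper_nc S.subset_base fun a ha =>
      S.even_card_innerVertices S.loop.upper_nc (Finset.mem_filter.1 ha).2,
    arcsProb_eq S.loop.lower_nc S.subset_base fun a ha =>
      S.even_card_innerVertices S.loop.lower_nc (Finset.mem_filter.1 ha).2, K,
    show 4 * S.halfLength = 2 * S.halfLength + 2 * S.halfLength by ring, pow_add]
  push_cast
  field_simp

theorem density_pos : 0 < S.density := by
  rw [density_eq]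
  have : (0 : ℝ) < S.K := by
    exact_mod_cast Nat.mul_pos (faceProduct_pos _ _) (faceProduct_pos _ _)
  positivity

/-- Two overlapping occurrences of a shape share no vertex. -/
theorem add_notMem_support {r : ℕ} (hr : 0 < r) {ω : ℕ × Bool → Bool} (h0 : S.Occurs 0 ω)
    (h1 : S.Occurs r ω) {y : ℕ} (hy : y ∈ S.support) : y + r ∉ S.support := by
  intro hyr
  -- A common vertex propagates along both matchings, hence around the whole loop, up to the last
  -- point `2ℓ`; but `2ℓ + r` is too large for the support.
  have key : ∀ z, S.loop.Joined y z → z ∈ S.support ∧ z + r ∈ S.support := by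
    intro z hz
    induction hz with
    | refl => exact ⟨hy, hyr⟩
    | @tail b c _ hbc ih =>
      rcases hbc with rfl | rfl
      · have := h0.1.eq_of_add_eq S.loop.upper_nc h1.1 ih.2 ih.1 rfl
        rw [add_zero] at this
        exact ⟨S.loop.upper_nc.mem_of_mem ih.1, this ▸ S.loop.upper_nc.mem_of_mem ih.2⟩
      · have := h0.2.eq_of_add_eq S.loop.lower_nc h1.2 ih.2 ih.1 rfl
        rw [add_zero] at this
        exact ⟨S.loop.lower_nc.mem_of_mem ih.1, this ▸ S.loop.lower_nc.mem_of_mem ih.2⟩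
  have h2 := (key _ (S.connected y hy _ S.last_mem)).2
  have := Finset.mem_Icc.1 (S.subset_base h2)
  omega

/-- In this form `b` is visibly the formula for the probability of two occurrences at distance `r`,
divided by the squared density. -/
theorem b_eq (r : ℕ) : S.b (r + 1) = S.pairK (r + 1) *
    (2 ^ (outerVertices (pairMatching r S.loop.upper) (2 * S.halfLength + r)).card *
      2 ^ (outerVertices (pairMatching r S.loop.lower) (2 * S.halfLength + r)).card) /
        2 ^ (2 * (2 * S.halfLength + r)) / S.density ^ 2 := by
  rw [b, pairHalfLength, pairCPlus, pairCMinus, density_eq, cPlus, cMinus, Nat.add_sub_cancel]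
  set o₁ := (outerVertices (pairMatching r S.loop.upper) (2 * S.halfLength + r)).card
  set o₂ := (outerVertices (pairMatching r S.loop.lower) (2 * S.halfLength + r)).card
  set o₃ := (outerVertices S.loop.upper (2 * S.halfLength)).card
  set o₄ := (outerVertices S.loop.lower (2 * S.halfLength)).card
  have e : 4 * (S.halfLength : ℝ) - 2 * (S.halfLength + (((r + 1 : ℕ) : ℝ) - 1) / 2) +
      (o₁ : ℝ) / 2 - 2 * ((o₃ : ℝ) / 2) + (o₂ : ℝ) / 2 - 2 * ((o₄ : ℝ) / 2) =
      ((8 * S.halfLength : ℕ) : ℝ) / 2 - ((2 * (2 * S.halfLength + r) : ℕ) : ℝ) / 2 +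
        (o₁ : ℝ) / 2 - ((2 * o₃ : ℕ) : ℝ) / 2 + (o₂ : ℝ) / 2 - ((2 * o₄ : ℕ) : ℝ) / 2 := by
    push_cast
    ring
  have hK : (S.K : ℝ) ≠ 0 := by
    exact_mod_cast (Nat.mul_pos (faceProduct_pos _ _) (faceProduct_pos _ _)).ne'
  rw [e, Real.rpow_sub four_pos, Real.rpow_add four_pos, Real.rpow_sub four_pos,
    Real.rpow_add four_pos, Real.rpow_sub four_pos]
  simp only [four_rpow_half]
  have e1 : (2 : ℝ) ^ (8 * S.halfLength) = (2 ^ (4 * S.halfLength)) ^ 2 := by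
    rw [← pow_mul]; ring_nf
  have e2 : ∀ o : ℕ, (2 : ℝ) ^ (2 * o) = (2 ^ o) ^ 2 := fun o => by rw [← pow_mul, mul_comm]
  rw [e1, e2 o₃, e2 o₄]
  field_simp

theorem occursProb_pair_eq {r : ℕ} (hr : 0 < r) (hne : S.occursProb {0, r} ≠ 0) :
    S.occursProb {0, r} = S.density ^ 2 * S.b (r + 1) := by
  obtain ⟨ω, hω⟩ := nonempty_of_measureReal_ne_zero (show (coins (ℕ × Bool)).real _ ≠ 0 from hne)
  have hdisj : ∀ y ∈ S.support, y + r ∉ S.support := fun y hy =>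
    S.add_notMem_support hr (hω 0 (by simp)) (hω r (by simp)) hy
  have hmul := S.occursProb_eq_mul (R := 2 * S.halfLength + r) (A := {0, r}) (by
    intro t ht
    rw [Finset.mem_insert, Finset.mem_singleton] at ht
    omega)
  rw [hmul] at hne
  have hu := coins_hasArcsAt_pair S.loop.upper_nc S.subset_base hdisj (left_ne_zero_of_mul hne)
  have hl := coins_hasArcsAt_pair S.loop.lower_nc S.subset_base hdisj (right_ne_zero_of_mul hne)
  have hd := S.density_pos.ne'
  rw [hmul, hu, hl, b_eq, pairK, Nat.add_sub_cancel, mul_div_cancel₀ _ (pow_ne_zero 2 hd),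
    two_mul (2 * S.halfLength + r), pow_add _ (2 * S.halfLength + r)]
  push_cast
  ring

/-- A meandric system with both components has positive probability among random words. Conversely,
if both occurrences are possible, the factorised probability that both words are moreover Dyck is
still positive. Size `2ℓ` is enough, since words of length `4ℓ` contain both windows. -/
theorem mem_overlaps_iff {r : ℕ} (hr : 0 < r) (hr' : r < 2 * S.halfLength) :
    r + 1 ∈ S.overlaps ↔ S.occursProb {0, r} ≠ 0 := by
  classical
  rw [overlaps, Finset.mem_filter, Finset.mem_Ioc, and_iff_right (by omega)]
  constructor
  · rintro ⟨n, M, h0, h1⟩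
    have h0' := MeandricSystem.hasShapeAt_iff.1 (show M.HasShapeAt S (1 + 0) from h0)
    rw [add_comm] at h1
    have h1' := MeandricSystem.hasShapeAt_iff.1 h1
    have hsub : {ω | MeandricSystem.Encodes M ω} ⊆
        {ω | ∀ t ∈ ({0, r} : Finset ℕ), S.Occurs t ω} := by
      intro ω hω t ht
      rw [Finset.mem_insert, Finset.mem_singleton] at ht
      rcases ht with rfl | rfl
      · exact (MeandricSystem.Encodes.occurs_iff hω h0'.1).2 h0'.2
      · exact (MeandricSystem.Encodes.occurs_iff hω h1'.1).2 h1'.2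
    have h2 := measureReal_mono (μ := coins (ℕ × Bool)) hsub
    rw [MeandricSystem.coins_encodes] at h2
    exact ((by positivity : (0 : ℝ) < (1 / 2) ^ (4 * n)).trans_le h2).ne'
  · intro hne
    have hA : ∀ t ∈ ({0, r} : Finset ℕ), t + 2 * S.halfLength ≤ 2 * (2 * S.halfLength) := by
      intro t ht
      rw [Finset.mem_insert, Finset.mem_singleton] at ht
      omega
    obtain ⟨i, j, -, -, -, -, h⟩ := S.coins_occurs_and_bothDyck hA
    have hpos : S.occursProb {0, r} * (dyckProb (2 * i) * dyckProb (2 * j)) ≠ 0 :=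
      mul_ne_zero hne (mul_ne_zero (dyckProb_pos (even_two_mul i)).ne'
        (dyckProb_pos (even_two_mul j)).ne')
    rw [← h] at hpos
    obtain ⟨ω, hoc, hD⟩ := nonempty_of_measureReal_ne_zero hpos
    obtain ⟨M, hM⟩ := MeandricSystem.bothDyck_iff_exists_encodes.1 hD
    refine ⟨_, M, ?_, ?_⟩
    · exact MeandricSystem.hasShapeAt_iff (t := 0).2
        ⟨hA 0 (by simp), (hM.occurs_iff (hA 0 (by simp))).1 (hoc 0 (by simp))⟩
    · rw [add_comm]
      exact MeandricSystem.hasShapeAt_iff.2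
        ⟨hA r (by simp), (hM.occurs_iff (hA r (by simp))).1 (hoc r (by simp))⟩

theorem sum_occursProb_pair : ∑ r ∈ Finset.Ioo 0 (2 * S.halfLength), S.occursProb {0, r} =
    S.density ^ 2 * ∑ i ∈ S.overlaps, S.b i := by
  classical
  have h1 : ∑ r ∈ Finset.Ioo 0 (2 * S.halfLength), S.occursProb {0, r} =
      ∑ r ∈ Finset.Ioo 0 (2 * S.halfLength) with r + 1 ∈ S.overlaps,
        S.density ^ 2 * S.b (r + 1) := by
    rw [Finset.sum_filter]
    refine Finset.sum_congr rfl fun r hr => ?_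
    rw [Finset.mem_Ioo] at hr
    have h := S.mem_overlaps_iff hr.1 hr.2
    split_ifs with hmem
    · exact S.occursProb_pair_eq hr.1 (h.1 hmem)
    · exact not_not.1 fun hne => hmem (h.2 hne)
  rw [h1, Finset.mul_sum]
  refine Finset.sum_nbij' (· + 1) (· - 1) ?_ ?_ ?_ ?_ ?_
  · intro r hr
    exact (Finset.mem_filter.1 hr).2
  · intro i hi
    have h2 := Finset.mem_Ioc.1 (Finset.mem_filter.1 hi).1
    rw [Finset.mem_filter, Finset.mem_Ioo, Nat.sub_add_cancel (by omega)]
    exact ⟨by omega, hi⟩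
  · intro r _
    rfl
  · intro i hi
    have h2 := Finset.mem_Ioc.1 (Finset.mem_filter.1 hi).1
    exact Nat.sub_add_cancel (by omega)
  · intro r _
    rfl

/-- The variance subtracts one squared density and each of the `2ℓ - 1` doubled covariances
subtracts two, in total `4ℓ - 1`. -/
theorem two_mul_letterVar : 2 * S.letterVar = 2 * S.density *
    (1 + S.density * (1 - 4 * (S.halfLength : ℝ) + 2 * ∑ i ∈ S.overlaps, S.b i)) := by
  have hL := S.halfLength_pos
  rw [letterVar, IsDependentSequence.asympVar, Finset.sum_sub_distrib, sum_occursProb_pair,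
    Finset.pair_eq_singleton, occursProb_zero, Finset.sum_const, Nat.card_Ioo, nsmul_eq_mul,
    Nat.sub_zero, Nat.cast_sub (by omega)]
  push_cast
  ring

/-! ### Positivity of the variance -/

/-- Take `w` to be the product over arcs of `2 * (2 + I)`, with `I` the number of inner points. Each
factor is compensated by `dyckProb I / 4`, and the product dominates the sum, which `card_faces`
evaluates. -/
theorem exists_le_and_arcsProb_mul_le_one {m : ℕ → ℕ} (h : IsNCMatching S.support m) :
    ∃ w : ℝ, 2 ≤ w ∧ arcsProb m (2 * S.halfLength) * w ≤ 1 ∧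
      2 * (2 * S.halfLength - (outerVertices m (2 * S.halfLength)).card) ≤ w := by
  set I := (Finset.Icc 1 (2 * S.halfLength)).filter fun a => a < m a with hI
  set f : ℕ → ℝ := fun a => 2 * (2 + (innerVertices m a).card) with hf
  have hI0 : I.Nonempty := by
    refine ⟨1, Finset.mem_filter.2 ⟨S.subset_base S.one_mem, ?_⟩⟩
    have h1 := Finset.mem_Icc.1 (S.subset_base (h.mem_of_mem S.one_mem))
    have h2 := (h.ne_iff 1).2 S.one_mem
    omega
  obtain ⟨h1, h2⟩ := sum_le_prod_of_two_le (s := I) (f := f)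
    (fun i _ => by simp only [hf]; linarith [Nat.cast_nonneg (α := ℝ) (innerVertices m i).card]) hI0
  refine ⟨∏ a ∈ I, f a, h2, ?_, le_trans (le_of_eq ?_) h1⟩
  · rw [arcsProb, ← Finset.prod_mul_distrib]
    refine Finset.prod_le_one (fun a _ => ?_) fun a _ => ?_
    · exact mul_nonneg (div_nonneg (dyckProb_nonneg _) four_pos.le) (by positivity)
    · have := dyckProb_mul_le (n := (innerVertices m a).card)
      simp only [hf]
      linarith
  · have h3 := card_faces h S.subset_base
    have h4 : (2 : ℝ) * S.halfLength = (outerVertices m (2 * S.halfLength)).card +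
        ∑ a ∈ I, (2 + ((innerVertices m a).card : ℝ)) := by exact_mod_cast h3
    rw [← Finset.mul_sum]
    linarith

/-- At a point exposed on both sides no arc passes over or under, so the loop, starting at `1`,
could never get past it to `2ℓ`. -/
theorem disjoint_outerVertices : Disjoint (outerVertices S.loop.upper (2 * S.halfLength))
    (outerVertices S.loop.lower (2 * S.halfLength)) := by
  rw [Finset.disjoint_left]
  intro x hu hl
  rw [mem_outerVertices] at hu hl
  have key : ∀ y, S.loop.Joined 1 y → y < x := by
    intro y hy
    induction hy with
    | refl =>
      refine lt_of_le_of_ne hu.1.1 fun hx => (S.loop.upper_nc.ne_iff 1).2 S.one_mem ?_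
      rw [hx]
      exact hu.2.1
    | @tail b c _ hbc ih =>
      rcases hbc with rfl | rfl
      · refine lt_of_le_of_ne (not_lt.1 (hu.2.2 b ih)) fun hx => ?_
        have := S.loop.upper_nc.invol b
        rw [hx, hu.2.1] at this
        omega
      · refine lt_of_le_of_ne (not_lt.1 (hl.2.2 b ih)) fun hx => ?_
        have := S.loop.lower_nc.invol b
        rw [hx, hl.2.1] at this
        omega
  have := key _ (S.connected 1 S.one_mem _ S.last_mem)
  omega

/-- The two exposed sets are disjoint, so together they have at most `2ℓ` points and the two weights
satisfy `w + z ≥ 4ℓ`; both being at least `2`, also `w * z ≥ 4ℓ`. -/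
theorem density_mul_le_one : S.density * (4 * S.halfLength) ≤ 1 := by
  obtain ⟨w, hw2, hw, hw'⟩ := S.exists_le_and_arcsProb_mul_le_one S.loop.upper_nc
  obtain ⟨z, hz2, hz, hz'⟩ := S.exists_le_and_arcsProb_mul_le_one S.loop.lower_nc
  have hcard : ((outerVertices S.loop.upper (2 * S.halfLength)).card : ℝ) +
      (outerVertices S.loop.lower (2 * S.halfLength)).card ≤ 2 * S.halfLength := by
    have h1 : outerVertices S.loop.upper (2 * S.halfLength) ∪
        outerVertices S.loop.lower (2 * S.halfLength) ⊆ Finset.Icc 1 (2 * S.halfLength) :=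
      Finset.union_subset (Finset.filter_subset _ _) (Finset.filter_subset _ _)
    have h2 := Finset.card_le_card h1
    rw [Finset.card_union_of_disjoint S.disjoint_outerVertices, Nat.card_Icc] at h2
    exact_mod_cast (by omega)
  have hnn : ∀ m, 0 ≤ arcsProb m (2 * S.halfLength) := fun m =>
    Finset.prod_nonneg fun a _ => div_nonneg (dyckProb_nonneg _) four_pos.le
  have hwz : 4 * (S.halfLength : ℝ) ≤ w * z := by nlinarith
  calc S.density * (4 * S.halfLength) ≤ S.density * (w * z) :=
        mul_le_mul_of_nonneg_left hwz S.density_pos.le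
    _ = (arcsProb S.loop.upper (2 * S.halfLength) * w) *
        (arcsProb S.loop.lower (2 * S.halfLength) * z) := by
        rw [← occursProb_zero, occursProb_zero_eq_mul]
        ring
    _ ≤ 1 * 1 := mul_le_mul hw hz (mul_nonneg (hnn _) (by linarith)) one_pos.le
    _ = 1 := one_mul 1

/-- Overlaps contribute nonnegatively, and `density_mul_le_one` leaves at least the density itself
in the bracket. -/
theorem letterVar_pos : 0 < S.letterVar := by
  have hd := S.density_pos
  have h1 := S.density_mul_le_one
  have h2 : 0 ≤ ∑ i ∈ S.overlaps, S.b i :=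
    Finset.sum_nonneg fun i _ => by unfold b; positivity
  have h3 : 0 ≤ S.density * ∑ i ∈ S.overlaps, S.b i := mul_nonneg hd.le h2
  have h4 : 0 < 1 + S.density * (1 - 4 * (S.halfLength : ℝ) + 2 * ∑ i ∈ S.overlaps, S.b i) := by
    nlinarith
  have h5 := mul_pos (mul_pos two_pos hd) h4
  rw [← two_mul_letterVar] at h5
  linarith

end Shape

/-! ### The central limit theorem for the number of components of a given shape -/

theorem theorem1p1 (S : Shape) :
    ∃ μ σ : ℝ, 0 < μ ∧ 0 < σ ∧
      μ = 2 * S.density ∧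
      σ ^ 2 = 2 * S.density *
        (1 + S.density * (1 - 4 * (S.halfLength : ℝ) + 2 * ∑ i ∈ S.overlaps, S.b i)) ∧
      TendstoInDistribution
        (fun (n : ℕ) (M : MeandricSystem n) =>
          ((M.numComponents S : ℝ) - n * μ) / (σ * Real.sqrt n))
        atTop (id : ℝ → ℝ) uniformMeandric (gaussianReal 0 1) := by
  have hv : 0 < 2 * S.letterVar := mul_pos two_pos S.letterVar_pos
  have hσ : √(2 * S.letterVar) ^ 2 = 2 * S.letterVar := Real.sq_sqrt hv.le
  refine ⟨2 * S.density, √(2 * S.letterVar), mul_pos two_pos S.density_pos, Real.sqrt_pos.2 hv,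
    rfl, hσ.trans S.two_mul_letterVar, ?_⟩
  rw [← S.occursProb_zero]
  exact S.tendstoInDistribution_of_sq_eq (Real.sqrt_pos.2 hv) hσ
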